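/- **Setting.** For a probability measure $\nu$ on $\mathbb{R}^d$, $\theta\in\mathbb{R}^d$ and $\sigma>0$, let $P_{\theta,\sigma}$ be the law of $(Y,X)\in\mathbb{R}\times\mathbb{R}^d$ where $X\sim\nu$, $\epsilon\sim N(0,\sigma^2)$ is independent of $X$ and $Y=X^\top\theta+\epsilon$; let $p_{\theta,\sigma}(y,x)$ be the $N(x^\top\theta,\sigma^2)$ density at $y$ (the density of $P_{\theta,\sigma}$ with respect to $\mathrm{Lebesgue}\otimes\nu$). For $\alpha\in(0,1)$ let $D_\alpha(P,R)=\frac{1}{\alpha-1}\log\int (\frac{dP}{d\mu})^\alpha(\frac{dR}{d\mu})^{1-\alpha}d\mu$ (for any $\mu$ dominating $P$ and $R$) be the $\alpha$-Rényi divergence, and let $\mathcal K$ be the Kullback–Leibler divergence. **Prior and fractional posterior.** Given $C_1>0$, $\tau>0$, $a>0$, $b>0$, let $\pi$ be the prior under which $\theta$ and $\sigma$ are independent, $\theta$ has density $\propto\prod_{i=1}^d(\tau^2+\theta_i^2)^{-2}$ on the ball $B_1(C_1)=\{\theta:\|\theta\|_1\le C_1\}$, and $\sigma^2\sim \mathrm{IG}(a,b)$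 (inverse-Gamma, density $\frac{b^a}{\Gamma(a)}x^{-a-1}e^{-b/x}$ on $(0,\infty)$). Given observations $Z_1,\dots,Z_n$ with $Z_i=(Y_i,X_i)$, the $\alpha$-fractional posterior is $\Pi_{n,\alpha}(d\theta,d\sigma)\propto \big(\prod_{i=1}^n p_{\theta,\sigma}(Z_i)\big)^\alpha\,\pi(d\theta,d\sigma)$. **Theorem.** Let $a>0$ and $\sigma_{\min}>0$. There is a constant $c>0$ depending only on $\sigma_{\min}$ and $a$ such that the following holds. Let $\alpha\in(0,1)$, let $n,d$ be positive integers, $\nu$ a probability measure on $\mathbb{R}^d$, $\theta_0\in\mathbb{R}^d$ with $s^*:=\|\theta_0\|_0$ satisfying $1\le s^*<n<d$, and $\sigma_0>0$ with $\sigma_0^2>(2\sigma_{\min})^{-1}$. Let $C_{\rm x}>0$ with $\mathbb{E}\|X_1\|_2^2<C_{\rm x}^2$ for $X_1\sim\nu$, put $\tau=(C_{\rm x}\sqrt{nd})^{-1}$ and $b=n^{-1/2}$, and suppose $\|\theta_0\|_1\le C_1-2d\tau$. Let $\Theta\subset\mathbb{R}^d$ be any model set, which need not contain $\theta_0$. Then,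 for $Z_1,\dots,Z_n$ i.i.d. from $P_{\theta_0,\sigma_0}$, $$\mathbb{E}\left[\int D_\alpha(P_{\theta,\sigma},P_{\theta_0,\sigma_0})\,\Pi_{n,\alpha}(d\theta,d\sigma)\right]\le\frac{\alpha}{1-\alpha}\inf_{\theta\in\Theta}\mathcal K(P_{\theta_0,\sigma_0},P_{\theta,\sigma_0})+c\,\frac{1+\alpha}{1-\alpha}\,\varepsilon_n,\qquad \varepsilon_n=\frac{s^*}{n}\log\left(\frac{C_{\rm x}C_1\sqrt{nd}}{s^*}\right).$$ (The infimum is the minimum whenever the minimum is attained.) -/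

import Mathlib

open MeasureTheory ProbabilityTheory
open scoped ENNReal

/-- Normalization of a measure to total mass one (meaningful when the total mass is neither `0`
nor `∞`): the probability measure "proportional to" `μ`. -/
noncomputable def normalizeMeasure {Ω : Type*} [MeasurableSpace Ω] (μ : Measure Ω) : Measure Ω :=
  (μ Set.univ)⁻¹ • μ

/-- The `α`-Rényi divergence
`D_α(P, R) = (α - 1)⁻¹ log ∫ (dP/dμ)^α (dR/dμ)^(1-α) dμ` for `α ∈ (0,1)`, with the dominating
measure `μ = P + R` (the value does not depend on the dominating measure).  It is valued in
`[0, ∞]`; it is `∞` exactly when the integral vanishes, since `ENNReal.log 0 = ⊥`. -/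
noncomputable def renyiDiv {Ω : Type*} [MeasurableSpace Ω] (α : ℝ) (P R : Measure Ω) : ℝ≥0∞ :=
  ((((α - 1)⁻¹ : ℝ) : EReal) * ENNReal.log
    (∫⁻ z, P.rnDeriv (P + R) z ^ α * R.rnDeriv (P + R) z ^ (1 - α) ∂(P + R))).toENNReal

/-- The law `P_{θ,σ}` of one observation `Z = (Y, X)` of the random design linear regression model:
`X` has law `ν`, `ε ∼ N(0, σ²)` is independent of `X`, and `Y = Xᵀθ + ε`. -/
noncomputable def linModel {d : ℕ} (ν : Measure (EuclideanSpace ℝ (Fin d)))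
    (θ : EuclideanSpace ℝ (Fin d)) (σ : ℝ) : Measure (ℝ × EuclideanSpace ℝ (Fin d)) :=
  (ν.prod (gaussianReal 0 (σ ^ 2).toNNReal)).map (fun w => (inner ℝ w.1 θ + w.2, w.1))

/-- The density `p_{θ,σ}(y, x)` of `P_{θ,σ}` with respect to the product of Lebesgue measure and
the law of the design (see `linModel_eq_withDensity`): the `N(xᵀθ, σ²)` density at `y`. -/
noncomputable def linDensity {d : ℕ} (θ : EuclideanSpace ℝ (Fin d)) (σ : ℝ)
    (z : ℝ × EuclideanSpace ℝ (Fin d)) : ℝ :=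
  gaussianPDFReal (inner ℝ z.2 θ) (σ ^ 2).toNNReal z.1

theorem linModel_eq_withDensity {d : ℕ} (ν : Measure (EuclideanSpace ℝ (Fin d)))
    [IsProbabilityMeasure ν] (θ : EuclideanSpace ℝ (Fin d)) (σ : ℝ) (hσ : 0 < σ) :
    linModel ν θ σ =
      ((volume : Measure ℝ).prod ν).withDensity (fun z => ENNReal.ofReal (linDensity θ σ z)) := by
  have hv : (σ ^ 2).toNNReal ≠ 0 := by
    simp only [ne_eq, Real.toNNReal_eq_zero, not_le]; positivity
  have hdm : Measurable (fun z : ℝ × EuclideanSpace ℝ (Fin d) =>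
      ENNReal.ofReal (linDensity θ σ z)) := by
    unfold linDensity gaussianPDFReal; fun_prop
  have hm : Measurable (fun w : EuclideanSpace ℝ (Fin d) × ℝ =>
      ((inner ℝ w.1 θ + w.2, w.1) : ℝ × EuclideanSpace ℝ (Fin d))) := by fun_prop
  ext s hs
  rw [linModel, Measure.map_apply hm hs, Measure.prod_apply (hm hs), withDensity_apply _ hs,
    ← lintegral_indicator hs, lintegral_prod_symm _ ((hdm.indicator hs).aemeasurable)]
  refine lintegral_congr fun x => ?_
  have hsx : MeasurableSet {y : ℝ | (y, x) ∈ s} := (measurable_id.prodMk measurable_const) hs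
  have h1 : Prod.mk x ⁻¹' ((fun w : EuclideanSpace ℝ (Fin d) × ℝ =>
      ((inner ℝ w.1 θ + w.2, w.1) : ℝ × EuclideanSpace ℝ (Fin d))) ⁻¹' s)
      = (fun e : ℝ => inner ℝ x θ + e) ⁻¹' {y : ℝ | (y, x) ∈ s} := rfl
  rw [h1, ← Measure.map_apply (by fun_prop) hsx, gaussianReal_map_const_add, zero_add,
    gaussianReal_apply _ hv, ← lintegral_indicator hsx]
  rfl

/-- The `ℓ₁` ball `B₁(C)`. -/
def l1Ball (d : ℕ) (C : ℝ) : Set (EuclideanSpace ℝ (Fin d)) := {θ | ∑ i, |θ i| ≤ C}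

/-- The `ℓ₀` quasi-norm: the number of nonzero entries. -/
noncomputable def sparsity {d : ℕ} (θ : EuclideanSpace ℝ (Fin d)) : ℕ :=
  Set.ncard {i : Fin d | θ i ≠ 0}

/-- The scaled Student prior on the `ℓ₁` ball `B₁(C₁)`:
`π_θ(θ) ∝ ∏ᵢ (τ² + θᵢ²)⁻²` for `θ ∈ B₁(C₁)`. -/
noncomputable def priorTheta (d : ℕ) (C₁ τ : ℝ) : Measure (EuclideanSpace ℝ (Fin d)) :=
  normalizeMeasure ((volume.restrict (l1Ball d C₁)).withDensity
    (fun θ => ENNReal.ofReal (∏ i, ((τ ^ 2 + θ i ^ 2) ^ 2)⁻¹)))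

/-- The inverse-Gamma distribution `IG(a, b)`: the law on `(0, ∞)` with density
`b^a / Γ(a) x^(-a-1) exp(-b/x)`. -/
noncomputable def invGammaMeasure (a b : ℝ) : Measure ℝ :=
  (volume.restrict (Set.Ioi 0)).withDensity
    (fun x => ENNReal.ofReal (b ^ a / Real.Gamma a * x ^ (-a - 1) * Real.exp (-(b / x))))

/-- The prior on `σ`: the law of `σ > 0` when `σ² ∼ IG(a, b)`. -/
noncomputable def priorSigma (a b : ℝ) : Measure ℝ := (invGammaMeasure a b).map Real.sqrt

/-- The `α`-fractional posterior `Π_{n,α}(dθ, dσ) ∝ L_n(θ,σ)^α π(dθ, dσ)` given the sample `z`,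
where `L_n(θ,σ) = ∏ᵢ p_{θ,σ}(zᵢ)`. -/
noncomputable def fracPosterior {d n : ℕ} (π : Measure (EuclideanSpace ℝ (Fin d) × ℝ)) (α : ℝ)
    (z : Fin n → ℝ × EuclideanSpace ℝ (Fin d)) : Measure (EuclideanSpace ℝ (Fin d) × ℝ) :=
  normalizeMeasure (π.withDensity
    (fun q => ENNReal.ofReal ((∏ i, linDensity q.1 q.2 (z i)) ^ α)))

/-- The rate `ε_n = s* log(C_x C₁ √(nd) / s*) / n`. -/
noncomputable def sparseRate (n d s : ℕ) (Cx C₁ : ℝ) : ℝ :=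
  (s : ℝ) * Real.log (Cx * C₁ * √((n : ℝ) * (d : ℝ)) / (s : ℝ)) / (n : ℝ)

/-! ### The Rényi divergence in terms of densities -/

/-! More is true than is claimed: the left side is at most `c ε_n / (1 - α)`, and the
Kullback–Leibler term is added for free. Let `ℓ = -log` of the affinity `∫ p_{θ,σ}^α
p_{θ₀,σ₀}^(1-α)`, so that `D_α = ℓ / (1 - α)`. With `Q = C_x C₁ √(nd)` and `A = s* log (Q / s*)`, it
is enough to bound the expected posterior mean of `n ℓ` by a multiple of `A`.

The affinity is the expectation, under the truth, of the `α`-th power of the likelihood ratio. Hence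
`e^{nℓ}` times the `n`-fold ratio has expectation one at every parameter, and Fubini carries this
through the prior. Linearizing the exponential bounds the posterior mean of `n ℓ` by `κ + E G + 1`,
whenever a set of prior mass at least `e^{-κ}` has all its likelihoods within a factor `e^G` of the
true one (`lintegral_affinityLoss_fracPosterior_le`). The set used is a ball of radius `2τ√d` around
`θ₀` times a window of relative width `1/n` just above `σ₀²`. There `E G = O(1)`
(`prod_linDensity_le_near`, `lintegral_likelihoodBound_le`). Polynomial tails of the Student weight
make the cost in `θ` logarithmic and charge only nonzero coordinates (`priorTheta_ball_ge`,
`sum_shiftCost_le`). The cost in `σ` is `a log σ₀² + (1 + a/2) log n + O(1)`.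

Since `σ₀` has no upper bound, `log σ₀²` need not be of order `A`; the argument above covers `σ₀² ≤
Q^16`. Beyond that the signal is negligible against the noise and the variance is handled exactly
(`exists_lintegral_loss_le_of_large_noise`). Given `θ`, the posterior of `σ²` is inverse-Gamma by
conjugacy, and the loss averaged over it is, up to `O(1)`, the loss at the posterior mean of the
precision (`exists_posterior_loss_le`). That loss is governed by `n (q - 1 - log q)`, where `q` is
the mean of the squared standardized noise (`scaleLoss_posterior_le`). Its expectation is `O(1)`
(`exists_lintegral_entropy_le`), and the event on which the signal is not dominated is polynomially
rare in `σ₀`. In this regime the total is bounded by a constant, hence by a multiple of `A ≥ 1/2`.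
-/

/-- The integrand is homogeneous of degree one in the pair of densities, so dividing both by `p + r`
is undone by integrating against `(p + r) μ`. Positivity and finiteness exclude `0/0` and `∞/∞`. -/
theorem lintegral_rnDeriv_add_rpow {Ω : Type*} [MeasurableSpace Ω] (μ : Measure Ω)
    {p r : Ω → ℝ≥0∞} (hp : Measurable p) (hr : Measurable r)
    (hp0 : ∀ z, p z ≠ 0) (hpt : ∀ z, p z ≠ ∞) (hrt : ∀ z, r z ≠ ∞)
    [IsFiniteMeasure (μ.withDensity p)] [IsFiniteMeasure (μ.withDensity r)]
    {α : ℝ} (h0 : 0 < α) (h1 : α < 1) :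
    ∫⁻ z, (μ.withDensity p).rnDeriv (μ.withDensity p + μ.withDensity r) z ^ α *
      (μ.withDensity r).rnDeriv (μ.withDensity p + μ.withDensity r) z ^ (1 - α)
        ∂(μ.withDensity p + μ.withDensity r) = ∫⁻ z, p z ^ α * r z ^ (1 - α) ∂μ := by
  set P := μ.withDensity p with hP
  set R := μ.withDensity r with hR
  have hs : P + R = μ.withDensity (p + r) := (withDensity_add_left hp r).symm
  have hsm : Measurable (p + r) := hp.add hr
  have hs0 : ∀ z, p z + r z ≠ 0 := fun z h => hp0 z (by simp at h; exact h.1)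
  have hst : ∀ z, p z + r z ≠ ∞ := fun z => ENNReal.add_ne_top.2 ⟨hpt z, hrt z⟩
  have key : ∀ f : Ω → ℝ≥0∞, Measurable f →
      (μ.withDensity f).rnDeriv (P + R) =ᵐ[P + R] fun z => f z / (p z + r z) := by
    intro f hf
    have hq : Measurable fun z => f z / (p z + r z) := hf.div hsm
    have : μ.withDensity f = (P + R).withDensity (fun z => f z / (p z + r z)) := by
      rw [hs, ← withDensity_mul _ hsm hq]
      congr 1
      ext z
      simp only [Pi.mul_apply, Pi.add_apply]
      rw [ENNReal.mul_div_cancel (hs0 z) (hst z)]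
    rw [this]
    exact Measure.rnDeriv_withDensity _ hq
  have e : (fun z => P.rnDeriv (P + R) z ^ α * R.rnDeriv (P + R) z ^ (1 - α)) =ᵐ[P + R]
      fun z => (p z / (p z + r z)) ^ α * (r z / (p z + r z)) ^ (1 - α) := by
    filter_upwards [key p hp, key r hr] with z hz1 hz2
    rw [hP, hR, hz1, hz2]
  rw [lintegral_congr_ae e, hs, lintegral_withDensity_eq_lintegral_mul _ hsm (by fun_prop)]
  refine lintegral_congr fun z => ?_
  simp only [Pi.mul_apply, Pi.add_apply]
  rw [ENNReal.div_rpow_of_nonneg _ _ h0.le, ENNReal.div_rpow_of_nonneg _ _ (by linarith)]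
  have e1 : p z + r z = (p z + r z) ^ α * (p z + r z) ^ (1 - α) := by
    rw [← ENNReal.rpow_add _ _ (hs0 z) (hst z)]; simp
  have n1 : (p z + r z) ^ α ≠ 0 := by simp [ENNReal.rpow_eq_zero_iff, hs0 z, hst z]
  have n2 : (p z + r z) ^ (1 - α) ≠ 0 := by simp [ENNReal.rpow_eq_zero_iff, hs0 z, hst z]
  have t1 : (p z + r z) ^ α ≠ ∞ := ENNReal.rpow_ne_top_of_nonneg h0.le (hst z)
  have t2 : (p z + r z) ^ (1 - α) ≠ ∞ := ENNReal.rpow_ne_top_of_nonneg (by linarith) (hst z)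
  calc _ = ((p z + r z) ^ α * (p z + r z) ^ (1 - α)) *
        (p z ^ α / (p z + r z) ^ α * (r z ^ (1 - α) / (p z + r z) ^ (1 - α))) := by rw [← e1]
    _ = ((p z + r z) ^ α * (p z ^ α / (p z + r z) ^ α)) *
        ((p z + r z) ^ (1 - α) * (r z ^ (1 - α) / (p z + r z) ^ (1 - α))) := by ring
    _ = _ := by rw [ENNReal.mul_div_cancel n1 t1, ENNReal.mul_div_cancel n2 t2]

/-! ### Affinities between Gaussian regression laws. -/

theorem gaussianPDFReal_eq_exp (m : ℝ) {v : ℝ} (hv : 0 < v) (y : ℝ) :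
    gaussianPDFReal m v.toNNReal y =
      Real.exp (-(Real.log (2 * Real.pi) + Real.log v) / 2 - (y - m) ^ 2 / (2 * v)) := by
  have h2 : (0 : ℝ) < 2 * Real.pi := by positivity
  rw [gaussianPDFReal, Real.coe_toNNReal _ hv.le, sub_eq_add_neg (-_ / 2), Real.exp_add,
    ← Real.log_mul h2.ne' hv.ne']
  congr 1
  · rw [← Real.sqrt_inv, Real.sqrt_eq_rpow, Real.rpow_def_of_pos (by positivity), Real.log_inv]
    congr 1; ring
  · congr 1; ring

theorem linDensity_eq_exp {d : ℕ} (θ : EuclideanSpace ℝ (Fin d)) {σ : ℝ} (hσ : 0 < σ)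
    (z : ℝ × EuclideanSpace ℝ (Fin d)) :
    linDensity θ σ z = Real.exp (-(Real.log (2 * Real.pi) + Real.log (σ ^ 2)) / 2
      - (z.1 - inner ℝ z.2 θ) ^ 2 / (2 * σ ^ 2)) :=
  gaussianPDFReal_eq_exp _ (by positivity) _

theorem linDensity_pos {d : ℕ} (θ : EuclideanSpace ℝ (Fin d)) {σ : ℝ} (hσ : 0 < σ)
    (z : ℝ × EuclideanSpace ℝ (Fin d)) : 0 < linDensity θ σ z := by
  rw [linDensity_eq_exp θ hσ]; exact Real.exp_pos _

theorem linDensity_nonneg {d : ℕ} (θ : EuclideanSpace ℝ (Fin d)) (σ : ℝ)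
    (z : ℝ × EuclideanSpace ℝ (Fin d)) : 0 ≤ linDensity θ σ z :=
  gaussianPDFReal_nonneg _ _ _

@[fun_prop]
theorem Measurable.linDensity {d : ℕ} {Ω : Type*} [MeasurableSpace Ω]
    {θ : Ω → EuclideanSpace ℝ (Fin d)} {σ : Ω → ℝ} {z : Ω → ℝ × EuclideanSpace ℝ (Fin d)}
    (hθ : Measurable θ) (hσ : Measurable σ) (hz : Measurable z) :
    Measurable fun w => linDensity (θ w) (σ w) (z w) := by
  unfold _root_.linDensity gaussianPDFReal; fun_prop

instance isProbabilityMeasure_linModel {d : ℕ} (ν : Measure (EuclideanSpace ℝ (Fin d)))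
    [IsProbabilityMeasure ν] (θ : EuclideanSpace ℝ (Fin d)) (σ : ℝ) :
    IsProbabilityMeasure (linModel ν θ σ) := by
  unfold linModel
  exact Measure.isProbabilityMeasure_map (by fun_prop)

/-- The Hellinger-type affinity `∫ p_{θ,σ}^α p_{θ₀,σ₀}^(1-α)`. -/
noncomputable def linAffinity {d : ℕ} (ν : Measure (EuclideanSpace ℝ (Fin d))) (α : ℝ)
    (θ₀ : EuclideanSpace ℝ (Fin d)) (σ₀ : ℝ) (q : EuclideanSpace ℝ (Fin d) × ℝ) : ℝ≥0∞ :=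
  ∫⁻ z, ENNReal.ofReal (linDensity q.1 q.2 z ^ α * linDensity θ₀ σ₀ z ^ (1 - α))
    ∂((volume : Measure ℝ).prod ν)

theorem measurable_linAffinity {d : ℕ} (ν : Measure (EuclideanSpace ℝ (Fin d)))
    [IsProbabilityMeasure ν] (α : ℝ) (θ₀ : EuclideanSpace ℝ (Fin d)) (σ₀ : ℝ) :
    Measurable (linAffinity ν α θ₀ σ₀) := by
  unfold linAffinity
  refine Measurable.lintegral_prod_right' (f := fun w : (EuclideanSpace ℝ (Fin d) × ℝ) ×
    (ℝ × EuclideanSpace ℝ (Fin d)) =>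
    ENNReal.ofReal (linDensity w.1.1 w.1.2 w.2 ^ α * linDensity θ₀ σ₀ w.2 ^ (1 - α))) ?_
  fun_prop

theorem renyiDiv_linModel {d : ℕ} (ν : Measure (EuclideanSpace ℝ (Fin d)))
    [IsProbabilityMeasure ν] {α : ℝ} (h0 : 0 < α) (h1 : α < 1)
    (θ θ₀ : EuclideanSpace ℝ (Fin d)) {σ σ₀ : ℝ} (hσ : 0 < σ) (hσ₀ : 0 < σ₀) :
    renyiDiv α (linModel ν θ σ) (linModel ν θ₀ σ₀) =
      ((((α - 1)⁻¹ : ℝ) : EReal) * ENNReal.log (linAffinity ν α θ₀ σ₀ (θ, σ))).toENNReal := by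
  have i1 : IsFiniteMeasure (((volume : Measure ℝ).prod ν).withDensity
      (fun z => ENNReal.ofReal (linDensity θ σ z))) := by
    rw [← linModel_eq_withDensity ν θ σ hσ]; infer_instance
  have i2 : IsFiniteMeasure (((volume : Measure ℝ).prod ν).withDensity
      (fun z => ENNReal.ofReal (linDensity θ₀ σ₀ z))) := by
    rw [← linModel_eq_withDensity ν θ₀ σ₀ hσ₀]; infer_instance
  unfold renyiDiv
  rw [linModel_eq_withDensity ν θ σ hσ, linModel_eq_withDensity ν θ₀ σ₀ hσ₀,
    lintegral_rnDeriv_add_rpow _ (by fun_prop) (by fun_prop)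
      (fun z => by simpa using linDensity_pos θ hσ z) (by simp) (by simp) h0 h1]
  congr 3
  unfold linAffinity
  refine lintegral_congr fun z => ?_
  rw [ENNReal.ofReal_rpow_of_nonneg (linDensity_nonneg _ _ _) h0.le,
    ENNReal.ofReal_rpow_of_nonneg (linDensity_nonneg _ _ _) (by linarith),
    ENNReal.ofReal_mul (Real.rpow_nonneg (linDensity_nonneg _ _ _) _)]

/-- The logarithm of the reciprocal affinity of two centred normal laws with variance ratio `u`,
times two. -/
noncomputable def scaleLoss (α u : ℝ) : ℝ := Real.log (α * u + 1 - α) - α * Real.log u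

/-- Completing the square: a weighted geometric mean of two normal densities is a constant times the
normal density whose precision `1/w` is the weighted mean of the precisions. The constant is the
affinity. -/
theorem lintegral_gaussianPDFReal_rpow_mul {α : ℝ} (h0 : 0 < α) (h1 : α < 1) (m m₀ : ℝ)
    {v v₀ : ℝ} (hv : 0 < v) (hv₀ : 0 < v₀) :
    ∫⁻ y, ENNReal.ofReal (gaussianPDFReal m v.toNNReal y ^ α *
        gaussianPDFReal m₀ v₀.toNNReal y ^ (1 - α)) =
      ENNReal.ofReal (Real.exp (-(scaleLoss α (v₀ / v) / 2) -
        α * (1 - α) * (m - m₀) ^ 2 / (2 * (α * v₀ + (1 - α) * v)))) := by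
  have h1' : 0 < 1 - α := by linarith
  have hvs : 0 < α * v₀ + (1 - α) * v := by positivity
  set vs := α * v₀ + (1 - α) * v with hvsd
  set w := v * v₀ / vs with hw
  have hwp : 0 < w := by positivity
  set ms := (α * m * v₀ + (1 - α) * m₀ * v) / vs with hms
  have hsl : scaleLoss α (v₀ / v) = Real.log vs - (1 - α) * Real.log v - α * Real.log v₀ := by
    unfold scaleLoss
    have : α * (v₀ / v) + 1 - α = vs / v := by field_simp; rw [hvsd]; ring
    rw [this, Real.log_div hvs.ne' hv.ne', Real.log_div hv₀.ne' hv.ne']; ring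
  have hlw : Real.log w = Real.log v + Real.log v₀ - Real.log vs := by
    rw [hw, Real.log_div (by positivity) hvs.ne', Real.log_mul hv.ne' hv₀.ne']
  have e : ∀ y, gaussianPDFReal m v.toNNReal y ^ α * gaussianPDFReal m₀ v₀.toNNReal y ^ (1 - α) =
      Real.exp (-(scaleLoss α (v₀ / v) / 2) - α * (1 - α) * (m - m₀) ^ 2 / (2 * vs)) *
        gaussianPDFReal ms w.toNNReal y := by
    intro y
    rw [gaussianPDFReal_eq_exp _ hv, gaussianPDFReal_eq_exp _ hv₀, gaussianPDFReal_eq_exp _ hwp,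
      ← Real.exp_mul, ← Real.exp_mul, ← Real.exp_add, ← Real.exp_add, hsl, hlw]
    congr 1
    have : (y - m) ^ 2 / (2 * v) * α + (y - m₀) ^ 2 / (2 * v₀) * (1 - α) =
        α * (1 - α) * (m - m₀) ^ 2 / (2 * vs) + (y - ms) ^ 2 / (2 * w) := by
      rw [hms, hw]
      field_simp
      rw [hvsd]
      ring
    linear_combination -this
  simp_rw [e, ENNReal.ofReal_mul (Real.exp_pos _).le]
  rw [lintegral_const_mul _ (by fun_prop), lintegral_gaussianPDFReal_eq_one _ (by simpa using hwp),
    mul_one]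

theorem linAffinity_eq {d : ℕ} (ν : Measure (EuclideanSpace ℝ (Fin d)))
    [IsProbabilityMeasure ν] {α : ℝ} (h0 : 0 < α) (h1 : α < 1)
    (θ θ₀ : EuclideanSpace ℝ (Fin d)) {σ σ₀ : ℝ} (hσ : 0 < σ) (hσ₀ : 0 < σ₀) :
    linAffinity ν α θ₀ σ₀ (θ, σ) = ∫⁻ x, ENNReal.ofReal (Real.exp
      (-(scaleLoss α (σ₀ ^ 2 / σ ^ 2) / 2) - α * (1 - α) * (inner ℝ x (θ - θ₀)) ^ 2 /
        (2 * (α * σ₀ ^ 2 + (1 - α) * σ ^ 2)))) ∂ν := by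
  unfold linAffinity
  rw [lintegral_prod_symm _ (by fun_prop)]
  refine lintegral_congr fun x => ?_
  rw [inner_sub_right, ← lintegral_gaussianPDFReal_rpow_mul h0 h1 _ _ (by positivity)
    (by positivity)]
  rfl

theorem linAffinity_le_one {d : ℕ} (ν : Measure (EuclideanSpace ℝ (Fin d)))
    [IsProbabilityMeasure ν] {α : ℝ} (h0 : 0 < α) (h1 : α < 1)
    (θ θ₀ : EuclideanSpace ℝ (Fin d)) {σ σ₀ : ℝ} (hσ : 0 < σ) (hσ₀ : 0 < σ₀) :
    linAffinity ν α θ₀ σ₀ (θ, σ) ≤ 1 := by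
  have key : ∀ (θ : EuclideanSpace ℝ (Fin d)) {σ : ℝ} (_ : 0 < σ),
      ∫⁻ z, ENNReal.ofReal (linDensity θ σ z) ∂((volume : Measure ℝ).prod ν) = 1 := by
    intro θ σ hσ
    rw [← setLIntegral_univ, ← withDensity_apply _ MeasurableSet.univ,
      ← linModel_eq_withDensity ν θ σ hσ]
    simp
  calc linAffinity ν α θ₀ σ₀ (θ, σ)
      ≤ ∫⁻ z, (ENNReal.ofReal α * ENNReal.ofReal (linDensity θ σ z) +
          ENNReal.ofReal (1 - α) * ENNReal.ofReal (linDensity θ₀ σ₀ z))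
          ∂((volume : Measure ℝ).prod ν) := by
        refine lintegral_mono fun z => ?_
        have p1 := linDensity_nonneg θ σ z
        have p2 := linDensity_nonneg θ₀ σ₀ z
        rw [← ENNReal.ofReal_mul h0.le, ← ENNReal.ofReal_mul (by linarith),
          ← ENNReal.ofReal_add (by positivity) (mul_nonneg (by linarith) p2)]
        exact ENNReal.ofReal_le_ofReal
          (Real.geom_mean_le_arith_mean2_weighted h0.le (by linarith) p1 p2 (by ring))
    _ = 1 := by
        rw [lintegral_add_left (by fun_prop), lintegral_const_mul _ (by fun_prop),
          lintegral_const_mul _ (by fun_prop), key θ hσ, key θ₀ hσ₀, mul_one, mul_one,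
          ← ENNReal.ofReal_add h0.le (by linarith)]
        simp

theorem ofReal_integral_le_lintegral_ofReal {Ω : Type*} [MeasurableSpace Ω] {μ : Measure Ω}
    {f : Ω → ℝ} (hf : Integrable f μ) :
    ENNReal.ofReal (∫ x, f x ∂μ) ≤ ∫⁻ x, ENNReal.ofReal (f x) ∂μ := by
  calc ENNReal.ofReal (∫ x, f x ∂μ) ≤ ENNReal.ofReal (∫ x, max (f x) 0 ∂μ) :=
        ENNReal.ofReal_le_ofReal (integral_mono hf hf.pos_part fun x => le_max_left _ _)
    _ = ∫⁻ x, ENNReal.ofReal (max (f x) 0) ∂μ :=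
        ofReal_integral_eq_lintegral_ofReal hf.pos_part
          (Filter.Eventually.of_forall fun x => le_max_right _ _)
    _ = _ := by simp [ENNReal.ofReal_max]

/-- The affinity is at least what the variance ratio and the second moment of the design give. -/
theorem le_linAffinity {d : ℕ} (ν : Measure (EuclideanSpace ℝ (Fin d)))
    [IsProbabilityMeasure ν] {α : ℝ} (h0 : 0 < α) (h1 : α < 1)
    (θ θ₀ : EuclideanSpace ℝ (Fin d)) {σ σ₀ Cx : ℝ} (hσ : 0 < σ) (hσ₀ : 0 < σ₀)
    (hCx : ∫⁻ x, ENNReal.ofReal (‖x‖ ^ 2) ∂ν ≤ ENNReal.ofReal (Cx ^ 2)) :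
    ENNReal.ofReal (Real.exp (-(scaleLoss α (σ₀ ^ 2 / σ ^ 2) / 2) -
      Cx ^ 2 * ‖θ - θ₀‖ ^ 2 / (2 * σ₀ ^ 2))) ≤ linAffinity ν α θ₀ σ₀ (θ, σ) := by
  have h1' : 0 < 1 - α := by linarith
  set K := scaleLoss α (σ₀ ^ 2 / σ ^ 2) / 2
  set κ := ‖θ - θ₀‖ ^ 2 / (2 * σ₀ ^ 2) with hκ
  have hκ0 : 0 ≤ κ := by positivity
  -- `t` dominates the mean of `κ ‖x‖²` under the design law. Jensen's inequality is carried out by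
  -- hand with the tangent of `exp (-·)` at `t`.
  set t := Cx ^ 2 * κ with ht
  have ht0 : 0 ≤ t := by positivity
  have hint : Integrable (fun x : EuclideanSpace ℝ (Fin d) => ‖x‖ ^ 2) ν := by
    refine ⟨by fun_prop, ?_⟩
    rw [hasFiniteIntegral_iff_ofReal (Filter.Eventually.of_forall fun x => by positivity)]
    exact hCx.trans_lt ENNReal.ofReal_lt_top
  have hm : ∫ x, ‖x‖ ^ 2 ∂ν ≤ Cx ^ 2 := by
    rw [← ofReal_integral_eq_lintegral_ofReal hint
      (Filter.Eventually.of_forall fun x => by positivity)] at hCx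
    exact (ENNReal.ofReal_le_ofReal_iff (by positivity)).1 hCx
  rw [linAffinity_eq ν h0 h1 θ θ₀ hσ hσ₀]
  have hpt : ∀ x : EuclideanSpace ℝ (Fin d), Real.exp (-K - t) * (1 + t - κ * ‖x‖ ^ 2) ≤
      Real.exp (-K - α * (1 - α) * (inner ℝ x (θ - θ₀)) ^ 2 /
        (2 * (α * σ₀ ^ 2 + (1 - α) * σ ^ 2))) := by
    intro x
    have a1 : α * (1 - α) * (inner ℝ x (θ - θ₀)) ^ 2 /
        (2 * (α * σ₀ ^ 2 + (1 - α) * σ ^ 2)) ≤ κ * ‖x‖ ^ 2 := by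
      have b1 : (inner ℝ x (θ - θ₀)) ^ 2 ≤ ‖x‖ ^ 2 * ‖θ - θ₀‖ ^ 2 := by
        rw [← mul_pow, ← sq_abs]
        exact pow_le_pow_left₀ (abs_nonneg _) (abs_real_inner_le_norm _ _) 2
      -- Dropping `1 - α` upstairs and `(1 - α) σ²` downstairs frees the bound of `σ`, so that it
      -- passes unchanged through the later integration over `σ`.
      have b2 : α * (1 - α) * (inner ℝ x (θ - θ₀)) ^ 2 /
        (2 * (α * σ₀ ^ 2 + (1 - α) * σ ^ 2)) ≤ (α * (inner ℝ x (θ - θ₀)) ^ 2) /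
          (2 * (α * σ₀ ^ 2)) := by
        gcongr
        · nlinarith
        · nlinarith [mul_pos h1' (pow_pos hσ 2)]
      refine b2.trans ?_
      have b3 : (α * (inner ℝ x (θ - θ₀)) ^ 2) / (2 * (α * σ₀ ^ 2)) =
          (inner ℝ x (θ - θ₀)) ^ 2 / (2 * σ₀ ^ 2) := by field_simp
      rw [hκ, b3, div_mul_eq_mul_div]
      gcongr
      linarith
    calc Real.exp (-K - t) * (1 + t - κ * ‖x‖ ^ 2)
        ≤ Real.exp (-K - t) * Real.exp (t - κ * ‖x‖ ^ 2) := by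
          gcongr; linarith [Real.add_one_le_exp (t - κ * ‖x‖ ^ 2)]
      _ = Real.exp (-K - κ * ‖x‖ ^ 2) := by rw [← Real.exp_add]; congr 1; ring
      _ ≤ _ := Real.exp_le_exp.2 (by linarith)
  have hi2 : Integrable (fun x : EuclideanSpace ℝ (Fin d) =>
      Real.exp (-K - t) * (1 + t - κ * ‖x‖ ^ 2)) ν :=
    ((integrable_const _).sub (hint.const_mul κ)).const_mul _
  calc ENNReal.ofReal (Real.exp (-K - Cx ^ 2 * ‖θ - θ₀‖ ^ 2 / (2 * σ₀ ^ 2)))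
      ≤ ENNReal.ofReal (∫ x, Real.exp (-K - t) * (1 + t - κ * ‖x‖ ^ 2) ∂ν) := by
        apply ENNReal.ofReal_le_ofReal
        rw [integral_const_mul, integral_sub (integrable_const _) (hint.const_mul κ),
          integral_const_mul]
        have e : -K - Cx ^ 2 * ‖θ - θ₀‖ ^ 2 / (2 * σ₀ ^ 2) = -K - t := by rw [ht, hκ]; ring
        rw [e]
        simp only [integral_const, probReal_univ, smul_eq_mul, one_mul]
        have : κ * ∫ x, ‖x‖ ^ 2 ∂ν ≤ t := by rw [ht, mul_comm]; gcongr
        nlinarith [Real.exp_pos (-K - t)]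
    _ ≤ ∫⁻ x, ENNReal.ofReal (Real.exp (-K - t) * (1 + t - κ * ‖x‖ ^ 2)) ∂ν :=
        ofReal_integral_le_lintegral_ofReal hi2
    _ ≤ _ := lintegral_mono fun x => ENNReal.ofReal_le_ofReal (hpt x)

/-! ### The fractional posterior -/

/-- The negative logarithm of the affinity. -/
noncomputable def affinityLoss {d : ℕ} (ν : Measure (EuclideanSpace ℝ (Fin d))) (α : ℝ)
    (θ₀ : EuclideanSpace ℝ (Fin d)) (σ₀ : ℝ) (q : EuclideanSpace ℝ (Fin d) × ℝ) : ℝ :=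
  -Real.log (linAffinity ν α θ₀ σ₀ q).toReal

@[fun_prop]
theorem measurable_affinityLoss {d : ℕ} (ν : Measure (EuclideanSpace ℝ (Fin d)))
    [IsProbabilityMeasure ν] (α : ℝ) (θ₀ : EuclideanSpace ℝ (Fin d)) (σ₀ : ℝ) :
    Measurable (affinityLoss ν α θ₀ σ₀) := by
  unfold affinityLoss
  have := measurable_linAffinity ν α θ₀ σ₀
  fun_prop

theorem linAffinity_pos {d : ℕ} (ν : Measure (EuclideanSpace ℝ (Fin d)))
    [IsProbabilityMeasure ν] {α : ℝ} (h0 : 0 < α) (h1 : α < 1)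
    (θ θ₀ : EuclideanSpace ℝ (Fin d)) {σ σ₀ Cx : ℝ} (hσ : 0 < σ) (hσ₀ : 0 < σ₀)
    (hCx : ∫⁻ x, ENNReal.ofReal (‖x‖ ^ 2) ∂ν ≤ ENNReal.ofReal (Cx ^ 2)) :
    0 < linAffinity ν α θ₀ σ₀ (θ, σ) :=
  lt_of_lt_of_le (ENNReal.ofReal_pos.2 (Real.exp_pos _))
    (le_linAffinity ν h0 h1 θ θ₀ hσ hσ₀ hCx)

theorem renyiDiv_linModel_eq_affinityLoss {d : ℕ} (ν : Measure (EuclideanSpace ℝ (Fin d)))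
    [IsProbabilityMeasure ν] {α : ℝ} (h0 : 0 < α) (h1 : α < 1)
    (θ θ₀ : EuclideanSpace ℝ (Fin d)) {σ σ₀ Cx : ℝ} (hσ : 0 < σ) (hσ₀ : 0 < σ₀)
    (hCx : ∫⁻ x, ENNReal.ofReal (‖x‖ ^ 2) ∂ν ≤ ENNReal.ofReal (Cx ^ 2)) :
    renyiDiv α (linModel ν θ σ) (linModel ν θ₀ σ₀) =
      ENNReal.ofReal ((1 - α)⁻¹ * affinityLoss ν α θ₀ σ₀ (θ, σ)) := by
  have hpos := linAffinity_pos ν h0 h1 θ θ₀ hσ hσ₀ hCx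
  have hle := linAffinity_le_one ν h0 h1 θ θ₀ hσ hσ₀
  have hne : linAffinity ν α θ₀ σ₀ (θ, σ) ≠ ∞ := (hle.trans_lt ENNReal.one_lt_top).ne
  rw [renyiDiv_linModel ν h0 h1 θ θ₀ hσ hσ₀, ENNReal.log_pos_real hpos.ne' hne,
    ← EReal.coe_mul, EReal.toENNReal_of_ne_top (EReal.coe_ne_top _), EReal.toReal_coe]
  congr 1
  unfold affinityLoss
  rw [← neg_sub α 1, inv_neg]; ring

theorem affinityLoss_le {d : ℕ} (ν : Measure (EuclideanSpace ℝ (Fin d)))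
    [IsProbabilityMeasure ν] {α : ℝ} (h0 : 0 < α) (h1 : α < 1)
    (θ θ₀ : EuclideanSpace ℝ (Fin d)) {σ σ₀ Cx : ℝ} (hσ : 0 < σ) (hσ₀ : 0 < σ₀)
    (hCx : ∫⁻ x, ENNReal.ofReal (‖x‖ ^ 2) ∂ν ≤ ENNReal.ofReal (Cx ^ 2)) :
    affinityLoss ν α θ₀ σ₀ (θ, σ) ≤
      scaleLoss α (σ₀ ^ 2 / σ ^ 2) / 2 + Cx ^ 2 * ‖θ - θ₀‖ ^ 2 / (2 * σ₀ ^ 2) := by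
  have hle := linAffinity_le_one ν h0 h1 θ θ₀ hσ hσ₀
  have hne : linAffinity ν α θ₀ σ₀ (θ, σ) ≠ ∞ := (hle.trans_lt ENNReal.one_lt_top).ne
  have h := (ENNReal.ofReal_le_iff_le_toReal hne).1 (le_linAffinity ν h0 h1 θ θ₀ hσ hσ₀ hCx)
  have h2 := Real.log_le_log (Real.exp_pos _) h
  rw [Real.log_exp] at h2
  unfold affinityLoss
  linarith

/-- The (fractional) likelihood of a sample. -/
noncomputable def fracLik {d n : ℕ} (α : ℝ) (z : Fin n → ℝ × EuclideanSpace ℝ (Fin d))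
    (q : EuclideanSpace ℝ (Fin d) × ℝ) : ℝ :=
  (∏ i, linDensity q.1 q.2 (z i)) ^ α

@[fun_prop]
theorem measurable_fracLik {d n : ℕ} (α : ℝ) (z : Fin n → ℝ × EuclideanSpace ℝ (Fin d)) :
    Measurable (fracLik α z) := by
  unfold fracLik
  exact Measurable.pow_const (Finset.measurable_prod _ fun i _ => by fun_prop) _

theorem lintegral_fracPosterior {d n : ℕ} (π : Measure (EuclideanSpace ℝ (Fin d) × ℝ)) (α : ℝ)
    (z : Fin n → ℝ × EuclideanSpace ℝ (Fin d)) {f : EuclideanSpace ℝ (Fin d) × ℝ → ℝ≥0∞}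
    (hf : Measurable f) :
    ∫⁻ q, f q ∂(fracPosterior π α z) =
      (∫⁻ q, ENNReal.ofReal (fracLik α z q) ∂π)⁻¹ *
        ∫⁻ q, ENNReal.ofReal (fracLik α z q) * f q ∂π := by
  unfold fracPosterior normalizeMeasure
  rw [lintegral_smul_measure, withDensity_apply _ MeasurableSet.univ, Measure.restrict_univ,
    smul_eq_mul]
  congr 1
  exact lintegral_withDensity_eq_lintegral_mul _ (measurable_fracLik α z).ennreal_ofReal hf

/-- An upper bound on the mass is all that is needed, and it survives a normalizing constant equal
to `0` or `∞`. -/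
theorem fracPosterior_univ_le_one {d n : ℕ} (π : Measure (EuclideanSpace ℝ (Fin d) × ℝ)) (α : ℝ)
    (z : Fin n → ℝ × EuclideanSpace ℝ (Fin d)) : fracPosterior π α z Set.univ ≤ 1 := by
  have := lintegral_fracPosterior π α z (f := fun _ => 1) measurable_const
  simp only [lintegral_const, one_mul, mul_one] at this
  rw [this]
  exact ENNReal.inv_mul_le_one _

theorem lintegral_fracPosterior_le_of_le {d n : ℕ} {π : Measure (EuclideanSpace ℝ (Fin d) × ℝ)}
    {α : ℝ} {z : Fin n → ℝ × EuclideanSpace ℝ (Fin d)}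
    {f : EuclideanSpace ℝ (Fin d) × ℝ → ℝ≥0∞} (hf : Measurable f) {F : ℝ≥0∞}
    (h : ∫⁻ q, ENNReal.ofReal (fracLik α z q) * f q ∂π ≤
      (∫⁻ q, ENNReal.ofReal (fracLik α z q) ∂π) * F) :
    ∫⁻ q, f q ∂(fracPosterior π α z) ≤ F := by
  rw [lintegral_fracPosterior π α z hf]
  calc _ ≤ (∫⁻ q, ENNReal.ofReal (fracLik α z q) ∂π)⁻¹ *
        ((∫⁻ q, ENNReal.ofReal (fracLik α z q) ∂π) * F) := by gcongr
    _ ≤ 1 * F := by rw [← mul_assoc]; gcongr; exact ENNReal.inv_mul_le_one _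
    _ = F := one_mul _

theorem lintegral_pi_prod {n : ℕ} {Ω : Type*} [MeasurableSpace Ω] (μ : Measure Ω)
    [IsProbabilityMeasure μ] {f : Ω → ℝ≥0∞} (hf : Measurable f) :
    ∫⁻ z, ∏ i, f (z i) ∂(Measure.pi fun _ : Fin n => μ) = (∫⁻ x, f x ∂μ) ^ n := by
  have hind : iIndepFun (fun i (z : Fin n → Ω) => f (z i)) (Measure.pi fun _ : Fin n => μ) :=
    iIndepFun_pi (X := fun _ => f) fun _ => hf.aemeasurable
  have h := lintegral_prod_eq_prod_lintegral_of_indepFun Finset.univ _ hind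
    fun i => hf.comp (measurable_pi_apply i)
  rw [h]
  have e : ∀ i : Fin n, ∫⁻ z, f (z i) ∂(Measure.pi fun _ : Fin n => μ) = ∫⁻ x, f x ∂μ :=
    fun i => (measurePreserving_eval (fun _ : Fin n => μ) i).lintegral_comp hf
  simp [e]

/-- The change of measure that turns the loss into an exponential moment under the true law. -/
theorem lintegral_density_ratio_rpow {d : ℕ} (ν : Measure (EuclideanSpace ℝ (Fin d)))
    [IsProbabilityMeasure ν] (α : ℝ)
    (q : EuclideanSpace ℝ (Fin d) × ℝ) (θ₀ : EuclideanSpace ℝ (Fin d)) {σ₀ : ℝ} (hσ₀ : 0 < σ₀) :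
    ∫⁻ z, ENNReal.ofReal (linDensity q.1 q.2 z ^ α / linDensity θ₀ σ₀ z ^ α)
      ∂(linModel ν θ₀ σ₀) = linAffinity ν α θ₀ σ₀ q := by
  rw [linModel_eq_withDensity ν θ₀ σ₀ hσ₀,
    lintegral_withDensity_eq_lintegral_mul _ (by fun_prop) (by fun_prop)]
  unfold linAffinity
  refine lintegral_congr fun z => ?_
  have hp := linDensity_pos θ₀ hσ₀ z
  rw [Pi.mul_apply, ← ENNReal.ofReal_mul hp.le, Real.rpow_sub hp, Real.rpow_one]
  congr 1; ring

/-- Oracle inequality for the fractional posterior: the posterior expected loss is bounded by the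
prior mass of a set on which the likelihood is uniformly comparable to the true one. -/
theorem lintegral_affinityLoss_fracPosterior_le {d n : ℕ}
    (ν : Measure (EuclideanSpace ℝ (Fin d)))
    [IsProbabilityMeasure ν] {α : ℝ} (h0 : 0 < α) (h1 : α < 1)
    (θ₀ : EuclideanSpace ℝ (Fin d)) {σ₀ Cx : ℝ} (hσ₀ : 0 < σ₀)
    (hCx : ∫⁻ x, ENNReal.ofReal (‖x‖ ^ 2) ∂ν ≤ ENNReal.ofReal (Cx ^ 2))
    (π : Measure (EuclideanSpace ℝ (Fin d) × ℝ)) [SFinite π] (hπ : π Set.univ ≤ 1)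
    (hπp : ∀ᵐ q ∂π, 0 < q.2) (B : Set (EuclideanSpace ℝ (Fin d) × ℝ))
    {κ : ℝ} (hκ : 0 ≤ κ) (hBκ : ENNReal.ofReal (Real.exp (-κ)) ≤ π B)
    (G : (Fin n → ℝ × EuclideanSpace ℝ (Fin d)) → ℝ) (hG0 : ∀ z, 0 ≤ G z) (hGm : Measurable G)
    (hG : ∀ z, ∀ q ∈ B, ∏ i, linDensity θ₀ σ₀ (z i) ≤
      Real.exp (G z) * ∏ i, linDensity q.1 q.2 (z i)) :
    ∫⁻ z, ∫⁻ q, ENNReal.ofReal (n * affinityLoss ν α θ₀ σ₀ q) ∂(fracPosterior π α z)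
      ∂(Measure.pi fun _ : Fin n => linModel ν θ₀ σ₀) ≤
      ENNReal.ofReal κ +
        ∫⁻ z, ENNReal.ofReal (G z) ∂(Measure.pi fun _ : Fin n => linModel ν θ₀ σ₀) + 1 := by
  set R : (Fin n → ℝ × EuclideanSpace ℝ (Fin d)) → EuclideanSpace ℝ (Fin d) × ℝ → ℝ≥0∞ :=
    fun z q => ∏ i, ENNReal.ofReal (linDensity q.1 q.2 (z i) ^ α / linDensity θ₀ σ₀ (z i) ^ α)
    with hR
  set E : EuclideanSpace ℝ (Fin d) × ℝ → ℝ≥0∞ :=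
    fun q => ENNReal.ofReal (Real.exp (n * affinityLoss ν α θ₀ σ₀ q)) with hE
  have hEm : Measurable E := by fun_prop
  have hRm : Measurable fun w : (Fin n → ℝ × EuclideanSpace ℝ (Fin d)) ×
      (EuclideanSpace ℝ (Fin d) × ℝ) => E w.2 * R w.1 w.2 := by
    refine (hEm.comp measurable_snd).mul (Finset.measurable_prod _ fun i _ => ?_)
    fun_prop
  have hpt : ∀ z, ∫⁻ q, ENNReal.ofReal (n * affinityLoss ν α θ₀ σ₀ q) ∂(fracPosterior π α z) ≤
      (ENNReal.ofReal κ + ENNReal.ofReal (G z)) + ∫⁻ q, E q * R z q ∂π := by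
    intro z
    -- `e^{-c} L₀^α` is a lower bound for the normalizing constant. Using `x ≤ c + e^{x - c}` with
    -- this same `c`, the factor `e^{-c}` cancels the one lost in that bound.
    set c := κ + G z with hc
    have hc0 : 0 ≤ c := add_nonneg hκ (hG0 z)
    set L₀ := ∏ i, linDensity θ₀ σ₀ (z i) with hL₀
    have hL₀p : 0 < L₀ := Finset.prod_pos fun i _ => linDensity_pos θ₀ hσ₀ _
    set T := ∫⁻ q, ENNReal.ofReal (fracLik α z q) ∂π with hT
    have hTl : ENNReal.ofReal (Real.exp (-c)) * ENNReal.ofReal (L₀ ^ α) ≤ T := by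
      calc ENNReal.ofReal (Real.exp (-c)) * ENNReal.ofReal (L₀ ^ α)
          = ENNReal.ofReal (Real.exp (-G z) * L₀ ^ α) * ENNReal.ofReal (Real.exp (-κ)) := by
            rw [← ENNReal.ofReal_mul (Real.exp_pos _).le, ← ENNReal.ofReal_mul (by positivity), hc]
            congr 1
            rw [neg_add, Real.exp_add]; ring
        _ ≤ ENNReal.ofReal (Real.exp (-G z) * L₀ ^ α) * π B := by gcongr
        _ = ∫⁻ q in B, ENNReal.ofReal (Real.exp (-G z) * L₀ ^ α) ∂π := by simp
        _ ≤ ∫⁻ q in B, ENNReal.ofReal (fracLik α z q) ∂π := by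
            refine setLIntegral_mono (by fun_prop) fun q hq => ENNReal.ofReal_le_ofReal ?_
            have hLq : 0 ≤ ∏ i, linDensity q.1 q.2 (z i) :=
              Finset.prod_nonneg fun i _ => linDensity_nonneg _ _ _
            calc Real.exp (-G z) * L₀ ^ α
                ≤ Real.exp (-G z) * (Real.exp (G z) * ∏ i, linDensity q.1 q.2 (z i)) ^ α := by
                  gcongr; exact hG z q hq
              _ = Real.exp (-G z + G z * α) * fracLik α z q := by
                  rw [Real.mul_rpow (Real.exp_pos _).le hLq, ← Real.exp_mul, Real.exp_add, fracLik,
                    mul_assoc]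
              _ ≤ 1 * fracLik α z q := by
                  have : 0 ≤ fracLik α z q := Real.rpow_nonneg hLq _
                  gcongr
                  rw [Real.exp_le_one_iff]
                  nlinarith [hG0 z]
              _ = _ := one_mul _
        _ ≤ T := setLIntegral_le_lintegral _ _
    have hexp0 : ENNReal.ofReal (Real.exp (-c)) ≠ 0 := by simp [Real.exp_pos]
    have hL0ne : ENNReal.ofReal (L₀ ^ α) ≠ 0 := by simp [Real.rpow_pos_of_pos hL₀p]
    have hTinv : ENNReal.ofReal (Real.exp (-c)) * T⁻¹ ≤ (ENNReal.ofReal (L₀ ^ α))⁻¹ := by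
      calc _ ≤ ENNReal.ofReal (Real.exp (-c)) *
            (ENNReal.ofReal (Real.exp (-c)) * ENNReal.ofReal (L₀ ^ α))⁻¹ := by gcongr
        _ = _ := by
          rw [ENNReal.mul_inv (Or.inl hexp0) (Or.inl ENNReal.ofReal_ne_top), ← mul_assoc,
            ENNReal.mul_inv_cancel hexp0 ENNReal.ofReal_ne_top, one_mul]
    calc ∫⁻ q, ENNReal.ofReal (n * affinityLoss ν α θ₀ σ₀ q) ∂(fracPosterior π α z)
        ≤ ∫⁻ q, (ENNReal.ofReal c + ENNReal.ofReal (Real.exp (-c)) * E q)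
            ∂(fracPosterior π α z) := by
          refine lintegral_mono fun q => ?_
          rw [hE, ← ENNReal.ofReal_mul (Real.exp_pos _).le,
            ← ENNReal.ofReal_add hc0 (by positivity), ← Real.exp_add]
          refine ENNReal.ofReal_le_ofReal ?_
          linarith [Real.add_one_le_exp (-c + n * affinityLoss ν α θ₀ σ₀ q)]
      _ = ENNReal.ofReal c * fracPosterior π α z Set.univ +
            ENNReal.ofReal (Real.exp (-c)) * ∫⁻ q, E q ∂(fracPosterior π α z) := by
          rw [lintegral_add_left measurable_const, lintegral_const, lintegral_const_mul _ hEm]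
      _ ≤ ENNReal.ofReal c * 1 + (ENNReal.ofReal (L₀ ^ α))⁻¹ *
            ∫⁻ q, ENNReal.ofReal (fracLik α z q) * E q ∂π := by
          rw [lintegral_fracPosterior π α z hEm, ← mul_assoc]
          refine add_le_add (mul_le_mul' le_rfl (fracPosterior_univ_le_one π α z))
            (mul_le_mul' hTinv le_rfl)
      _ = (ENNReal.ofReal κ + ENNReal.ofReal (G z)) + ∫⁻ q, E q * R z q ∂π := by
          rw [mul_one, hc, ENNReal.ofReal_add hκ (hG0 z), ← lintegral_const_mul _ (by fun_prop)]
          congr 1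
          refine lintegral_congr fun q => ?_
          rw [← mul_assoc, mul_comm]
          congr 1
          simp only [hR]
          rw [← ENNReal.ofReal_prod_of_nonneg (fun i _ => div_nonneg
            (Real.rpow_nonneg (linDensity_nonneg _ _ _) _)
            (Real.rpow_nonneg (linDensity_nonneg _ _ _) _)), Finset.prod_div_distrib,
            Real.finsetProd_rpow _ _ (fun i _ => linDensity_nonneg _ _ _),
            Real.finsetProd_rpow _ _ (fun i _ => linDensity_nonneg _ _ _),
            ← ENNReal.ofReal_inv_of_pos (Real.rpow_pos_of_pos hL₀p _),
            ← ENNReal.ofReal_mul (by positivity), div_eq_inv_mul]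
          rfl
  calc _ ≤ ∫⁻ z, ((ENNReal.ofReal κ + ENNReal.ofReal (G z)) + ∫⁻ q, E q * R z q ∂π)
          ∂(Measure.pi fun _ : Fin n => linModel ν θ₀ σ₀) := lintegral_mono hpt
    _ = ENNReal.ofReal κ +
        ∫⁻ z, ENNReal.ofReal (G z) ∂(Measure.pi fun _ : Fin n => linModel ν θ₀ σ₀) +
        ∫⁻ z, ∫⁻ q, E q * R z q ∂π ∂(Measure.pi fun _ : Fin n => linModel ν θ₀ σ₀) := by
        rw [lintegral_add_left (by fun_prop), lintegral_add_left (by fun_prop)]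
        simp
    _ ≤ _ := by
        gcongr
        -- For fixed `q` with `q.2 > 0`, the `n` observations contribute the `n`-th power of the
        -- affinity, which is `e^{-nℓ}`. The inner integral is then one, and the prior has mass at
        -- most one.
        rw [lintegral_lintegral_swap hRm.aemeasurable]
        calc _ ≤ ∫⁻ q, 1 ∂π := by
              refine lintegral_mono_ae ?_
              filter_upwards [hπp] with q hq
              have hpos := linAffinity_pos ν h0 h1 q.1 θ₀ hq hσ₀ hCx
              have hle := linAffinity_le_one ν h0 h1 q.1 θ₀ hq hσ₀
              have hne : linAffinity ν α θ₀ σ₀ q ≠ ∞ := (hle.trans_lt ENNReal.one_lt_top).ne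
              rw [lintegral_const_mul' _ _ ENNReal.ofReal_ne_top, hR, lintegral_pi_prod _
                (f := fun z => ENNReal.ofReal (linDensity q.1 q.2 z ^ α / linDensity θ₀ σ₀ z ^ α))
                (by fun_prop), lintegral_density_ratio_rpow ν α q θ₀ hσ₀]
              have ht : 0 < (linAffinity ν α θ₀ σ₀ q).toReal := ENNReal.toReal_pos hpos.ne' hne
              rw [← ENNReal.ofReal_toReal hne, ← ENNReal.ofReal_pow ht.le,
                ← ENNReal.ofReal_mul (Real.exp_pos _).le]
              refine (ENNReal.ofReal_le_ofReal (le_of_eq ?_)).trans ENNReal.ofReal_one.le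
              have : (linAffinity ν α θ₀ σ₀ q).toReal ^ n =
                  Real.exp (n * Real.log (linAffinity ν α θ₀ σ₀ q).toReal) := by
                rw [Real.exp_nat_mul, Real.exp_log ht]
              rw [this, ← Real.exp_add]
              simp [affinityLoss]
          _ ≤ 1 := by simpa using hπ

/-! ### Moments of the data -/

theorem lintegral_linModel {d : ℕ} (ν : Measure (EuclideanSpace ℝ (Fin d)))
    [IsProbabilityMeasure ν] (θ : EuclideanSpace ℝ (Fin d)) (σ : ℝ)
    {f : EuclideanSpace ℝ (Fin d) → ℝ → ℝ≥0∞} (hf : Measurable (Function.uncurry f)) :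
    ∫⁻ z, f z.2 (z.1 - inner ℝ z.2 θ) ∂(linModel ν θ σ) =
      ∫⁻ x, ∫⁻ e, f x e ∂(gaussianReal 0 (σ ^ 2).toNNReal) ∂ν := by
  unfold linModel
  have hm : Measurable fun z : ℝ × EuclideanSpace ℝ (Fin d) =>
      f z.2 (z.1 - inner ℝ z.2 θ) :=
    hf.comp (f := fun z : ℝ × EuclideanSpace ℝ (Fin d) => (z.2, z.1 - inner ℝ z.2 θ))
      (by fun_prop)
  rw [lintegral_map hm (by fun_prop)]
  simp only [add_sub_cancel_left]
  exact lintegral_prod _ hf.aemeasurable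

theorem integrable_sq_gaussianReal (v : NNReal) :
    Integrable (fun x : ℝ => x ^ 2) (gaussianReal 0 v) := by
  simpa using (memLp_id_gaussianReal (μ := 0) (v := v) 2).integrable_sq

theorem integral_sq_gaussianReal (v : NNReal) : ∫ x, x ^ 2 ∂(gaussianReal 0 v) = v := by
  have h := variance_of_integral_eq_zero (μ := gaussianReal 0 v) (X := fun x => x)
    (by fun_prop) (by rw [integral_id_gaussianReal])
  rw [← h, variance_fun_id_gaussianReal]

theorem lintegral_sq_gaussianReal (v : NNReal) :
    ∫⁻ x, ENNReal.ofReal (x ^ 2) ∂(gaussianReal 0 v) = v := by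
  rw [← ofReal_integral_eq_lintegral_ofReal (integrable_sq_gaussianReal v)
    (Filter.Eventually.of_forall fun x => sq_nonneg x), integral_sq_gaussianReal]
  simp

theorem lintegral_pi_eval {n : ℕ} {Ω : Type*} [MeasurableSpace Ω] (μ : Measure Ω)
    [IsProbabilityMeasure μ] (i : Fin n) {f : Ω → ℝ≥0∞} (hf : Measurable f) :
    ∫⁻ z, f (z i) ∂(Measure.pi fun _ : Fin n => μ) = ∫⁻ x, f x ∂μ :=
  (measurePreserving_eval (fun _ : Fin n => μ) i).lintegral_comp hf

theorem lintegral_pi_sum {n : ℕ} {Ω : Type*} [MeasurableSpace Ω] (μ : Measure Ω)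
    [IsProbabilityMeasure μ] {f : Ω → ℝ≥0∞} (hf : Measurable f) :
    ∫⁻ z, ∑ i, f (z i) ∂(Measure.pi fun _ : Fin n => μ) = n * ∫⁻ x, f x ∂μ := by
  have hm : ∀ i : Fin n, Measurable fun z : Fin n → Ω => f (z i) :=
    fun i => hf.comp (measurable_pi_apply i)
  rw [lintegral_finsetSum _ fun i _ => hm i]
  simp [lintegral_pi_eval μ _ hf]

theorem lintegral_pi_sq_sum {n : ℕ} {Ω : Type*} [MeasurableSpace Ω] (μ : Measure Ω)
    [IsProbabilityMeasure μ] {h : Ω → ℝ} (hm : Measurable h) (h2 : MemLp h 2 μ)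
    (h0 : ∫ x, h x ∂μ = 0) :
    ∫⁻ z, ENNReal.ofReal ((∑ i, h (z i)) ^ 2) ∂(Measure.pi fun _ : Fin n => μ) =
      n * ∫⁻ x, ENNReal.ofReal (h x ^ 2) ∂μ := by
  set P := Measure.pi fun _ : Fin n => μ with hP
  have hL : ∀ i : Fin n, MemLp (fun z : Fin n → Ω => h (z i)) 2 P := fun i =>
    h2.comp_measurePreserving (measurePreserving_eval (fun _ : Fin n => μ) i)
  have hS : MemLp (∑ i, fun z : Fin n → Ω => h (z i)) 2 P := memLp_finsetSum' _ fun i _ => hL i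
  have hvar := variance_sum_pi (μ := fun _ : Fin n => μ) (X := fun _ => h) fun _ => h2
  have hE : ∫ z, (∑ i, fun z : Fin n → Ω => h (z i)) z ∂P = 0 := by
    simp only [Finset.sum_apply]
    rw [integral_finsetSum _ fun i _ => (hL i).integrable (by norm_num)]
    refine Finset.sum_eq_zero fun i _ => ?_
    have hmp := measurePreserving_eval (fun _ : Fin n => μ) i
    have := integral_map (μ := P) hmp.measurable.aemeasurable (f := h) hm.aestronglyMeasurable
    rw [hP, hmp.map_eq] at this
    exact this.symm.trans h0
  rw [variance_of_integral_eq_zero hS.aestronglyMeasurable.aemeasurable hE,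
    variance_of_integral_eq_zero hm.aemeasurable h0] at hvar
  simp only [Finset.sum_apply, Finset.sum_const, Finset.card_univ, Fintype.card_fin,
    nsmul_eq_mul] at hvar
  have hi := hS.integrable_sq
  simp only [Finset.sum_apply] at hi
  rw [← ofReal_integral_eq_lintegral_ofReal hi
    (Filter.Eventually.of_forall fun x => sq_nonneg _), hvar,
    ENNReal.ofReal_mul (by positivity), ENNReal.ofReal_natCast,
    ofReal_integral_eq_lintegral_ofReal h2.integrable_sq
      (Filter.Eventually.of_forall fun x => sq_nonneg _)]

theorem lintegral_linModel_norm_sq {d : ℕ} (ν : Measure (EuclideanSpace ℝ (Fin d)))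
    [IsProbabilityMeasure ν] (θ : EuclideanSpace ℝ (Fin d)) (σ : ℝ) :
    ∫⁻ z, ENNReal.ofReal (‖z.2‖ ^ 2) ∂(linModel ν θ σ) = ∫⁻ x, ENNReal.ofReal (‖x‖ ^ 2) ∂ν := by
  rw [lintegral_linModel ν θ σ (f := fun x _ => ENNReal.ofReal (‖x‖ ^ 2)) (by
    unfold Function.uncurry; fun_prop)]
  simp

theorem euclidean_norm_sq_eq {d : ℕ} (x : EuclideanSpace ℝ (Fin d)) :
    ‖x‖ ^ 2 = ∑ k, x k ^ 2 := by
  rw [EuclideanSpace.norm_sq_eq]; simp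

/-- The score `∑ (Yᵢ - Xᵢᵀθ) Xᵢ` has second moment `n σ² E‖X‖²`. -/
theorem lintegral_score_sq {d n : ℕ} (ν : Measure (EuclideanSpace ℝ (Fin d)))
    [IsProbabilityMeasure ν] (θ : EuclideanSpace ℝ (Fin d)) (σ : ℝ)
    (hν : ∫⁻ x, ENNReal.ofReal (‖x‖ ^ 2) ∂ν ≠ ∞) :
    ∫⁻ z, ENNReal.ofReal (‖∑ i, (((z i).1 - inner ℝ (z i).2 θ) • (z i).2)‖ ^ 2)
      ∂(Measure.pi fun _ : Fin n => linModel ν θ σ) =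
      n * (ENNReal.ofReal (σ ^ 2) * ∫⁻ x, ENNReal.ofReal (‖x‖ ^ 2) ∂ν) := by
  have hk : ∀ k : Fin d, ∫⁻ z, ENNReal.ofReal ((∑ i, ((z i).1 - inner ℝ (z i).2 θ) * (z i).2 k) ^ 2)
      ∂(Measure.pi fun _ : Fin n => linModel ν θ σ) =
      n * (ENNReal.ofReal (σ ^ 2) * ∫⁻ x, ENNReal.ofReal (x k ^ 2) ∂ν) := by
    intro k
    have hsq : ∫⁻ z, ENNReal.ofReal (((z.1 - inner ℝ z.2 θ) * z.2 k) ^ 2) ∂(linModel ν θ σ) =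
        ENNReal.ofReal (σ ^ 2) * ∫⁻ x, ENNReal.ofReal (x k ^ 2) ∂ν := by
      rw [lintegral_linModel ν θ σ
        (f := fun (x : EuclideanSpace ℝ (Fin d)) e => ENNReal.ofReal ((e * x k) ^ 2)) (by
        unfold Function.uncurry; fun_prop)]
      rw [← lintegral_const_mul' _ _ ENNReal.ofReal_ne_top]
      refine lintegral_congr fun x => ?_
      simp_rw [mul_pow, ENNReal.ofReal_mul (sq_nonneg _)]
      rw [lintegral_mul_const' _ _ ENNReal.ofReal_ne_top, lintegral_sq_gaussianReal]
      rfl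
    have hle : ∫⁻ x, ENNReal.ofReal (x k ^ 2) ∂ν ≠ ∞ := by
      refine ne_top_of_le_ne_top hν (lintegral_mono fun x => ENNReal.ofReal_le_ofReal ?_)
      rw [euclidean_norm_sq_eq]
      exact Finset.single_le_sum (f := fun k => x k ^ 2) (fun i _ => sq_nonneg _)
        (Finset.mem_univ k)
    have hint : Integrable (fun z : ℝ × EuclideanSpace ℝ (Fin d) =>
        ((z.1 - inner ℝ z.2 θ) * z.2 k) ^ 2) (linModel ν θ σ) := by
      refine ⟨by fun_prop, ?_⟩
      rw [hasFiniteIntegral_iff_ofReal (Filter.Eventually.of_forall fun x => by positivity), hsq]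
      exact ENNReal.mul_lt_top ENNReal.ofReal_lt_top hle.lt_top
    have hmean : ∫ z, (z.1 - inner ℝ z.2 θ) * z.2 k ∂(linModel ν θ σ) = 0 := by
      unfold linModel
      rw [integral_map (by fun_prop) (by fun_prop)]
      simp only [add_sub_cancel_left]
      have := integral_prod_mul (μ := ν) (ν := gaussianReal 0 (σ ^ 2).toNNReal)
        (fun x : EuclideanSpace ℝ (Fin d) => x k) (fun e : ℝ => e)
      simp_rw [mul_comm] at this ⊢
      rw [this, integral_id_gaussianReal, zero_mul]
    rw [lintegral_pi_sq_sum (linModel ν θ σ) (h := fun z => (z.1 - inner ℝ z.2 θ) * z.2 k)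
      (by fun_prop) ((memLp_two_iff_integrable_sq (by fun_prop)).2 hint) hmean, hsq]
  have e1 : ∀ z : Fin n → ℝ × EuclideanSpace ℝ (Fin d),
      ENNReal.ofReal (‖∑ i, (((z i).1 - inner ℝ (z i).2 θ) • (z i).2)‖ ^ 2) =
      ∑ k, ENNReal.ofReal ((∑ i, ((z i).1 - inner ℝ (z i).2 θ) * (z i).2 k) ^ 2) := by
    intro z
    rw [euclidean_norm_sq_eq, ENNReal.ofReal_sum_of_nonneg fun _ _ => sq_nonneg _]
    simp
  simp_rw [e1]
  rw [lintegral_finsetSum _ fun k _ => by fun_prop]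
  simp_rw [hk]
  rw [← Finset.mul_sum, ← Finset.mul_sum, ← lintegral_finsetSum _ fun k _ => by fun_prop]
  congr 3
  ext x
  rw [euclidean_norm_sq_eq, ENNReal.ofReal_sum_of_nonneg fun _ _ => sq_nonneg _]

/-- Uniform comparison of the true likelihood with the likelihood at parameters near the truth. -/
theorem prod_linDensity_le_near {d n : ℕ} (θ θ₀ : EuclideanSpace ℝ (Fin d)) {σ σ₀ D : ℝ}
    (hσ : 0 < σ) (hσ₀ : 0 < σ₀) (hD : ‖θ - θ₀‖ ≤ D) (h1 : σ₀ ^ 2 ≤ σ ^ 2) (hn : 0 < n)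
    (h2 : σ ^ 2 ≤ σ₀ ^ 2 * (1 + (n : ℝ)⁻¹)) (z : Fin n → ℝ × EuclideanSpace ℝ (Fin d)) :
    ∏ i, linDensity θ₀ σ₀ (z i) ≤
      Real.exp (1 + D ^ 2 * ‖∑ i, (((z i).1 - inner ℝ (z i).2 θ₀) • (z i).2)‖ ^ 2 / (2 * σ₀ ^ 4) +
        D ^ 2 * (∑ i, ‖(z i).2‖ ^ 2) / (2 * σ₀ ^ 2)) * ∏ i, linDensity θ σ (z i) := by
  have hD0 : 0 ≤ D := (norm_nonneg _).trans hD
  simp_rw [linDensity_eq_exp θ₀ hσ₀, linDensity_eq_exp θ hσ]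
  rw [← Real.exp_sum, ← Real.exp_sum, ← Real.exp_add]
  refine Real.exp_le_exp.2 ?_
  set U := ∑ i, (((z i).1 - inner ℝ (z i).2 θ₀) • (z i).2) with hU
  set S := ∑ i, ‖(z i).2‖ ^ 2 with hS
  set r : Fin n → ℝ := fun i => (z i).1 - inner ℝ (z i).2 θ₀ with hr
  set t : Fin n → ℝ := fun i => inner ℝ (z i).2 (θ - θ₀) with ht
  have hs0 : 0 < σ₀ ^ 2 := by positivity
  have hs : 0 < σ ^ 2 := by positivity
  have hnp : (0 : ℝ) < n := by exact_mod_cast hn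
  have hlog : Real.log (σ ^ 2) ≤ Real.log (σ₀ ^ 2) + (n : ℝ)⁻¹ := by
    calc Real.log (σ ^ 2) ≤ Real.log (σ₀ ^ 2 * (1 + (n : ℝ)⁻¹)) := Real.log_le_log hs h2
      _ = Real.log (σ₀ ^ 2) + Real.log (1 + (n : ℝ)⁻¹) := Real.log_mul hs0.ne' (by positivity)
      _ ≤ _ := by linarith [Real.log_le_sub_one_of_pos (show 0 < 1 + (n : ℝ)⁻¹ by positivity)]
  -- Because `σ ≥ σ₀`, the residual term `r²` moves in the favourable direction. The change of scale
  -- costs only the normalizing constant, at most `1/(2n)` per observation.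
  have hterm : ∀ i, -(Real.log (2 * Real.pi) + Real.log (σ₀ ^ 2)) / 2 - (r i) ^ 2 / (2 * σ₀ ^ 2) ≤
      (n : ℝ)⁻¹ / 2 + (-(2 * r i * t i) + t i ^ 2) / (2 * σ ^ 2) +
      (-(Real.log (2 * Real.pi) + Real.log (σ ^ 2)) / 2 -
        ((z i).1 - inner ℝ (z i).2 θ) ^ 2 / (2 * σ ^ 2)) := by
    intro i
    have e : (z i).1 - inner ℝ (z i).2 θ = r i - t i := by
      simp only [hr, ht, inner_sub_right]; ring
    have e2 : (r i) ^ 2 / (2 * σ ^ 2) ≤ (r i) ^ 2 / (2 * σ₀ ^ 2) := by gcongr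
    have e3 : (r i - t i) ^ 2 / (2 * σ ^ 2) =
        (r i) ^ 2 / (2 * σ ^ 2) + (-(2 * r i * t i) + t i ^ 2) / (2 * σ ^ 2) := by ring
    rw [e, e3]
    linarith
  have hsum := Finset.sum_le_sum fun i (_ : i ∈ Finset.univ) => hterm i
  rw [Finset.sum_add_distrib, Finset.sum_add_distrib, ← Finset.sum_div,
    ← Finset.sum_div, Finset.sum_add_distrib, Finset.sum_neg_distrib] at hsum
  have hc : ∑ _i : Fin n, (n : ℝ)⁻¹ = 1 := by simp [hnp.ne']
  rw [hc] at hsum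
  have hin : ∑ i, 2 * r i * t i = 2 * inner ℝ U (θ - θ₀) := by
    rw [hU, sum_inner, Finset.mul_sum]
    refine Finset.sum_congr rfl fun i _ => ?_
    rw [real_inner_smul_left]; ring
  have hUb : -(∑ i, 2 * r i * t i) ≤ 2 * (‖U‖ * D) := by
    rw [hin]
    have := abs_le.1 (abs_real_inner_le_norm U (θ - θ₀))
    have : ‖U‖ * ‖θ - θ₀‖ ≤ ‖U‖ * D := by gcongr
    linarith
  have ht2 : ∑ i, t i ^ 2 ≤ D ^ 2 * S := by
    rw [hS, Finset.mul_sum]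
    refine Finset.sum_le_sum fun i _ => ?_
    have b1 : |t i| ≤ ‖(z i).2‖ * D := (abs_real_inner_le_norm _ _).trans (by gcongr)
    have := pow_le_pow_left₀ (abs_nonneg _) b1 2
    rw [sq_abs] at this
    linarith
  have hq : (-(∑ i, 2 * r i * t i) + ∑ i, t i ^ 2) / (2 * σ ^ 2) ≤
      (2 * (‖U‖ * D) + D ^ 2 * S) / (2 * σ₀ ^ 2) := by
    have hS0 : 0 ≤ S := Finset.sum_nonneg fun i _ => by positivity
    calc _ ≤ (2 * (‖U‖ * D) + D ^ 2 * S) / (2 * σ ^ 2) := by gcongr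
      _ ≤ _ := by gcongr
  -- The term linear in the score norm is traded for its square, whose mean is known exactly. The
  -- `1/2` spent here and the `1/2` from the normalizing constants make up the `1` in the exponent.
  have hyoung : (2 * (‖U‖ * D) + D ^ 2 * S) / (2 * σ₀ ^ 2) ≤
      1 / 2 + D ^ 2 * ‖U‖ ^ 2 / (2 * σ₀ ^ 4) + D ^ 2 * S / (2 * σ₀ ^ 2) := by
    have e : 1 / 2 + D ^ 2 * ‖U‖ ^ 2 / (2 * σ₀ ^ 4) + D ^ 2 * S / (2 * σ₀ ^ 2) -
        (2 * (‖U‖ * D) + D ^ 2 * S) / (2 * σ₀ ^ 2) = (1 - ‖U‖ * D / σ₀ ^ 2) ^ 2 / 2 := by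
      field_simp; ring
    have : 0 ≤ (1 - ‖U‖ * D / σ₀ ^ 2) ^ 2 / 2 := by positivity
    linarith
  linarith

/-! ### Mass of the prior near the truth -/

/-- The unnormalized Student weight `(τ² + t²)⁻²`. -/
noncomputable def studentWeight (τ t : ℝ) : ℝ := ((τ ^ 2 + t ^ 2) ^ 2)⁻¹

theorem studentWeight_pos {τ : ℝ} (hτ : 0 < τ) (t : ℝ) : 0 < studentWeight τ t := by
  unfold studentWeight; positivity

@[fun_prop]
theorem measurable_studentWeight (τ : ℝ) : Measurable (studentWeight τ) := by
  unfold studentWeight; fun_prop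

theorem integrable_inv_sq_add_sq {τ : ℝ} (hτ : 0 < τ) :
    Integrable fun t : ℝ => (τ ^ 2 + t ^ 2)⁻¹ := by
  have h := (integrable_inv_one_add_sq.comp_div hτ.ne').const_mul (τ ^ 2)⁻¹
  refine h.congr (Filter.Eventually.of_forall fun t => ?_)
  simp only
  rw [← mul_inv]; congr 1; field_simp

theorem integrable_sq_mul_studentWeight {τ : ℝ} (hτ : 0 < τ) :
    Integrable fun t : ℝ => t ^ 2 * studentWeight τ t := by
  refine (integrable_inv_sq_add_sq hτ).mono' (by fun_prop) (Filter.Eventually.of_forall fun t => ?_)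
  have := studentWeight_pos hτ t
  rw [Real.norm_of_nonneg (by positivity), studentWeight, ← div_eq_mul_inv,
    div_le_iff₀ (by positivity), sq (τ ^ 2 + t ^ 2), ← mul_assoc,
    inv_mul_cancel₀ (by positivity)]
  nlinarith [sq_nonneg τ]

theorem integrable_studentWeight {τ : ℝ} (hτ : 0 < τ) : Integrable (studentWeight τ) := by
  refine ((integrable_inv_sq_add_sq hτ).const_mul (τ ^ 2)⁻¹).mono' (by fun_prop)
    (Filter.Eventually.of_forall fun t => ?_)
  have := studentWeight_pos hτ t
  rw [Real.norm_of_nonneg this.le, studentWeight, ← mul_inv]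
  refine inv_anti₀ (by positivity) ?_
  rw [sq (τ ^ 2 + t ^ 2)]
  gcongr
  nlinarith [sq_nonneg t]

theorem integral_studentWeight_pos {τ : ℝ} (hτ : 0 < τ) : 0 < ∫ t, studentWeight τ t := by
  rw [integral_pos_iff_support_of_nonneg (fun t => (studentWeight_pos hτ t).le)
    (integrable_studentWeight hτ)]
  have : Function.support (studentWeight τ) = Set.univ :=
    Set.eq_univ_of_forall fun t => (studentWeight_pos hτ t).ne'
  simp [this]

/-- The function `t / (τ² + t²)` vanishes at both ends, and its derivative is `(τ² - t²)` times the
weight. -/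
theorem integral_sq_mul_studentWeight {τ : ℝ} (hτ : 0 < τ) :
    ∫ t, t ^ 2 * studentWeight τ t = τ ^ 2 * ∫ t, studentWeight τ t := by
  have hd : ∀ t : ℝ, HasDerivAt (fun t => t / (τ ^ 2 + t ^ 2))
      (τ ^ 2 * studentWeight τ t - t ^ 2 * studentWeight τ t) t := by
    intro t
    have h1 : HasDerivAt (fun t : ℝ => τ ^ 2 + t ^ 2) (2 * t) t := by
      simpa using (hasDerivAt_pow 2 t).const_add (τ ^ 2)
    have h2 := (hasDerivAt_id t).div h1 (by positivity)
    refine h2.congr_deriv ?_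
    unfold studentWeight
    simp only [id]
    field_simp
    ring
  have hb : ∀ t : ℝ, |t / (τ ^ 2 + t ^ 2)| ≤ |t|⁻¹ := by
    intro t
    rcases eq_or_ne t 0 with rfl | ht
    · simp
    · rw [abs_div, abs_of_pos (show 0 < τ ^ 2 + t ^ 2 by positivity), div_le_iff₀ (by positivity),
        ← sq_abs t]
      have : 0 < |t| := abs_pos.2 ht
      field_simp
      nlinarith [sq_nonneg τ]
  have l1 : Filter.Tendsto (fun t : ℝ => t / (τ ^ 2 + t ^ 2)) Filter.atTop (nhds 0) :=
    squeeze_zero_norm hb (tendsto_inv_atTop_zero.comp Filter.tendsto_abs_atTop_atTop)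
  have l2 : Filter.Tendsto (fun t : ℝ => t / (τ ^ 2 + t ^ 2)) Filter.atBot (nhds 0) :=
    squeeze_zero_norm hb (tendsto_inv_atTop_zero.comp Filter.tendsto_abs_atBot_atTop)
  have hi := ((integrable_studentWeight hτ).const_mul (τ ^ 2))
  have := integral_of_hasDerivAt_of_tendsto hd
    (hi.sub (integrable_sq_mul_studentWeight hτ)) l2 l1
  rw [integral_sub hi (integrable_sq_mul_studentWeight hτ), integral_const_mul] at this
  linarith

theorem lintegral_euclidean_prod {d : ℕ} {f : Fin d → ℝ → ℝ} (hi : ∀ i, Integrable (f i))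
    (h0 : ∀ i t, 0 ≤ f i t) :
    ∫⁻ θ : EuclideanSpace ℝ (Fin d), ENNReal.ofReal (∏ i, f i (θ i)) =
      ENNReal.ofReal (∏ i, ∫ t, f i t) := by
  have hp : Integrable fun x : Fin d → ℝ => ∏ i, f i (x i) :=
    Integrable.fintype_prod_dep hi
  rw [← integral_fintype_prod_volume_eq_prod, ofReal_integral_eq_lintegral_ofReal hp
    (Filter.Eventually.of_forall fun x => Finset.prod_nonneg fun i _ => h0 i _)]
  exact (PiLp.volume_preserving_ofLp (Fin d)).lintegral_comp_emb
    (MeasurableEquiv.toLp 2 (Fin d → ℝ)).symm.measurableEmbedding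
    (fun x : Fin d → ℝ => ENNReal.ofReal (∏ i, f i (x i)))

/-- The product Student weight. -/
noncomputable def studentProd {d : ℕ} (τ : ℝ) (θ : EuclideanSpace ℝ (Fin d)) : ℝ :=
  ∏ i, studentWeight τ (θ i)

theorem studentProd_pos {d : ℕ} {τ : ℝ} (hτ : 0 < τ) (θ : EuclideanSpace ℝ (Fin d)) :
    0 < studentProd τ θ := Finset.prod_pos fun _ _ => studentWeight_pos hτ _

@[fun_prop]
theorem measurable_studentProd {d : ℕ} (τ : ℝ) :
    Measurable (studentProd τ : EuclideanSpace ℝ (Fin d) → ℝ) := by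
  unfold studentProd; fun_prop

theorem lintegral_studentProd {d : ℕ} {τ : ℝ} (hτ : 0 < τ) :
    ∫⁻ θ : EuclideanSpace ℝ (Fin d), ENNReal.ofReal (studentProd τ θ) =
      ENNReal.ofReal ((∫ t, studentWeight τ t) ^ d) := by
  unfold studentProd
  rw [lintegral_euclidean_prod (f := fun _ => studentWeight τ)
    (fun _ => integrable_studentWeight hτ) fun _ t => (studentWeight_pos hτ t).le]
  simp

theorem lintegral_norm_sq_mul_studentProd {d : ℕ} {τ : ℝ} (hτ : 0 < τ) :
    ∫⁻ θ : EuclideanSpace ℝ (Fin d), ENNReal.ofReal (‖θ‖ ^ 2 * studentProd τ θ) =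
      ENNReal.ofReal (d * τ ^ 2 * (∫ t, studentWeight τ t) ^ d) := by
  set Z := ∫ t, studentWeight τ t with hZ
  have hZ0 := integral_studentWeight_pos hτ
  have e : ∀ θ : EuclideanSpace ℝ (Fin d), ENNReal.ofReal (‖θ‖ ^ 2 * studentProd τ θ) =
      ∑ k, ENNReal.ofReal (∏ i, (if i = k then θ i ^ 2 else 1) * studentWeight τ (θ i)) := by
    intro θ
    rw [euclidean_norm_sq_eq, Finset.sum_mul, ENNReal.ofReal_sum_of_nonneg
      fun k _ => mul_nonneg (sq_nonneg _) (studentProd_pos hτ θ).le]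
    refine Finset.sum_congr rfl fun k _ => ?_
    rw [Finset.prod_mul_distrib, Finset.prod_ite_eq' Finset.univ k fun i => θ i ^ 2]
    simp [studentProd]
  simp_rw [e]
  have hk : ∀ k : Fin d, ∫⁻ θ : EuclideanSpace ℝ (Fin d),
      ENNReal.ofReal (∏ i, (if i = k then θ i ^ 2 else 1) * studentWeight τ (θ i)) =
      ENNReal.ofReal (τ ^ 2 * Z ^ d) := by
    intro k
    rw [lintegral_euclidean_prod
      (f := fun i t => (if i = k then t ^ 2 else 1) * studentWeight τ t)]
    · have : ∀ i : Fin d, ∫ t, (if i = k then t ^ 2 else 1) * studentWeight τ t =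
          (if i = k then τ ^ 2 else 1) * Z := by
        intro i
        split_ifs
        · exact integral_sq_mul_studentWeight hτ
        · simp [hZ]
      simp_rw [this]
      rw [Finset.prod_mul_distrib, Finset.prod_ite_eq' Finset.univ k fun _ => τ ^ 2]
      simp
    · intro i
      split_ifs
      · exact integrable_sq_mul_studentWeight hτ
      · simpa using integrable_studentWeight hτ
    · intro i t
      have := studentWeight_pos hτ t
      split_ifs <;> positivity
  rw [lintegral_finsetSum _ fun k _ => by
    refine Measurable.ennreal_ofReal (Finset.measurable_prod _ fun i _ => ?_)
    split_ifs <;> fun_prop]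
  simp_rw [hk]
  rw [Finset.sum_const, Finset.card_univ, Fintype.card_fin, nsmul_eq_mul,
    ← ENNReal.ofReal_natCast, ← ENNReal.ofReal_mul (by positivity), mul_assoc]

/-- Three quarters of the mass of the product Student law is in the ball of radius `2τ√d`. -/
theorem lintegral_studentProd_ball {d : ℕ} (hd : 0 < d) {τ : ℝ} (hτ : 0 < τ) :
    ENNReal.ofReal (3 / 4 * (∫ t, studentWeight τ t) ^ d) ≤
      ∫⁻ θ in {θ : EuclideanSpace ℝ (Fin d) | ‖θ‖ ^ 2 ≤ 4 * d * τ ^ 2},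
        ENNReal.ofReal (studentProd τ θ) := by
  set A := (∫ t, studentWeight τ t) ^ d with hA
  have hA0 : 0 < A := pow_pos (integral_studentWeight_pos hτ) d
  have hd' : (0 : ℝ) < d := by exact_mod_cast hd
  have hms : MeasurableSet {θ : EuclideanSpace ℝ (Fin d) | ‖θ‖ ^ 2 ≤ 4 * d * τ ^ 2} :=
    measurableSet_le (by fun_prop) (by fun_prop)
  set X := ∫⁻ θ in {θ : EuclideanSpace ℝ (Fin d) | ‖θ‖ ^ 2 ≤ 4 * d * τ ^ 2},
        ENNReal.ofReal (studentProd τ θ) with hX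
  -- Markov's inequality: outside the ball `‖θ‖² / (4dτ²)` exceeds one, while its mean under the
  -- normalized law is `1/4`.
  have h1 : ENNReal.ofReal A ≤ X + ENNReal.ofReal (1 / 4 * A) := by
    rw [hA, ← lintegral_studentProd hτ, hX, ← lintegral_indicator hms]
    have e : ENNReal.ofReal (1 / 4 * (∫ t, studentWeight τ t) ^ d) =
        ∫⁻ θ : EuclideanSpace ℝ (Fin d), ENNReal.ofReal ((4 * d * τ ^ 2)⁻¹) *
          ENNReal.ofReal (‖θ‖ ^ 2 * studentProd τ θ) := by
      rw [lintegral_const_mul _ (by fun_prop), lintegral_norm_sq_mul_studentProd hτ,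
        ← ENNReal.ofReal_mul (by positivity)]
      congr 1; field_simp
    rw [e, ← lintegral_add_right _ (by fun_prop)]
    refine lintegral_mono fun θ => ?_
    by_cases h : ‖θ‖ ^ 2 ≤ 4 * d * τ ^ 2
    · rw [Set.indicator_of_mem (by exact h)]
      exact le_self_add
    · rw [Set.indicator_of_notMem (by exact h), zero_add, ← ENNReal.ofReal_mul (by positivity)]
      refine ENNReal.ofReal_le_ofReal ?_
      have := studentProd_pos hτ θ
      rw [← mul_assoc]
      refine le_mul_of_one_le_left this.le ?_
      rw [inv_mul_eq_div, one_le_div (by positivity)]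
      linarith
  by_contra hlt
  rw [not_le] at hlt
  have h2 : X + ENNReal.ofReal (1 / 4 * A) <
      ENNReal.ofReal (3 / 4 * A) + ENNReal.ofReal (1 / 4 * A) :=
    ENNReal.add_lt_add_right ENNReal.ofReal_ne_top hlt
  rw [← ENNReal.ofReal_add (by positivity) (by positivity)] at h2
  have := h1.trans_lt h2
  rw [show 3 / 4 * A + 1 / 4 * A = A by ring] at this
  exact lt_irrefl _ this

/-- The logarithmic price of translating the Student weight by `a`. -/
noncomputable def shiftCost (τ a : ℝ) : ℝ :=
  if a = 0 then 0 else 2 * Real.log 2 + 4 * Real.log (1 + |a| / τ)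

/-- This rests on `τ² + (t + a)² ≤ 2 (1 + |a|/τ)² (τ² + t²)`. The case `a = 0` is kept free of
charge: a factor `2` on every coordinate would bring in `d` instead of the sparsity. -/
theorem studentWeight_shift {τ : ℝ} (hτ : 0 < τ) (a t : ℝ) :
    Real.exp (-shiftCost τ a) * studentWeight τ t ≤ studentWeight τ (t + a) := by
  unfold shiftCost
  split_ifs with h
  · simp [h]
  · have h1 : 0 < 1 + |a| / τ := by positivity
    have e : Real.exp (-(2 * Real.log 2 + 4 * Real.log (1 + |a| / τ))) =
        ((2 * (1 + |a| / τ) ^ 2) ^ 2)⁻¹ := by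
      rw [Real.exp_neg, Real.exp_add]
      have a1 : Real.exp (2 * Real.log 2) = 2 ^ 2 := by
        rw [show (2 : ℝ) * Real.log 2 = Real.log (2 ^ 2) by rw [Real.log_pow]; norm_num,
          Real.exp_log (by norm_num)]
      have a2 : Real.exp (4 * Real.log (1 + |a| / τ)) = (1 + |a| / τ) ^ 4 := by
        rw [show 4 * Real.log (1 + |a| / τ) = Real.log ((1 + |a| / τ) ^ 4) by
          rw [Real.log_pow]; norm_num, Real.exp_log (by positivity)]
      rw [a1, a2]; ring_nf
    rw [e]
    unfold studentWeight
    rw [← mul_inv, ← mul_pow]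
    refine inv_anti₀ (by positivity) (pow_le_pow_left₀ (by positivity) ?_ 2)
    have b1 : 1 + (a / τ) ^ 2 ≤ (1 + |a| / τ) ^ 2 := by
      have : (a / τ) ^ 2 = (|a| / τ) ^ 2 := by rw [div_pow, div_pow, sq_abs]
      have : 0 ≤ |a| / τ := by positivity
      nlinarith
    calc τ ^ 2 + (t + a) ^ 2 ≤ 2 * (1 + (a / τ) ^ 2) * (τ ^ 2 + t ^ 2) := by
          have : 2 * (1 + (a / τ) ^ 2) * (τ ^ 2 + t ^ 2) =
              2 * τ ^ 2 + 2 * t ^ 2 + 2 * a ^ 2 + 2 * (a * t / τ) ^ 2 := by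
            field_simp; ring
          rw [this]
          nlinarith [sq_nonneg (t - a), sq_nonneg τ, sq_nonneg (a * t / τ)]
      _ ≤ _ := by gcongr

theorem studentProd_shift {d : ℕ} {τ : ℝ} (hτ : 0 < τ) (θ₀ θ : EuclideanSpace ℝ (Fin d)) :
    Real.exp (-∑ i, shiftCost τ (θ₀ i)) * studentProd τ θ ≤ studentProd τ (θ + θ₀) := by
  unfold studentProd
  rw [← Finset.sum_neg_distrib, Real.exp_sum, ← Finset.prod_mul_distrib]
  refine Finset.prod_le_prod (fun i _ => ?_) fun i _ => studentWeight_shift hτ _ _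
  have := studentWeight_pos hτ (θ i)
  positivity

/-- Jensen's inequality for the logarithm over the nonzero coordinates, obtained from the tangent
line at the average `y` of `1 + |θ₀ᵢ|/τ`. -/
theorem sum_shiftCost_le {d : ℕ} {τ : ℝ} (hτ : 0 < τ) (θ₀ : EuclideanSpace ℝ (Fin d))
    (hs : 1 ≤ sparsity θ₀) :
    ∑ i, shiftCost τ (θ₀ i) ≤ 2 * Real.log 2 * sparsity θ₀ +
      4 * (sparsity θ₀ * Real.log (1 + (∑ i, |θ₀ i|) / (sparsity θ₀ * τ))) := by
  set s := sparsity θ₀ with hsd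
  have hs0 : (0 : ℝ) < s := by exact_mod_cast hs
  set N := ∑ i, |θ₀ i| with hN
  have hN0 : 0 ≤ N := Finset.sum_nonneg fun _ _ => abs_nonneg _
  set y := 1 + N / (s * τ) with hy
  have hy0 : 0 < y := by positivity
  have hcard : (s : ℝ) = ∑ i : Fin d, if θ₀ i = 0 then (0 : ℝ) else 1 := by
    rw [hsd, sparsity, Set.ncard_eq_toFinset_card', Finset.sum_ite]
    simp
  have hterm : ∀ i, shiftCost τ (θ₀ i) ≤ (if θ₀ i = 0 then (0 : ℝ) else 1) *
      (2 * Real.log 2 + 4 * (Real.log y + y⁻¹ - 1)) + 4 * y⁻¹ / τ * |θ₀ i| := by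
    intro i
    unfold shiftCost
    split_ifs with h
    · simp [h]
    · have h1 : 0 < 1 + |θ₀ i| / τ := by positivity
      have := Real.log_le_sub_one_of_pos (show 0 < (1 + |θ₀ i| / τ) / y by positivity)
      rw [Real.log_div h1.ne' hy0.ne'] at this
      have e : (1 + |θ₀ i| / τ) / y = y⁻¹ + y⁻¹ / τ * |θ₀ i| := by field_simp
      rw [e] at this
      have e2 : 4 * y⁻¹ / τ * |θ₀ i| = 4 * (y⁻¹ / τ * |θ₀ i|) := by ring
      rw [e2]
      linarith
  have hsum := Finset.sum_le_sum fun i (_ : i ∈ Finset.univ) => hterm i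
  rw [Finset.sum_add_distrib, ← Finset.sum_mul, ← Finset.mul_sum, ← hcard, ← hN] at hsum
  refine hsum.trans (le_of_eq ?_)
  have e : (s : ℝ) * y⁻¹ + y⁻¹ / τ * N = s := by
    have : y⁻¹ * (s + N / τ) = s := by
      rw [inv_mul_eq_div, div_eq_iff hy0.ne', hy]; field_simp
    linear_combination this
  linear_combination 4 * e

theorem l1_le_sqrt_mul_norm {d : ℕ} (θ : EuclideanSpace ℝ (Fin d)) :
    (∑ i, |θ i|) ^ 2 ≤ d * ‖θ‖ ^ 2 := by
  rw [euclidean_norm_sq_eq]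
  have := sq_sum_le_card_mul_sum_sq (s := Finset.univ) (f := fun i => |θ i|)
  simpa using this

theorem measurableSet_l1Ball (d : ℕ) (C : ℝ) : MeasurableSet (l1Ball d C) :=
  measurableSet_le (by fun_prop) (by fun_prop)

theorem normalizeMeasure_univ_le_one {Ω : Type*} [MeasurableSpace Ω] (μ : Measure Ω) :
    normalizeMeasure μ Set.univ ≤ 1 := by
  simp only [normalizeMeasure, Measure.smul_apply, smul_eq_mul]
  exact ENNReal.inv_mul_le_one _

/-- Truncation does no harm: the whole ball lies in `B₁(C₁)` by Cauchy–Schwarz and the margin `2dτ`,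
and restricting the weight only lowers the normalizing constant. What remains is the centred ball
estimate, translated by `θ₀`. -/
theorem priorTheta_ball_ge {d : ℕ} (hd : 0 < d) {τ C₁ : ℝ} (hτ : 0 < τ)
    (θ₀ : EuclideanSpace ℝ (Fin d)) (hθ₀ : ∑ i, |θ₀ i| ≤ C₁ - 2 * d * τ) :
    ENNReal.ofReal (3 / 4 * Real.exp (-∑ i, shiftCost τ (θ₀ i))) ≤
      priorTheta d C₁ τ {θ | ‖θ - θ₀‖ ^ 2 ≤ 4 * d * τ ^ 2} := by
  have hd' : (0 : ℝ) < d := by exact_mod_cast hd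
  set A := (∫ t, studentWeight τ t) ^ d with hA
  have hA0 : 0 < A := pow_pos (integral_studentWeight_pos hτ) d
  set K := Real.exp (-∑ i, shiftCost τ (θ₀ i)) with hK
  have hK0 : 0 < K := Real.exp_pos _
  have hBm : MeasurableSet {θ : EuclideanSpace ℝ (Fin d) | ‖θ - θ₀‖ ^ 2 ≤ 4 * d * τ ^ 2} :=
    measurableSet_le (by fun_prop) (by fun_prop)
  have hB0 : MeasurableSet {θ : EuclideanSpace ℝ (Fin d) | ‖θ‖ ^ 2 ≤ 4 * d * τ ^ 2} :=
    measurableSet_le (by fun_prop) (by fun_prop)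
  have hsub : {θ : EuclideanSpace ℝ (Fin d) | ‖θ - θ₀‖ ^ 2 ≤ 4 * d * τ ^ 2} ⊆ l1Ball d C₁ := by
    intro θ hθ
    simp only [Set.mem_ofPred_eq, l1Ball] at hθ ⊢
    have h1 : ∑ i, |(θ - θ₀) i| ≤ 2 * d * τ := by
      refine abs_le_of_sq_le_sq' ?_ (by positivity) |>.2
      refine (l1_le_sqrt_mul_norm _).trans ?_
      nlinarith
    have h2 : ∑ i, |θ i| ≤ ∑ i, |(θ - θ₀) i| + ∑ i, |θ₀ i| := by
      rw [← Finset.sum_add_distrib]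
      refine Finset.sum_le_sum fun i _ => ?_
      have := abs_add_le ((θ - θ₀) i) (θ₀ i)
      simpa using this
    linarith
  have hmass : ENNReal.ofReal (K * (3 / 4 * A)) ≤
      ((volume.restrict (l1Ball d C₁)).withDensity
        (fun θ => ENNReal.ofReal (∏ i, ((τ ^ 2 + θ i ^ 2) ^ 2)⁻¹)))
        {θ | ‖θ - θ₀‖ ^ 2 ≤ 4 * d * τ ^ 2} := by
    rw [withDensity_apply _ hBm, Measure.restrict_restrict hBm, Set.inter_eq_left.2 hsub,
      ← lintegral_indicator hBm, ← lintegral_add_right_eq_self _ θ₀]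
    calc ENNReal.ofReal (K * (3 / 4 * A))
        = ENNReal.ofReal K * ENNReal.ofReal (3 / 4 * A) := ENNReal.ofReal_mul hK0.le
      _ ≤ ENNReal.ofReal K * ∫⁻ θ in {θ : EuclideanSpace ℝ (Fin d) | ‖θ‖ ^ 2 ≤ 4 * d * τ ^ 2},
            ENNReal.ofReal (studentProd τ θ) := by
          gcongr
          exact lintegral_studentProd_ball hd hτ
      _ = ∫⁻ θ, {θ : EuclideanSpace ℝ (Fin d) | ‖θ‖ ^ 2 ≤ 4 * d * τ ^ 2}.indicator
            (fun θ => ENNReal.ofReal (K * studentProd τ θ)) θ := by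
          rw [lintegral_indicator hB0, ← lintegral_const_mul _ (by fun_prop)]
          simp_rw [ENNReal.ofReal_mul hK0.le]
      _ ≤ _ := by
          refine lintegral_mono fun θ => ?_
          by_cases h : ‖θ‖ ^ 2 ≤ 4 * d * τ ^ 2
          · rw [Set.indicator_of_mem (by exact h), Set.indicator_of_mem (by simpa using h)]
            exact ENNReal.ofReal_le_ofReal (studentProd_shift hτ θ₀ θ)
          · rw [Set.indicator_of_notMem (by exact h)]
            exact bot_le
  have htot : ((volume.restrict (l1Ball d C₁)).withDensity
        (fun θ => ENNReal.ofReal (∏ i, ((τ ^ 2 + θ i ^ 2) ^ 2)⁻¹))) Set.univ ≤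
      ENNReal.ofReal A := by
    rw [withDensity_apply _ MeasurableSet.univ, Measure.restrict_univ, hA,
      ← lintegral_studentProd hτ]
    exact setLIntegral_le_lintegral _ _
  unfold priorTheta normalizeMeasure
  rw [Measure.smul_apply, smul_eq_mul]
  calc ENNReal.ofReal (3 / 4 * K) = (ENNReal.ofReal A)⁻¹ * ENNReal.ofReal (K * (3 / 4 * A)) := by
        rw [← ENNReal.ofReal_inv_of_pos hA0, ← ENNReal.ofReal_mul (by positivity)]
        congr 1; field_simp
    _ ≤ _ := by gcongr

/-! ### The inverse-Gamma law -/

theorem lintegral_Ioi_inv (g : ℝ → ℝ≥0∞) :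
    ∫⁻ x in Set.Ioi (0 : ℝ), g x =
      ∫⁻ u in Set.Ioi (0 : ℝ), ENNReal.ofReal ((u ^ 2)⁻¹) * g u⁻¹ := by
  have him : (fun u : ℝ => u⁻¹) '' Set.Ioi 0 = Set.Ioi 0 := by
    ext x
    constructor
    · rintro ⟨u, hu, rfl⟩
      exact inv_pos.2 (Set.mem_Ioi.1 hu)
    · intro hx
      exact ⟨x⁻¹, inv_pos.2 (Set.mem_Ioi.1 hx), inv_inv x⟩
  conv_lhs => rw [← him]
  rw [lintegral_image_eq_lintegral_abs_deriv_mul measurableSet_Ioi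
    (fun u hu => (hasDerivAt_inv (ne_of_gt hu)).hasDerivWithinAt) inv_injective.injOn]
  refine setLIntegral_congr_fun measurableSet_Ioi fun u _ => ?_
  rw [abs_neg, abs_of_nonneg (by positivity)]

/-- The unnormalized inverse-Gamma density. -/
noncomputable def invGammaKernel (m S x : ℝ) : ℝ := x ^ (-m - 1) * Real.exp (-(S / x))

theorem invGammaKernel_pos (m S : ℝ) {x : ℝ} (hx : 0 < x) : 0 < invGammaKernel m S x := by
  unfold invGammaKernel; positivity

@[fun_prop]
theorem measurable_invGammaKernel (m S : ℝ) : Measurable (invGammaKernel m S) := by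
  unfold invGammaKernel; fun_prop

/-- The substitution `x = 1/u` reduces this to the total mass of the Gamma law. -/
theorem lintegral_invGammaKernel {m S : ℝ} (hm : 0 < m) (hS : 0 < S) :
    ∫⁻ x in Set.Ioi (0 : ℝ), ENNReal.ofReal (invGammaKernel m S x) =
      ENNReal.ofReal (Real.Gamma m / S ^ m) := by
  have hΓ := Real.Gamma_pos_of_pos hm
  have hSm : 0 < S ^ m := Real.rpow_pos_of_pos hS m
  have h1 : ∫⁻ u in Set.Ioi (0 : ℝ), gammaPDF m S u = 1 := by
    have h := lintegral_add_compl (μ := volume) (gammaPDF m S) (measurableSet_Ioi (a := (0:ℝ)))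
    rwa [Set.compl_Ioi, setLIntegral_congr (Iio_ae_eq_Iic (a := (0:ℝ)) (μ := volume)).symm,
      lintegral_gammaPDF_of_nonpos le_rfl, add_zero, lintegral_gammaPDF_eq_one hm hS] at h
  rw [lintegral_Ioi_inv, ← mul_one (ENNReal.ofReal (Real.Gamma m / S ^ m)), ← h1,
    ← lintegral_const_mul' _ _ ENNReal.ofReal_ne_top]
  refine setLIntegral_congr_fun measurableSet_Ioi fun u hu => ?_
  have hu : 0 < u := hu
  rw [gammaPDF_of_nonneg hu.le, ← ENNReal.ofReal_mul (by positivity),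
    ← ENNReal.ofReal_mul (by positivity), invGammaKernel]
  congr 1
  have e1 : (u⁻¹) ^ (-m - 1) = u ^ (m - 1) * u ^ 2 := by
    rw [Real.inv_rpow hu.le, ← Real.rpow_neg hu.le, ← Real.rpow_natCast u 2, ← Real.rpow_add hu]
    congr 1; push_cast; ring
  rw [e1, div_inv_eq_mul]
  field_simp

theorem integrableOn_invGammaKernel {m S : ℝ} (hm : 0 < m) (hS : 0 < S) :
    IntegrableOn (invGammaKernel m S) (Set.Ioi 0) := by
  refine ⟨by fun_prop, ?_⟩
  rw [hasFiniteIntegral_iff_ofReal, lintegral_invGammaKernel hm hS]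
  · exact ENNReal.ofReal_lt_top
  · exact (ae_restrict_iff' measurableSet_Ioi).2
      (Filter.Eventually.of_forall fun x hx => (invGammaKernel_pos m S hx).le)

theorem integral_invGammaKernel {m S : ℝ} (hm : 0 < m) (hS : 0 < S) :
    ∫ x in Set.Ioi 0, invGammaKernel m S x = Real.Gamma m / S ^ m := by
  have hnn : 0 ≤ᵐ[volume.restrict (Set.Ioi 0)] invGammaKernel m S :=
    (ae_restrict_iff' measurableSet_Ioi).2
      (Filter.Eventually.of_forall fun x hx => (invGammaKernel_pos m S hx).le)
  have hΓ := Real.Gamma_pos_of_pos hm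
  have h := lintegral_invGammaKernel hm hS
  rw [← ofReal_integral_eq_lintegral_ofReal (integrableOn_invGammaKernel hm hS) hnn,
    ENNReal.ofReal_eq_ofReal_iff (integral_nonneg_of_ae hnn) (by positivity)] at h
  exact h

theorem lintegral_priorSigma (a b : ℝ) {f : ℝ → ℝ≥0∞} (hf : Measurable f) :
    ∫⁻ σ, f σ ∂(priorSigma a b) = ∫⁻ x in Set.Ioi (0 : ℝ),
      ENNReal.ofReal (b ^ a / Real.Gamma a * invGammaKernel a b x) * f (√x) := by
  have hm : Measurable fun x => f (√x) := hf.comp (by fun_prop)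
  unfold priorSigma invGammaMeasure
  rw [lintegral_map hf (by fun_prop), lintegral_withDensity_eq_lintegral_mul _ (by fun_prop) hm]
  simp only [Pi.mul_apply, invGammaKernel, mul_assoc]

theorem priorSigma_univ {a b : ℝ} (ha : 0 < a) (hb : 0 < b) : priorSigma a b Set.univ = 1 := by
  have hΓ := Real.Gamma_pos_of_pos ha
  rw [← lintegral_one, lintegral_priorSigma a b (f := fun _ => 1) measurable_const]
  simp only [mul_one]
  simp_rw [ENNReal.ofReal_mul (show 0 ≤ b ^ a / Real.Gamma a by positivity)]
  rw [lintegral_const_mul _ (by fun_prop), lintegral_invGammaKernel ha hb,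
    ← ENNReal.ofReal_mul (by positivity)]
  have : 0 < b ^ a := Real.rpow_pos_of_pos hb a
  rw [show b ^ a / Real.Gamma a * (Real.Gamma a / b ^ a) = 1 by field_simp, ENNReal.ofReal_one]

theorem ae_priorSigma_pos (a b : ℝ) : ∀ᵐ σ ∂(priorSigma a b), 0 < σ := by
  refine (ae_map_iff (by fun_prop) measurableSet_Ioi).2 ?_
  refine (withDensity_absolutelyContinuous _ _).ae_le ?_
  exact (ae_restrict_iff' measurableSet_Ioi).2
    (Filter.Eventually.of_forall fun x hx => Real.sqrt_pos.2 hx)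

/-- Window length times a lower bound for the density: the power is evaluated at `2σ₀²`, beyond the
right end, and the exponential at the left end. The window is one-sided to suit
`prod_linDensity_le_near`. -/
theorem priorSigma_near_ge {a b σ₀ : ℝ} (ha : 0 < a) (hb : 0 < b) (hσ₀ : 0 < σ₀) {n : ℕ}
    (hn : 0 < n) :
    ENNReal.ofReal (σ₀ ^ 2 * (n : ℝ)⁻¹ *
      (b ^ a / Real.Gamma a * ((2 * σ₀ ^ 2) ^ (-a - 1) * Real.exp (-(b / σ₀ ^ 2))))) ≤
      priorSigma a b {σ | 0 < σ ∧ σ₀ ^ 2 ≤ σ ^ 2 ∧ σ ^ 2 ≤ σ₀ ^ 2 * (1 + (n : ℝ)⁻¹)} := by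
  have hΓ := Real.Gamma_pos_of_pos ha
  have hn1 : (1 : ℝ) ≤ n := by exact_mod_cast hn
  have hs : 0 < σ₀ ^ 2 := by positivity
  have hms : MeasurableSet {σ : ℝ | 0 < σ ∧ σ₀ ^ 2 ≤ σ ^ 2 ∧ σ ^ 2 ≤ σ₀ ^ 2 * (1 + (n : ℝ)⁻¹)} :=
    (measurableSet_lt measurable_const measurable_id).inter
      ((measurableSet_le measurable_const (measurable_id.pow_const 2)).inter
        (measurableSet_le (measurable_id.pow_const 2) measurable_const))
  rw [← setLIntegral_one, ← lintegral_indicator hms,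
    lintegral_priorSigma a b (measurable_const.indicator hms)]
  set c := b ^ a / Real.Gamma a * ((2 * σ₀ ^ 2) ^ (-a - 1) * Real.exp (-(b / σ₀ ^ 2))) with hc
  have hc0 : 0 ≤ c := by positivity
  calc ENNReal.ofReal (σ₀ ^ 2 * (n : ℝ)⁻¹ * c)
      = ∫⁻ x in Set.Icc (σ₀ ^ 2) (σ₀ ^ 2 * (1 + (n : ℝ)⁻¹)), ENNReal.ofReal c := by
        rw [setLIntegral_const, Real.volume_Icc, ← ENNReal.ofReal_mul hc0]
        congr 1; ring
    _ ≤ ∫⁻ x in Set.Icc (σ₀ ^ 2) (σ₀ ^ 2 * (1 + (n : ℝ)⁻¹)),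
          ENNReal.ofReal (b ^ a / Real.Gamma a * invGammaKernel a b x) *
          {σ : ℝ | 0 < σ ∧ σ₀ ^ 2 ≤ σ ^ 2 ∧ σ ^ 2 ≤ σ₀ ^ 2 * (1 + (n : ℝ)⁻¹)}.indicator
            (fun _ => 1) (√x) := by
        refine setLIntegral_mono' measurableSet_Icc fun x hx => ?_
        have hx0 : 0 < x := hs.trans_le hx.1
        rw [Set.indicator_of_mem (by
          refine ⟨Real.sqrt_pos.2 hx0, ?_, ?_⟩ <;> rw [Real.sq_sqrt hx0.le]
          exacts [hx.1, hx.2]), mul_one]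
        refine ENNReal.ofReal_le_ofReal ?_
        rw [hc, invGammaKernel]
        have hp : (2 * σ₀ ^ 2) ^ (-a - 1) ≤ x ^ (-a - 1) := by
          refine Real.rpow_le_rpow_of_nonpos hx0 (hx.2.trans ?_) (by linarith)
          have : (n : ℝ)⁻¹ ≤ 1 := inv_le_one_of_one_le₀ hn1
          nlinarith
        have he : Real.exp (-(b / σ₀ ^ 2)) ≤ Real.exp (-(b / x)) := by
          have := hx.1
          gcongr
        gcongr
    _ ≤ _ := lintegral_mono_set fun x hx => hs.trans_le hx.1

/-! ### Averages of the scale loss under the inverse-Gamma law -/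

theorem scaleLoss_nonneg {α u : ℝ} (h0 : 0 < α) (h1 : α < 1) (hu : 0 < u) :
    0 ≤ scaleLoss α u := by
  unfold scaleLoss
  have h := Real.geom_mean_le_arith_mean2_weighted (w₁ := α) (w₂ := 1 - α) (p₁ := u) (p₂ := 1)
    h0.le (by linarith) hu.le zero_le_one (by ring)
  rw [Real.one_rpow, mul_one, mul_one] at h
  have h2 := Real.log_le_log (Real.rpow_pos_of_pos hu α) h
  rw [Real.log_rpow hu] at h2
  rw [show α * u + 1 - α = α * u + (1 - α) by ring]
  linarith

/-- The concave part `log (αu + 1 - α)` lies below its tangent at `w`, and `-log u` is bounded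
through a power `k`. The exponent is left free because, when `u` is proportional to `1/x` with `x`
inverse-Gamma of shape `m`, the moment of `x^k` needs `k < m`, and the shape may be below one. -/
theorem scaleLoss_le_tangent {α u w k : ℝ} (h0 : 0 < α) (h1 : α < 1) (hu : 0 < u) (hw : 0 < w)
    (hk : 0 < k) :
    scaleLoss α u ≤ scaleLoss α w + α * (u - w) / (α * w + 1 - α) +
      α * (((w / u) ^ k - 1) / k) := by
  unfold scaleLoss
  have hY : 0 < α * w + 1 - α := by nlinarith [mul_pos h0 hw]
  have hU : 0 < α * u + 1 - α := by nlinarith [mul_pos h0 hu]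
  have a1 := Real.log_le_sub_one_of_pos (show 0 < (α * u + 1 - α) / (α * w + 1 - α) by positivity)
  rw [Real.log_div hU.ne' hY.ne'] at a1
  have e1 : (α * u + 1 - α) / (α * w + 1 - α) - 1 = α * (u - w) / (α * w + 1 - α) := by
    field_simp; ring
  have a2 := Real.log_le_sub_one_of_pos (show 0 < (w / u) ^ k by positivity)
  rw [Real.log_rpow (by positivity), Real.log_div hw.ne' hu.ne'] at a2
  have a3 : Real.log w - Real.log u ≤ ((w / u) ^ k - 1) / k := by
    rw [le_div_iff₀ hk]; linarith
  have := mul_le_mul_of_nonneg_left a3 h0.le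
  linarith

/-- Near-sharp moments of the Gamma law: for every shape `m ≥ a` a suitable negative moment is
within `O(1/m)` of the corresponding power of the mean. -/
theorem exists_gamma_moment_bound {a : ℝ} (ha : 0 < a) :
    ∃ C : ℝ, 0 ≤ C ∧ ∀ m, a ≤ m → ∃ k, 0 < k ∧ k < m ∧ ∀ t, 0 ≤ t → t ≤ 2 * m →
      t * ((m ^ k * Real.Gamma (m - k) / Real.Gamma m - 1) / k) ≤ C := by
  have hcomp : IsCompact (Set.Icc a (max a 2)) := isCompact_Icc
  have hΓc : ∀ x : ℝ, 0 < x → ContinuousAt Real.Gamma x := fun x hx =>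
    (Real.differentiableAt_Gamma fun m => by
      have : (0 : ℝ) ≤ m := by positivity
      linarith).continuousAt
  have hcont : ContinuousOn (fun m : ℝ => m ^ (a / 2) * Real.Gamma (m - a / 2) / Real.Gamma m)
      (Set.Icc a (max a 2)) := by
    intro m hm
    have hm0 : 0 < m := ha.trans_le hm.1
    have hm1 : 0 < m - a / 2 := by linarith [hm.1]
    refine ContinuousAt.continuousWithinAt ?_
    refine ContinuousAt.div (ContinuousAt.mul ?_ ?_) (hΓc m hm0) (Real.Gamma_pos_of_pos hm0).ne'
    · exact Real.continuousAt_rpow_const _ _ (Or.inl hm0.ne')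
    · exact ContinuousAt.comp (f := fun m => m - a / 2) (hΓc _ hm1) (by fun_prop)
  obtain ⟨M, hM⟩ := hcomp.bddAbove_image hcont
  refine ⟨max 4 (8 / a * |M|), by positivity, fun m hm => ?_⟩
  have hm0 : 0 < m := ha.trans_le hm
  -- For `m ≥ 2` the choice `k = 1` gives the excess `1/(m - 1)` exactly. For `m ≤ 2` the choice `k
  -- = a/2` is admissible down to `m = a`, and continuity on a compact interval supplies the bound.
  rcases le_total 2 m with h2 | h2
  · refine ⟨1, one_pos, by linarith, fun t ht0 ht => le_max_of_le_left ?_⟩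
    have e : Real.Gamma m = (m - 1) * Real.Gamma (m - 1) := by
      have := Real.Gamma_add_one (s := m - 1) (by linarith)
      rwa [sub_add_cancel] at this
    have hG : 0 < Real.Gamma (m - 1) := Real.Gamma_pos_of_pos (by linarith)
    have hm1 : 0 < m - 1 := by linarith
    rw [e, Real.rpow_one, div_one, mul_div_mul_right _ _ hG.ne']
    have : m / (m - 1) - 1 = 1 / (m - 1) := by field_simp; ring
    rw [this, mul_one_div, div_le_iff₀ hm1]
    linarith
  · refine ⟨a / 2, by positivity, by linarith, fun t ht0 ht => le_max_of_le_right ?_⟩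
    have hX := hM (Set.mem_image_of_mem _ (show m ∈ Set.Icc a (max a 2) from
      ⟨hm, h2.trans (le_max_right _ _)⟩))
    set X := m ^ (a / 2) * Real.Gamma (m - a / 2) / Real.Gamma m
    have : (X - 1) / (a / 2) ≤ 2 / a * |M| := by
      rw [div_le_iff₀ (by positivity)]
      have : 2 / a * |M| * (a / 2) = |M| := by field_simp
      rw [this]
      linarith [le_abs_self M]
    calc t * ((X - 1) / (a / 2)) ≤ t * (2 / a * |M|) := by gcongr
      _ ≤ 4 * (2 / a * |M|) := by gcongr; linarith
      _ = 8 / a * |M| := by ring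

/-- Posterior average of the scale loss under a conjugate inverse-Gamma law. -/
theorem exists_lintegral_invGammaKernel_scaleLoss_le {a : ℝ} (ha : 0 < a) :
    ∃ C : ℝ, 0 ≤ C ∧ ∀ (n : ℕ) (α : ℝ), 0 < α → α < 1 → ∀ S σ₀ e₀ : ℝ, 0 < S → 0 < σ₀ → 0 ≤ e₀ →
      ∀ f : ℝ → ℝ, (∀ x, 0 < x → f x ≤ n * (scaleLoss α (σ₀ ^ 2 / x) / 2) + e₀) →
      ∫⁻ x in Set.Ioi (0 : ℝ), ENNReal.ofReal (invGammaKernel (a + n * α / 2) S x) *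
          ENNReal.ofReal (f x) ≤
        (∫⁻ x in Set.Ioi (0 : ℝ), ENNReal.ofReal (invGammaKernel (a + n * α / 2) S x)) *
          ENNReal.ofReal (n * (scaleLoss α ((a + n * α / 2) * σ₀ ^ 2 / S) / 2) + C + e₀) := by
  obtain ⟨C, hC0, hC⟩ := exists_gamma_moment_bound ha
  refine ⟨C, hC0, fun n α h0 h1 S σ₀ e₀ hS hσ₀ he₀ f hf => ?_⟩
  set m := a + n * α / 2 with hm
  have hna : (0 : ℝ) ≤ n * α := by positivity
  have hma : a ≤ m := by rw [hm]; linarith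
  have hm0 : 0 < m := ha.trans_le hma
  obtain ⟨k, hk0, hkm, hk⟩ := hC m hma
  -- `w` is the mean of `σ₀²/x` under the inverse-Gamma law with shape `m` and scale `S`, so the
  -- linear term of the tangent bound averages to zero.
  set w := m * σ₀ ^ 2 / S with hw
  have hw0 : 0 < w := by positivity
  set Y := α * w + 1 - α with hY
  have hY0 : 0 < Y := by rw [hY]; nlinarith [mul_pos h0 hw0]
  set c0 := n * scaleLoss α w / 2 - n * α * w / (2 * Y) - n * α / (2 * k) + e₀ with hc0
  set c1 := n * α * σ₀ ^ 2 / (2 * Y) with hc1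
  set c2 := n * α * (w / σ₀ ^ 2) ^ k / (2 * k) with hc2
  have hle : ∀ x, 0 < x → n * (scaleLoss α (σ₀ ^ 2 / x) / 2) + e₀ ≤ c0 + c1 * x⁻¹ + c2 * x ^ k := by
    intro x hx
    have ht := scaleLoss_le_tangent (u := σ₀ ^ 2 / x) h0 h1 (by positivity) hw0 hk0
    have e1 : w / (σ₀ ^ 2 / x) = w / σ₀ ^ 2 * x := by field_simp
    rw [e1, Real.mul_rpow (by positivity) hx.le] at ht
    have := mul_le_mul_of_nonneg_left ht (show (0 : ℝ) ≤ n / 2 by positivity)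
    refine le_trans (b := (n : ℝ) / 2 * (scaleLoss α w + α * (σ₀ ^ 2 / x - w) / Y +
      α * (((w / σ₀ ^ 2) ^ k * x ^ k - 1) / k)) + e₀) (by linarith) (le_of_eq ?_)
    rw [hc0, hc1, hc2]
    field_simp
    ring
  have hnn : ∀ x, 0 < x → 0 ≤ c0 + c1 * x⁻¹ + c2 * x ^ k := fun x hx => by
    have := scaleLoss_nonneg h0 h1 (show 0 < σ₀ ^ 2 / x by positivity)
    exact le_trans (by positivity) (hle x hx)
  have hker : ∀ x, 0 < x → invGammaKernel m S x * (c0 + c1 * x⁻¹ + c2 * x ^ k) =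
      c0 * invGammaKernel m S x + c1 * invGammaKernel (m + 1) S x +
        c2 * invGammaKernel (m - k) S x := by
    intro x hx
    unfold invGammaKernel
    have e1 : x ^ (-(m + 1) - 1) = x ^ (-m - 1) * x⁻¹ := by
      rw [← Real.rpow_neg_one, ← Real.rpow_add hx]; congr 1; ring
    have e2 : x ^ (-(m - k) - 1) = x ^ (-m - 1) * x ^ k := by
      rw [← Real.rpow_add hx]; congr 1; ring
    rw [e1, e2]; ring
  have i0 := (integrableOn_invGammaKernel hm0 hS).const_mul c0
  have i1 := (integrableOn_invGammaKernel (show 0 < m + 1 by linarith) hS).const_mul c1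
  have i2 := (integrableOn_invGammaKernel (show 0 < m - k by linarith) hS).const_mul c2
  have i01 : Integrable (fun x => c0 * invGammaKernel m S x + c1 * invGammaKernel (m + 1) S x)
      (volume.restrict (Set.Ioi 0)) := i0.add i1
  have i012 : Integrable (fun x => c0 * invGammaKernel m S x + c1 * invGammaKernel (m + 1) S x +
      c2 * invGammaKernel (m - k) S x) (volume.restrict (Set.Ioi 0)) := i01.add i2
  have hint : ∫ x in Set.Ioi 0, (c0 * invGammaKernel m S x + c1 * invGammaKernel (m + 1) S x +
        c2 * invGammaKernel (m - k) S x) =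
      c0 * (Real.Gamma m / S ^ m) + c1 * (Real.Gamma (m + 1) / S ^ (m + 1)) +
        c2 * (Real.Gamma (m - k) / S ^ (m - k)) := by
    rw [integral_add i01 i2, integral_add i0 i1, integral_const_mul, integral_const_mul,
      integral_const_mul, integral_invGammaKernel hm0 hS,
      integral_invGammaKernel (by linarith) hS, integral_invGammaKernel (by linarith) hS]
  have hΓ := Real.Gamma_pos_of_pos hm0
  have hSm : 0 < S ^ m := Real.rpow_pos_of_pos hS m
  have hSk : 0 < S ^ k := Real.rpow_pos_of_pos hS k
  calc ∫⁻ x in Set.Ioi (0 : ℝ), ENNReal.ofReal (invGammaKernel m S x) * ENNReal.ofReal (f x)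
      ≤ ∫⁻ x in Set.Ioi (0 : ℝ), ENNReal.ofReal (c0 * invGammaKernel m S x +
          c1 * invGammaKernel (m + 1) S x + c2 * invGammaKernel (m - k) S x) := by
        refine setLIntegral_mono' measurableSet_Ioi fun x hx => ?_
        have hx : 0 < x := hx
        have hp := invGammaKernel_pos m S hx
        rw [← ENNReal.ofReal_mul hp.le, ← hker x hx]
        exact ENNReal.ofReal_le_ofReal
          (mul_le_mul_of_nonneg_left ((hf x hx).trans (hle x hx)) hp.le)
    _ = ENNReal.ofReal (c0 * (Real.Gamma m / S ^ m) + c1 * (Real.Gamma (m + 1) / S ^ (m + 1)) +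
        c2 * (Real.Gamma (m - k) / S ^ (m - k))) := by
        rw [← hint, ofReal_integral_eq_lintegral_ofReal i012]
        refine (ae_restrict_iff' measurableSet_Ioi).2 (Filter.Eventually.of_forall fun x hx => ?_)
        simp only [Pi.zero_apply]
        rw [← hker x hx]
        exact mul_nonneg (invGammaKernel_pos m S hx).le (hnn x hx)
    _ ≤ ENNReal.ofReal (Real.Gamma m / S ^ m * (n * (scaleLoss α w / 2) + C + e₀)) := by
        refine ENNReal.ofReal_le_ofReal ?_
        have e1 : S ^ (m + 1) = S ^ m * S := by rw [Real.rpow_add hS, Real.rpow_one]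
        have e2 : S ^ (m - k) = S ^ m / S ^ k := Real.rpow_sub hS _ _
        have e3 : (w / σ₀ ^ 2) ^ k = m ^ k / S ^ k := by
          rw [← Real.div_rpow hm0.le hS.le]; congr 1; rw [hw]; field_simp
        -- The excess of the power moment is of order `1/m`. Its multiplier `nα/2` is at most `m`,
        -- so the product is bounded uniformly in `n` and `α`.
        have hkk := hk (n * α / 2) (by positivity) (by rw [hm]; linarith)
        have : c0 * (Real.Gamma m / S ^ m) + c1 * (Real.Gamma (m + 1) / S ^ (m + 1)) +
            c2 * (Real.Gamma (m - k) / S ^ (m - k)) = Real.Gamma m / S ^ m *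
            (n * (scaleLoss α w / 2) + (n * α / 2) *
              ((m ^ k * Real.Gamma (m - k) / Real.Gamma m - 1) / k) + e₀) := by
          rw [Real.Gamma_add_one hm0.ne', e1, e2, hc2, e3, hc0, hc1]
          have : w * S = m * σ₀ ^ 2 := by rw [hw]; field_simp
          field_simp
          linear_combination (-(n : ℝ) * α * Real.Gamma m * k) * this
        rw [this]
        gcongr
    _ = _ := by
        rw [ENNReal.ofReal_mul (by positivity), lintegral_invGammaKernel hm0 hS]

/-! ### The oracle bound -/

instance isFiniteMeasure_priorTheta (d : ℕ) (C₁ τ : ℝ) : IsFiniteMeasure (priorTheta d C₁ τ) :=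
  ⟨(normalizeMeasure_univ_le_one _).trans_lt ENNReal.one_lt_top⟩

theorem lintegral_likelihoodBound_le {d n : ℕ} (hn : 0 < n)
    (ν : Measure (EuclideanSpace ℝ (Fin d)))
    [IsProbabilityMeasure ν] (θ₀ : EuclideanSpace ℝ (Fin d)) {σ₀ Cx D : ℝ} (hσ₀ : 0 < σ₀)
    (hCx : ∫⁻ x, ENNReal.ofReal (‖x‖ ^ 2) ∂ν ≤ ENNReal.ofReal (Cx ^ 2))
    (hD : D ^ 2 * (n * Cx ^ 2) = 4) :
    ∫⁻ z, ENNReal.ofReal (1 + D ^ 2 * ‖∑ i, (((z i).1 - inner ℝ (z i).2 θ₀) • (z i).2)‖ ^ 2 /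
        (2 * σ₀ ^ 4) + D ^ 2 * (∑ i, ‖(z i).2‖ ^ 2) / (2 * σ₀ ^ 2))
      ∂(Measure.pi fun _ : Fin n => linModel ν θ₀ σ₀) ≤ ENNReal.ofReal (1 + 4 / σ₀ ^ 2) := by
  set P := Measure.pi fun _ : Fin n => linModel ν θ₀ σ₀ with hP
  have e : ∀ z : Fin n → ℝ × EuclideanSpace ℝ (Fin d),
      ENNReal.ofReal (1 + D ^ 2 * ‖∑ i, (((z i).1 - inner ℝ (z i).2 θ₀) • (z i).2)‖ ^ 2 /
        (2 * σ₀ ^ 4) + D ^ 2 * (∑ i, ‖(z i).2‖ ^ 2) / (2 * σ₀ ^ 2)) =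
      1 + ENNReal.ofReal (D ^ 2 / (2 * σ₀ ^ 4)) *
        ENNReal.ofReal (‖∑ i, (((z i).1 - inner ℝ (z i).2 θ₀) • (z i).2)‖ ^ 2) +
        ENNReal.ofReal (D ^ 2 / (2 * σ₀ ^ 2)) * ∑ i, ENNReal.ofReal (‖(z i).2‖ ^ 2) := by
    intro z
    have hS : 0 ≤ ∑ i, ‖(z i).2‖ ^ 2 := Finset.sum_nonneg fun i _ => by positivity
    rw [← ENNReal.ofReal_one, ← ENNReal.ofReal_sum_of_nonneg fun i _ => by positivity,
      ← ENNReal.ofReal_mul (by positivity), ← ENNReal.ofReal_mul (by positivity),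
      ← ENNReal.ofReal_add (by positivity) (by positivity),
      ← ENNReal.ofReal_add (by positivity) (by positivity)]
    congr 1; ring
  simp_rw [e]
  rw [lintegral_add_right _ (by fun_prop), lintegral_add_right _ (by fun_prop),
    lintegral_const_mul _ (by fun_prop), lintegral_const_mul _ (by fun_prop),
    lintegral_score_sq ν θ₀ σ₀ (hCx.trans_lt ENNReal.ofReal_lt_top).ne,
    lintegral_pi_sum (linModel ν θ₀ σ₀) (f := fun z => ENNReal.ofReal (‖z.2‖ ^ 2)) (by fun_prop),
    lintegral_linModel_norm_sq]
  calc _ ≤ 1 + ENNReal.ofReal (D ^ 2 / (2 * σ₀ ^ 4)) *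
          (n * (ENNReal.ofReal (σ₀ ^ 2) * ENNReal.ofReal (Cx ^ 2))) +
          ENNReal.ofReal (D ^ 2 / (2 * σ₀ ^ 2)) * (n * ENNReal.ofReal (Cx ^ 2)) := by
        rw [lintegral_const]
        gcongr
        simp [hP]
    _ = _ := by
        rw [← ENNReal.ofReal_natCast n, ← ENNReal.ofReal_one, ← ENNReal.ofReal_mul (by positivity),
          ← ENNReal.ofReal_mul (by positivity), ← ENNReal.ofReal_mul (by positivity),
          ← ENNReal.ofReal_mul (by positivity), ← ENNReal.ofReal_mul (by positivity),
          ← ENNReal.ofReal_add (by positivity) (by positivity),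
          ← ENNReal.ofReal_add (by positivity) (by positivity)]
        congr 1
        have e1 : D ^ 2 / (2 * σ₀ ^ 4) * (n * (σ₀ ^ 2 * Cx ^ 2)) = 2 / σ₀ ^ 2 := by
          field_simp; linear_combination hD
        have e2 : D ^ 2 / (2 * σ₀ ^ 2) * (n * Cx ^ 2) = 2 / σ₀ ^ 2 := by
          field_simp; linear_combination hD
        rw [e1, e2]; ring

/-- Posterior loss bound from the prior mass near the truth. -/
theorem lintegral_loss_le_of_prior_mass {a σmin : ℝ} (ha : 0 < a) (hσmin : 0 < σmin)
    {α : ℝ} (h0 : 0 < α) (h1 : α < 1) {n d : ℕ} (hn : 0 < n) (hd : 0 < d)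
    (ν : Measure (EuclideanSpace ℝ (Fin d)))
    [IsProbabilityMeasure ν] {Cx C₁ τ σ₀ : ℝ} (θ₀ : EuclideanSpace ℝ (Fin d)) (hCx0 : 0 < Cx)
    (hCx : ∫⁻ x, ENNReal.ofReal (‖x‖ ^ 2) ∂ν ≤ ENNReal.ofReal (Cx ^ 2))
    (hσ₀ : 0 < σ₀) (hσm : (2 * σmin)⁻¹ < σ₀ ^ 2)
    (hτ : τ = (Cx * √((n : ℝ) * (d : ℝ)))⁻¹) (hθ₀ : ∑ i, |θ₀ i| ≤ C₁ - 2 * (d : ℝ) * τ) :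
    ∫⁻ z, ∫⁻ q, ENNReal.ofReal (n * affinityLoss ν α θ₀ σ₀ q)
        ∂(fracPosterior ((priorTheta d C₁ τ).prod (priorSigma a (√(n : ℝ))⁻¹)) α z)
      ∂(Measure.pi fun _ : Fin n => linModel ν θ₀ σ₀) ≤
    ENNReal.ofReal (∑ i, shiftCost τ (θ₀ i) + a * Real.log (σ₀ ^ 2) + (1 + a / 2) * Real.log n +
      (Real.log (Real.Gamma a) + (a + 1) * Real.log 2 + Real.log (4 / 3) + 2 + 10 * σmin)) := by
  have hn' : (0 : ℝ) < n := by exact_mod_cast hn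
  have hn1 : (1 : ℝ) ≤ n := by exact_mod_cast hn
  have hd' : (0 : ℝ) < d := by exact_mod_cast hd
  have hsq : 0 < √((n : ℝ) * d) := Real.sqrt_pos.2 (by positivity)
  have hτ0 : 0 < τ := by rw [hτ]; positivity
  have hs : 0 < σ₀ ^ 2 := by positivity
  have hΓ := Real.Gamma_pos_of_pos ha
  set b := (√(n : ℝ))⁻¹ with hb
  have hsn : 0 < √(n : ℝ) := Real.sqrt_pos.2 hn'
  have hb0 : 0 < b := by positivity
  have hb1 : b ≤ 1 := inv_le_one_of_one_le₀ (Real.one_le_sqrt.2 hn1)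
  have hinv : 1 / σ₀ ^ 2 ≤ 2 * σmin := by
    rw [div_le_iff₀ hs]
    have := (inv_lt_iff_one_lt_mul₀ (show 0 < 2 * σmin by positivity)).1 hσm
    linarith
  have hfin : IsProbabilityMeasure (priorSigma a b) := ⟨priorSigma_univ ha hb0⟩
  set D := 2 * √(d : ℝ) * τ with hDd
  have hD2 : D ^ 2 = 4 * d * τ ^ 2 := by
    rw [hDd, mul_pow, mul_pow, Real.sq_sqrt hd'.le]; ring
  -- This is the calibration behind `τ`: displacements of size `2τ√d` change the expected
  -- log-likelihood bound only by a constant.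
  have hD : D ^ 2 * (n * Cx ^ 2) = 4 := by
    rw [hD2, hτ, inv_pow, mul_pow, Real.sq_sqrt (by positivity)]
    field_simp
  set Bσ := {σ : ℝ | 0 < σ ∧ σ₀ ^ 2 ≤ σ ^ 2 ∧ σ ^ 2 ≤ σ₀ ^ 2 * (1 + (n : ℝ)⁻¹)} with hBσ
  set Bθ := {θ : EuclideanSpace ℝ (Fin d) | ‖θ - θ₀‖ ^ 2 ≤ 4 * d * τ ^ 2} with hBθ
  set π := (priorTheta d C₁ τ).prod (priorSigma a b) with hπ
  have hπ1 : π Set.univ ≤ 1 := by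
    rw [hπ, ← Set.univ_prod_univ, Measure.prod_prod, priorSigma_univ ha hb0, mul_one]
    exact normalizeMeasure_univ_le_one _
  set kθ := ∑ i, shiftCost τ (θ₀ i) with hkθ
  set κ := Real.log (4 / 3) + kθ + (a * Real.log (σ₀ ^ 2) + (1 + a / 2) * Real.log n +
    Real.log (Real.Gamma a) + (a + 1) * Real.log 2 + b / σ₀ ^ 2) with hκ
  have hmassσ : Real.exp (-(a * Real.log (σ₀ ^ 2) + (1 + a / 2) * Real.log n +
      Real.log (Real.Gamma a) + (a + 1) * Real.log 2 + b / σ₀ ^ 2)) = σ₀ ^ 2 * (n : ℝ)⁻¹ *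
      (b ^ a / Real.Gamma a * ((2 * σ₀ ^ 2) ^ (-a - 1) * Real.exp (-(b / σ₀ ^ 2)))) := by
    have h2 : 0 < (2 * σ₀ ^ 2) ^ (-a - 1) := by positivity
    have h3 : 0 < b ^ a := by positivity
    rw [← Real.exp_log (show 0 < σ₀ ^ 2 * (n : ℝ)⁻¹ *
      (b ^ a / Real.Gamma a * ((2 * σ₀ ^ 2) ^ (-a - 1) * Real.exp (-(b / σ₀ ^ 2)))) by positivity)]
    congr 1
    rw [Real.log_mul (by positivity) (by positivity), Real.log_mul hs.ne' (by positivity),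
      Real.log_mul (by positivity) (by positivity), Real.log_div h3.ne' hΓ.ne',
      Real.log_mul h2.ne' (Real.exp_pos _).ne', Real.log_exp, Real.log_inv, Real.log_rpow hb0,
      Real.log_rpow (by positivity), Real.log_mul two_ne_zero hs.ne', hb, Real.log_inv,
      Real.log_sqrt hn'.le]
    ring
  have hBmass : ENNReal.ofReal (Real.exp (-κ)) ≤ π (Bθ ×ˢ Bσ) := by
    rw [hπ, Measure.prod_prod]
    have hex : Real.exp (-κ) = (3 / 4 * Real.exp (-kθ)) *
        Real.exp (-(a * Real.log (σ₀ ^ 2) + (1 + a / 2) * Real.log n +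
          Real.log (Real.Gamma a) + (a + 1) * Real.log 2 + b / σ₀ ^ 2)) := by
      rw [hκ, neg_add, neg_add, Real.exp_add, Real.exp_add, Real.exp_neg (Real.log (4 / 3)),
        Real.exp_log (by norm_num)]
      norm_num
    rw [hex, ENNReal.ofReal_mul (by positivity), hmassσ]
    exact mul_le_mul' (priorTheta_ball_ge hd hτ0 θ₀ hθ₀) (priorSigma_near_ge ha hb0 hσ₀ hn)
  -- The sign follows from the mass bound itself: `e^{-κ}` is at most a prior mass, hence at most
  -- one.
  have hκ0 : 0 ≤ κ := by
    have := (hBmass.trans (measure_mono (Set.subset_univ _))).trans hπ1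
    rw [← ENNReal.ofReal_one, ENNReal.ofReal_le_ofReal_iff zero_le_one, Real.exp_le_one_iff] at this
    linarith
  have hπp : ∀ᵐ q ∂π, 0 < q.2 :=
    Measure.quasiMeasurePreserving_snd.ae (ae_priorSigma_pos a b)
  have key := lintegral_affinityLoss_fracPosterior_le (n := n) ν h0 h1 θ₀ hσ₀ hCx π hπ1 hπp
    (Bθ ×ˢ Bσ) hκ0 hBmass (fun z => 1 + D ^ 2 *
      ‖∑ i, (((z i).1 - inner ℝ (z i).2 θ₀) • (z i).2)‖ ^ 2 / (2 * σ₀ ^ 4) +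
        D ^ 2 * (∑ i, ‖(z i).2‖ ^ 2) / (2 * σ₀ ^ 2))
    (fun z => by
      have hS : 0 ≤ ∑ i, ‖(z i).2‖ ^ 2 := Finset.sum_nonneg fun i _ => by positivity
      positivity) (by fun_prop)
    (fun z q hq => by
      obtain ⟨hq1, hq2⟩ := hq
      refine prod_linDensity_le_near q.1 θ₀ hq2.1 hσ₀ ?_ hq2.2.1 hn hq2.2.2 z
      refine abs_le_of_sq_le_sq' ?_ (by positivity) |>.2
      rw [hD2]; exact hq1)
  refine key.trans ?_
  have hG := lintegral_likelihoodBound_le hn ν θ₀ hσ₀ hCx hD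
  calc _ ≤ ENNReal.ofReal κ + ENNReal.ofReal (1 + 4 / σ₀ ^ 2) + ENNReal.ofReal 1 := by
        rw [ENNReal.ofReal_one]
        gcongr
    _ = ENNReal.ofReal (κ + (1 + 4 / σ₀ ^ 2) + 1) := by
        rw [← ENNReal.ofReal_add hκ0 (by positivity),
          ← ENNReal.ofReal_add (by positivity) zero_le_one]
    _ ≤ _ := by
        refine ENNReal.ofReal_le_ofReal ?_
        have e1 : b / σ₀ ^ 2 ≤ 2 * σmin := by
          refine le_trans ?_ hinv
          gcongr
        have e2 : 4 / σ₀ ^ 2 = 4 * (1 / σ₀ ^ 2) := by ring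
        rw [hκ, e2]
        linarith

/-! ### Conjugacy in the variance -/

theorem fracLik_eq {d n : ℕ} (α : ℝ) (z : Fin n → ℝ × EuclideanSpace ℝ (Fin d))
    (θ : EuclideanSpace ℝ (Fin d)) {x : ℝ} (hx : 0 < x) :
    fracLik α z (θ, √x) = (2 * Real.pi) ^ (-(n * α / 2)) * (x ^ (-(n * α / 2)) *
      Real.exp (-(α * (∑ i, ((z i).1 - inner ℝ (z i).2 θ) ^ 2) / 2 / x))) := by
  have h2 : (0 : ℝ) < 2 * Real.pi := by positivity
  unfold fracLik
  simp_rw [linDensity_eq_exp θ (Real.sqrt_pos.2 hx), Real.sq_sqrt hx.le]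
  rw [← Real.exp_sum, ← Real.exp_mul, Real.rpow_def_of_pos h2, Real.rpow_def_of_pos hx,
    ← Real.exp_add, ← Real.exp_add, Finset.sum_sub_distrib, Finset.sum_const, Finset.card_univ,
    Fintype.card_fin, nsmul_eq_mul, ← Finset.sum_div]
  congr 1
  field_simp
  ring

/-- Conjugacy for fixed `θ`: the tempered likelihood raises the shape by `nα/2` and the scale by
`α/2` times the residual sum of squares. The prefactor does not depend on `θ` or `x`. -/
theorem priorSigma_fracLik_eq {d n : ℕ} (a b α : ℝ) (z : Fin n → ℝ × EuclideanSpace ℝ (Fin d))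
    (θ : EuclideanSpace ℝ (Fin d)) {x : ℝ} (hx : 0 < x) :
    b ^ a / Real.Gamma a * invGammaKernel a b x * fracLik α z (θ, √x) =
      (b ^ a / Real.Gamma a * (2 * Real.pi) ^ (-(n * α / 2))) *
        invGammaKernel (a + n * α / 2)
          (b + α * (∑ i, ((z i).1 - inner ℝ (z i).2 θ) ^ 2) / 2) x := by
  rw [fracLik_eq α z θ hx]
  unfold invGammaKernel
  have e1 : x ^ (-(a + n * α / 2) - 1) = x ^ (-a - 1) * x ^ (-(n * α / 2)) := by
    rw [← Real.rpow_add hx]; congr 1; ring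
  have e2 : Real.exp (-((b + α * (∑ i, ((z i).1 - inner ℝ (z i).2 θ) ^ 2) / 2) / x)) =
      Real.exp (-(b / x)) *
        Real.exp (-(α * (∑ i, ((z i).1 - inner ℝ (z i).2 θ) ^ 2) / 2 / x)) := by
    rw [← Real.exp_add]; congr 1; ring
  rw [e1, e2]; ring

theorem ae_priorTheta_mem (d : ℕ) (C₁ τ : ℝ) :
    ∀ᵐ θ ∂(priorTheta d C₁ τ), θ ∈ l1Ball d C₁ := by
  unfold priorTheta normalizeMeasure
  refine Measure.ae_smul_measure ?_ _
  refine (withDensity_absolutelyContinuous _ _).ae_le ?_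
  exact ae_restrict_mem (measurableSet_l1Ball d C₁)

theorem norm_le_sum_abs {d : ℕ} (θ : EuclideanSpace ℝ (Fin d)) : ‖θ‖ ≤ ∑ i, |θ i| := by
  refine abs_le_of_sq_le_sq' ?_ (Finset.sum_nonneg fun _ _ => abs_nonneg _) |>.2
  rw [euclidean_norm_sq_eq]
  calc ∑ i, θ i ^ 2 = ∑ i, |θ i| ^ 2 := by simp
    _ ≤ _ := Finset.sum_sq_le_sq_sum_of_nonneg fun i _ => abs_nonneg _

theorem norm_sub_le_of_mem_l1Ball {d : ℕ} {C₁ : ℝ} {θ θ₀ : EuclideanSpace ℝ (Fin d)}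
    (h : θ ∈ l1Ball d C₁) (h₀ : θ₀ ∈ l1Ball d C₁) : ‖θ - θ₀‖ ≤ 2 * C₁ := by
  have h : ∑ i, |θ i| ≤ C₁ := h
  have h₀ : ∑ i, |θ₀ i| ≤ C₁ := h₀
  have := norm_sub_le θ θ₀
  have := norm_le_sum_abs θ
  have := norm_le_sum_abs θ₀
  linarith

/-- Given the data, the posterior expected loss is controlled by the scale loss at the posterior
mean of the precision, uniformly over the regression parameter. -/
theorem exists_posterior_loss_le {a : ℝ} (ha : 0 < a) :
    ∃ C : ℝ, 0 ≤ C ∧ ∀ (α : ℝ), 0 < α → α < 1 → ∀ (n d : ℕ)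
      (ν : Measure (EuclideanSpace ℝ (Fin d))) [IsProbabilityMeasure ν]
      (Cx C₁ τ b σ₀ F : ℝ) (θ₀ : EuclideanSpace ℝ (Fin d)),
      ∫⁻ x, ENNReal.ofReal (‖x‖ ^ 2) ∂ν ≤ ENNReal.ofReal (Cx ^ 2) → 0 < b → 0 < σ₀ →
      θ₀ ∈ l1Ball d C₁ →
      ∀ z : Fin n → ℝ × EuclideanSpace ℝ (Fin d),
      (∀ θ ∈ l1Ball d C₁, n * scaleLoss α ((a + n * α / 2) * σ₀ ^ 2 /
        (b + α * (∑ i, ((z i).1 - inner ℝ (z i).2 θ) ^ 2) / 2)) ≤ F) →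
      ∫⁻ q, ENNReal.ofReal (n * affinityLoss ν α θ₀ σ₀ q)
        ∂(fracPosterior ((priorTheta d C₁ τ).prod (priorSigma a b)) α z) ≤
        ENNReal.ofReal (F + C + 2 * (n * Cx ^ 2 * C₁ ^ 2 / σ₀ ^ 2)) := by
  obtain ⟨C, hC0, hC⟩ := exists_lintegral_invGammaKernel_scaleLoss_le ha
  refine ⟨C, hC0, fun α h0 h1 n d ν _ Cx C₁ τ b σ₀ F θ₀ hCx hb hσ₀ hθ₀ z hF => ?_⟩
  have hΓ := Real.Gamma_pos_of_pos ha
  have hfin : IsProbabilityMeasure (priorSigma a b) := ⟨priorSigma_univ ha hb⟩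
  set e₀ := 2 * (n * Cx ^ 2 * C₁ ^ 2 / σ₀ ^ 2) with he₀
  have he0 : 0 ≤ e₀ := by positivity
  -- The target bound is free of `θ`, so comparing unnormalized integrals over `σ` for each `θ`
  -- suffices. The marginal posterior of `θ` never has to be known.
  refine lintegral_fracPosterior_le_of_le (by fun_prop) ?_
  have hm1 : Measurable fun q : EuclideanSpace ℝ (Fin d) × ℝ =>
      ENNReal.ofReal (fracLik α z q) * ENNReal.ofReal (n * affinityLoss ν α θ₀ σ₀ q) := by fun_prop
  have hm2 : Measurable fun q : EuclideanSpace ℝ (Fin d) × ℝ =>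
      ENNReal.ofReal (fracLik α z q) := by fun_prop
  rw [lintegral_prod _ hm1.aemeasurable, lintegral_prod _ hm2.aemeasurable,
    ← lintegral_mul_const' _ _ ENNReal.ofReal_ne_top]
  refine lintegral_mono_ae ?_
  filter_upwards [ae_priorTheta_mem d C₁ τ] with θ hθ
  have hr1 : Measurable fun σ : ℝ => ENNReal.ofReal (fracLik α z (θ, σ)) *
      ENNReal.ofReal (n * affinityLoss ν α θ₀ σ₀ (θ, σ)) := hm1.comp measurable_prodMk_left
  have hr2 : Measurable fun σ : ℝ => ENNReal.ofReal (fracLik α z (θ, σ)) :=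
    hm2.comp measurable_prodMk_left
  rw [lintegral_priorSigma a b hr1, lintegral_priorSigma a b hr2]
  set S := b + α * (∑ i, ((z i).1 - inner ℝ (z i).2 θ) ^ 2) / 2 with hS
  have hR : 0 ≤ ∑ i, ((z i).1 - inner ℝ (z i).2 θ) ^ 2 :=
    Finset.sum_nonneg fun i _ => sq_nonneg _
  have hS0 : 0 < S := by positivity
  set K := b ^ a / Real.Gamma a * (2 * Real.pi) ^ (-(n * α / 2)) with hK
  have hK0 : 0 ≤ K := by positivity
  have hker : ∀ x, 0 < x → ENNReal.ofReal (b ^ a / Real.Gamma a * invGammaKernel a b x) *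
      ENNReal.ofReal (fracLik α z (θ, √x)) =
      ENNReal.ofReal K * ENNReal.ofReal (invGammaKernel (a + n * α / 2) S x) := by
    intro x hx
    have := invGammaKernel_pos a b hx
    rw [← ENNReal.ofReal_mul (by positivity), ← ENNReal.ofReal_mul hK0,
      priorSigma_fracLik_eq a b α z θ hx]
  have hloss := hC n α h0 h1 S σ₀ e₀ hS0 hσ₀ he0
    (fun x => n * affinityLoss ν α θ₀ σ₀ (θ, √x)) (fun x hx => by
      have h := affinityLoss_le ν h0 h1 θ θ₀ (Real.sqrt_pos.2 hx) hσ₀ hCx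
      rw [Real.sq_sqrt hx.le] at h
      have hn := norm_sub_le_of_mem_l1Ball hθ hθ₀
      -- The diameter of the `ℓ₁` ball is a crude bound on the error in `θ`, but it is divided by
      -- `σ₀²`, which is huge in the regime where this is used.
      have h3 : Cx ^ 2 * ‖θ - θ₀‖ ^ 2 / (2 * σ₀ ^ 2) ≤ Cx ^ 2 * (2 * C₁) ^ 2 / (2 * σ₀ ^ 2) := by
        gcongr
      have h4 := mul_le_mul_of_nonneg_left (h.trans (add_le_add_right h3 _))
        (Nat.cast_nonneg (α := ℝ) n)
      refine h4.trans (le_of_eq ?_)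
      rw [he₀]
      field_simp)
  calc _ = ENNReal.ofReal K * ∫⁻ x in Set.Ioi (0 : ℝ),
          ENNReal.ofReal (invGammaKernel (a + n * α / 2) S x) *
            ENNReal.ofReal (n * affinityLoss ν α θ₀ σ₀ (θ, √x)) := by
        rw [← lintegral_const_mul' _ _ ENNReal.ofReal_ne_top]
        refine setLIntegral_congr_fun measurableSet_Ioi fun x hx => ?_
        rw [← mul_assoc, hker x hx, mul_assoc]
    _ ≤ ENNReal.ofReal K * ((∫⁻ x in Set.Ioi (0 : ℝ),
          ENNReal.ofReal (invGammaKernel (a + n * α / 2) S x)) *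
          ENNReal.ofReal (n * (scaleLoss α ((a + n * α / 2) * σ₀ ^ 2 / S) / 2) + C + e₀)) := by
        gcongr
    _ ≤ ENNReal.ofReal K * ((∫⁻ x in Set.Ioi (0 : ℝ),
          ENNReal.ofReal (invGammaKernel (a + n * α / 2) S x)) * ENNReal.ofReal (F + C + e₀)) := by
        have hw : 0 < (a + n * α / 2) * σ₀ ^ 2 / S := by positivity
        have h5 := hF θ hθ
        have h6 : 0 ≤ n * scaleLoss α ((a + n * α / 2) * σ₀ ^ 2 / S) :=
          mul_nonneg (Nat.cast_nonneg _) (scaleLoss_nonneg h0 h1 hw)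
        gcongr
        linarith
    _ = _ := by
        rw [← mul_assoc, ← lintegral_const_mul' _ _ ENNReal.ofReal_ne_top]
        congr 1
        refine setLIntegral_congr_fun measurableSet_Ioi fun x hx => ?_
        rw [hker x hx]

/-! ### The scale loss at the posterior mean of the precision -/

theorem sum_sq_sub_le {n : ℕ} (e v : Fin n → ℝ) {η : ℝ} (hη : 0 < η) :
    ∑ i, (e i - v i) ^ 2 ≤ (1 + η) * ∑ i, e i ^ 2 + (1 + η⁻¹) * ∑ i, v i ^ 2 := by
  rw [Finset.mul_sum, Finset.mul_sum, ← Finset.sum_add_distrib]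
  refine Finset.sum_le_sum fun i _ => ?_
  have h : 0 ≤ η * (e i + η⁻¹ * v i) ^ 2 := by positivity
  have : η * (e i + η⁻¹ * v i) ^ 2 = η * e i ^ 2 + 2 * e i * v i + η⁻¹ * v i ^ 2 := by
    field_simp
    ring
  nlinarith

theorem le_sum_sq_sub {n : ℕ} (e v : Fin n → ℝ) {η : ℝ} (hη : 0 < η) :
    (1 - η) * ∑ i, e i ^ 2 - η⁻¹ * ∑ i, v i ^ 2 ≤ ∑ i, (e i - v i) ^ 2 := by
  rw [Finset.mul_sum, Finset.mul_sum, ← Finset.sum_sub_distrib]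
  refine Finset.sum_le_sum fun i _ => ?_
  have h : 0 ≤ η * (e i - η⁻¹ * v i) ^ 2 := by positivity
  have : η * (e i - η⁻¹ * v i) ^ 2 = η * e i ^ 2 - 2 * e i * v i + η⁻¹ * v i ^ 2 := by
    field_simp
    ring
  nlinarith [sq_nonneg (v i)]

/-- Since the precision is at most about `1/q`, multiplying the argument of the logarithm by `q`
gives at most `α + (1 - α) q + O(1/n)`, and `log x ≤ x - 1` applies. The term `n(1 - α)(q - 1)` is
kept exactly, as it must combine with `nα(q - 1)` from `-α log w` into `n (q - 1 - log q)`. -/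
theorem log_precision_le {a α β R q n : ℝ} (ha : 0 < a) (h0 : 0 < α) (h1 : α < 1)
    (hn : 1 ≤ n) (hβ : 0 < β) (hq : 0 < q) (hR : n * q ≤ (1 + n⁻¹) * R) :
    n * Real.log (α * ((2 * a + n * α) / (β + α * R)) + 1 - α) ≤
      n * (1 - α) * (q - 1) + (1 + 4 * a) - n * Real.log q := by
  have hn0 : 0 < n := by linarith
  have hni : n⁻¹ ≤ 1 := inv_le_one_of_one_le₀ hn
  have hRpos : 0 < R := pos_of_mul_pos_right ((mul_pos hn0 hq).trans_le hR) (by positivity)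
  have hden : 0 < β + α * R := by positivity
  have hY0 : 0 < α * ((2 * a + n * α) / (β + α * R)) + 1 - α := by
    have : 0 < α * ((2 * a + n * α) / (β + α * R)) := by positivity
    linarith
  have d1 : α / (β + α * R) ≤ 1 / R := by
    rw [div_le_div_iff₀ hden hRpos]; linarith
  have d2 : 1 / R ≤ (1 + n⁻¹) / (n * q) := by
    rw [div_le_div_iff₀ hRpos (by positivity)]; linarith
  have hαw : α * ((2 * a + n * α) / (β + α * R)) ≤ (α + (1 + 4 * a) / n) / q := by
    calc α * ((2 * a + n * α) / (β + α * R)) = (2 * a + n * α) * (α / (β + α * R)) := by ring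
      _ ≤ (2 * a + n * α) * ((1 + n⁻¹) / (n * q)) := by
          have := d1.trans d2
          gcongr
      _ = (α + (α + 2 * a + 2 * a * n⁻¹) / n) / q := by field_simp; ring
      _ ≤ _ := by
          have : α + 2 * a + 2 * a * n⁻¹ ≤ 1 + 4 * a := by nlinarith
          gcongr
  have l1 := Real.log_le_sub_one_of_pos (mul_pos hY0 hq)
  rw [Real.log_mul hY0.ne' hq.ne'] at l1
  have l2 := mul_le_mul_of_nonneg_right hαw hq.le
  rw [div_mul_cancel₀ _ hq.ne'] at l2
  have l3 : Real.log (α * ((2 * a + n * α) / (β + α * R)) + 1 - α) ≤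
      (1 - α) * (q - 1) + (1 + 4 * a) / n - Real.log q := by linarith
  calc _ ≤ n * ((1 - α) * (q - 1) + (1 + 4 * a) / n - Real.log q) := by gcongr
    _ = _ := by field_simp

/-- Here `e` is the standardized noise and `v` the standardized signal error. If the noise
dominates, `X > 16n²V`, then `log_precision_le` applies. Otherwise the logarithm is bounded only by
its worst value `log (1 + (2a + n)/β)`, so the indicator of this event is majorized by quantities
with small expectation. The parameter `ρ` balances the two majorants. -/
theorem scaleLoss_posterior_le {a α β V : ℝ} {n : ℕ} (ha : 0 < a) (h0 : 0 < α) (h1 : α < 1)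
    (hn : 0 < n) (hβ : 0 < β) (e v : Fin n → ℝ) (hV : ∑ i, v i ^ 2 ≤ V) (j : Fin n)
    (hj : e j ≠ 0) {ρ : ℝ} (hρ : 0 < ρ) :
    n * scaleLoss α ((2 * a + n * α) / (β + α * ∑ i, (e i - v i) ^ 2)) ≤
      n * ((∑ i, e i ^ 2) / n - 1 - Real.log ((∑ i, e i ^ 2) / n)) + (∑ i, e i ^ 2) / n +
        (1 + 4 * a + β) + (1 + n + 16 * n ^ 2) * V +
        n * Real.log (1 + (2 * a + n) / β) *
          (ρ * |e j| ^ (-(1 / 2) : ℝ) + 16 * n ^ 2 * V / ρ ^ 4) := by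
  have hn' : (0 : ℝ) < n := by exact_mod_cast hn
  have hn1 : (1 : ℝ) ≤ n := by exact_mod_cast hn
  set X := ∑ i, e i ^ 2 with hX
  set R := ∑ i, (e i - v i) ^ 2 with hR
  set q := X / n with hq
  have hXj : e j ^ 2 ≤ X := Finset.single_le_sum (f := fun i => e i ^ 2)
    (fun i _ => sq_nonneg _) (Finset.mem_univ j)
  have hX0 : 0 < X := lt_of_lt_of_le (by positivity) hXj
  have hq0 : 0 < q := by positivity
  have hR0 : 0 ≤ R := Finset.sum_nonneg fun i _ => sq_nonneg _
  have hV0 : 0 ≤ V := (Finset.sum_nonneg fun i _ => sq_nonneg _).trans hV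
  have hXq : X = n * q := by rw [hq]; field_simp
  set den := β + α * R with hden
  have hden0 : 0 < den := by positivity
  set w := (2 * a + n * α) / den with hw
  have hw0 : 0 < w := by positivity
  have hA : -(n * (α * Real.log w)) ≤ n * α * (q - 1) + q + (1 + n) * V + β := by
    have hnα : 0 < n * α := by positivity
    have l1 : Real.log ((n * α) / den) ≤ Real.log w := by
      apply Real.log_le_log (by positivity)
      rw [hw]; gcongr; linarith
    have l2 := Real.log_le_sub_one_of_pos (show 0 < den / (n * α) by positivity)
    rw [← inv_div, Real.log_inv] at l1
    have l3 : -(n * (α * Real.log w)) ≤ n * α * (den / (n * α) - 1) := by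
      have : n * α * (-Real.log w) ≤ n * α * (den / (n * α) - 1) := by gcongr; linarith
      linarith
    have l4 : n * α * (den / (n * α) - 1) = den - n * α := by field_simp
    have hRle := sum_sq_sub_le e v (inv_pos.2 hn')
    rw [inv_inv, ← hX, ← hR] at hRle
    have hRle2 : R ≤ X + q + (1 + n) * V := by
      have : (1 + (n : ℝ)) * ∑ i, v i ^ 2 ≤ (1 + n) * V := by gcongr
      have e2 : (1 + (n : ℝ)⁻¹) * X = X + q := by rw [hq]; ring
      linarith
    have : α * R ≤ α * X + q + (1 + n) * V := by
      calc α * R ≤ α * (X + (q + (1 + n) * V)) := by gcongr; linarith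
        _ = α * X + α * (q + (1 + n) * V) := by ring
        _ ≤ α * X + 1 * (q + (1 + n) * V) := by gcongr
        _ = _ := by ring
    rw [hXq] at this
    rw [l4] at l3
    linarith
  have hlogq : 0 ≤ q - 1 - Real.log q := by linarith [Real.log_le_sub_one_of_pos hq0]
  have hL0 : 0 ≤ n * Real.log (1 + (2 * a + n) / β) := by
    have := Real.log_nonneg (show 1 ≤ 1 + (2 * a + n) / β by
      have : 0 ≤ (2 * a + n) / β := by positivity
      linarith)
    positivity
  have hej : 0 < |e j| := abs_pos.2 hj
  have hI0 : 0 ≤ ρ * |e j| ^ (-(1 / 2) : ℝ) := by positivity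
  have hJ0 : 0 ≤ 16 * n ^ 2 * V / ρ ^ 4 := by positivity
  have hY0 : 0 < α * w + 1 - α := by nlinarith [mul_pos h0 hw0]
  have hsl : n * scaleLoss α w = n * Real.log (α * w + 1 - α) + -(n * (α * Real.log w)) := by
    unfold scaleLoss; ring
  rw [hsl]
  by_cases hbad : X ≤ 16 * n ^ 2 * V
  · have hαw : α * w + 1 - α ≤ 1 + (2 * a + n) / β := by
      have : α * w ≤ 1 * ((2 * a + n) / β) := by
        rw [hw]
        gcongr
        · nlinarith
        · rw [hden]; nlinarith
      linarith
    have hB : n * Real.log (α * w + 1 - α) ≤ n * Real.log (1 + (2 * a + n) / β) := by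
      gcongr
    -- Either `X ≤ ρ⁴`, which forces the single noise term `|e j|` below `ρ²`, or `16n²V ≥ X > ρ⁴`.
    -- In each case one summand is at least one.
    have hone : 1 ≤ ρ * |e j| ^ (-(1 / 2) : ℝ) + 16 * n ^ 2 * V / ρ ^ 4 := by
      by_cases hs : X ≤ ρ ^ 4
      · have h3 : |e j| ≤ ρ ^ 2 := by
          refine abs_le_of_sq_le_sq' ?_ (by positivity) |>.2
          rw [sq_abs]
          linarith [show (ρ ^ 2) ^ 2 = ρ ^ 4 by ring]
        have h4 : |e j| ^ (1 / 2 : ℝ) ≤ ρ := by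
          calc |e j| ^ (1 / 2 : ℝ) ≤ (ρ ^ 2) ^ (1 / 2 : ℝ) := by gcongr
            _ = ρ := by rw [← Real.sqrt_eq_rpow, Real.sqrt_sq hρ.le]
        have h5 : 0 < |e j| ^ (1 / 2 : ℝ) := by positivity
        have : 1 ≤ ρ * |e j| ^ (-(1 / 2) : ℝ) := by
          rw [Real.rpow_neg hej.le, ← div_eq_mul_inv, one_le_div h5]
          exact h4
        linarith
      · have : 1 ≤ 16 * n ^ 2 * V / ρ ^ 4 := by
          rw [one_le_div (by positivity)]
          linarith
        linarith
    have hLone := mul_le_mul_of_nonneg_left hone hL0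
    have hαq : n * α * (q - 1) ≤ 16 * n ^ 2 * V := by
      have : n * α * (q - 1) = α * X - n * α := by rw [hXq]; ring
      have : α * X ≤ 1 * X := by gcongr
      have : 0 ≤ n * α := by positivity
      linarith
    have := mul_nonneg hn'.le hlogq
    linarith
  · push Not at hbad
    -- With `η = 1/(4n)` the cross term and the signal term each cost at most `X/(4n)`, so `R ≥ (1 -
    -- 1/(2n)) X`. This suffices because `(1 + 1/n)(1 - 1/(2n)) ≥ 1`.
    have hRX : X ≤ (1 + (n : ℝ)⁻¹) * R := by
      have hle := le_sum_sq_sub e v (show 0 < (4 * (n : ℝ))⁻¹ by positivity)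
      rw [inv_inv, ← hX, ← hR] at hle
      have h3 : 4 * (n : ℝ) * ∑ i, v i ^ 2 ≤ (4 * (n : ℝ))⁻¹ * X := by
        rw [inv_mul_eq_div, le_div_iff₀ (by positivity)]
        have : ∑ i, v i ^ 2 * (16 * (n : ℝ) ^ 2) ≤ V * (16 * n ^ 2) := by
          rw [← Finset.sum_mul]; gcongr
        rw [← Finset.sum_mul] at this
        nlinarith
      have h4 : (1 - (2 * (n : ℝ))⁻¹) * X ≤ R := by
        have : (2 * (n : ℝ))⁻¹ = (4 * (n : ℝ))⁻¹ + (4 * (n : ℝ))⁻¹ := by field_simp; norm_num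
        rw [this]; linarith
      calc X ≤ (1 + (n : ℝ)⁻¹) * ((1 - (2 * (n : ℝ))⁻¹) * X) := by
            have : (1 + (n : ℝ)⁻¹) * ((1 - (2 * (n : ℝ))⁻¹) * X) =
                X + X * (n - 1) / (2 * n ^ 2) := by field_simp; ring
            rw [this]
            have : 0 ≤ X * (n - 1) / (2 * n ^ 2) := by
              have : 0 ≤ (n : ℝ) - 1 := by linarith
              positivity
            linarith
        _ ≤ _ := by gcongr
    have hRpos : 0 < R := by
      by_contra h
      have : R = 0 := le_antisymm (not_lt.1 h) hR0
      rw [this, mul_zero] at hRX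
      linarith
    have hB : n * Real.log (α * w + 1 - α) ≤
        n * (1 - α) * (q - 1) + (1 + 4 * a) - n * Real.log q :=
      log_precision_le ha h0 h1 hn1 hβ hq0 (by rwa [← hXq])
    have := mul_nonneg hL0 (add_nonneg hI0 hJ0)
    have : 0 ≤ 16 * n ^ 2 * V := by positivity
    linarith

/-! ### Moments of the standardized noise -/

theorem lintegral_linModel_noise {d : ℕ} (ν : Measure (EuclideanSpace ℝ (Fin d)))
    [IsProbabilityMeasure ν] (θ : EuclideanSpace ℝ (Fin d)) {σ : ℝ} (hσ : 0 < σ)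
    {f : ℝ → ℝ≥0∞} (hf : Measurable f) :
    ∫⁻ z, f ((z.1 - inner ℝ z.2 θ) / σ) ∂(linModel ν θ σ) = ∫⁻ x, f x ∂(gaussianReal 0 1) := by
  rw [lintegral_linModel ν θ σ (f := fun _ e => f (e / σ)) (by
    exact hf.comp (f := fun p : EuclideanSpace ℝ (Fin d) × ℝ => p.2 / σ) (by fun_prop))]
  rw [lintegral_const, measure_univ, mul_one]
  have h := gaussianReal_map_div_const (μ := 0) (v := (σ ^ 2).toNNReal) σ
  have h3 : (gaussianReal 0 (σ ^ 2).toNNReal).map (· / σ) = gaussianReal 0 1 := by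
    rw [h, zero_div]
    congr 1
    have hs : 0 < σ ^ 2 := by positivity
    rw [Real.toNNReal_of_nonneg hs.le]
    exact div_self (Subtype.coe_injective.ne_iff.1 hs.ne')
  rw [← h3, lintegral_map hf (by fun_prop)]

theorem lintegral_pi_noise {d n : ℕ} (ν : Measure (EuclideanSpace ℝ (Fin d)))
    [IsProbabilityMeasure ν] (θ : EuclideanSpace ℝ (Fin d)) {σ : ℝ} (hσ : 0 < σ) (i : Fin n)
    {f : ℝ → ℝ≥0∞} (hf : Measurable f) :
    ∫⁻ z, f (((z i).1 - inner ℝ (z i).2 θ) / σ) ∂(Measure.pi fun _ : Fin n => linModel ν θ σ) =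
      ∫⁻ x, f x ∂(gaussianReal 0 1) := by
  rw [lintegral_pi_eval (linModel ν θ σ) i
    (f := fun z => f ((z.1 - inner ℝ z.2 θ) / σ))
    (hf.comp (f := fun z : ℝ × EuclideanSpace ℝ (Fin d) => (z.1 - inner ℝ z.2 θ) / σ)
      (by fun_prop)), lintegral_linModel_noise ν θ hσ hf]

theorem ae_noise_ne_zero {d n : ℕ} (ν : Measure (EuclideanSpace ℝ (Fin d)))
    [IsProbabilityMeasure ν] (θ : EuclideanSpace ℝ (Fin d)) {σ : ℝ} (hσ : 0 < σ) (i : Fin n) :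
    ∀ᵐ z ∂(Measure.pi fun _ : Fin n => linModel ν θ σ),
      ((z i).1 - inner ℝ (z i).2 θ) / σ ≠ 0 := by
  have hf : Measurable (Set.indicator ({0} : Set ℝ) fun _ => (1 : ℝ≥0∞)) :=
    measurable_const.indicator (measurableSet_singleton 0)
  have h := lintegral_pi_noise (n := n) ν θ hσ i hf
  have hg : ∫⁻ x, Set.indicator ({0} : Set ℝ) (fun _ => (1 : ℝ≥0∞)) x ∂(gaussianReal 0 1) = 0 := by
    rw [lintegral_indicator (measurableSet_singleton 0), setLIntegral_one]
    exact gaussianReal_absolutelyContinuous 0 one_ne_zero (by simp)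
  have hm : Measurable fun z : Fin n → ℝ × EuclideanSpace ℝ (Fin d) =>
      Set.indicator ({0} : Set ℝ) (fun _ => (1 : ℝ≥0∞)) (((z i).1 - inner ℝ (z i).2 θ) / σ) :=
    hf.comp (by fun_prop)
  rw [hg, lintegral_eq_zero_iff hm] at h
  filter_upwards [h] with z hz h0
  rw [h0] at hz
  simp at hz

theorem lintegral_exp_neg_mul_sq_gaussianReal {s : ℝ} (hs : 0 ≤ s) :
    ∫⁻ x, ENNReal.ofReal (Real.exp (-(s * x ^ 2))) ∂(gaussianReal 0 1) =
      ENNReal.ofReal ((1 + 2 * s) ^ (-(1 / 2) : ℝ)) := by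
  have hs1 : 0 < 1 + 2 * s := by linarith
  rw [gaussianReal_of_var_ne_zero 0 one_ne_zero,
    lintegral_withDensity_eq_lintegral_mul _ (by fun_prop) (by fun_prop)]
  have e : ∀ x, (gaussianPDF 0 1 * fun x => ENNReal.ofReal (Real.exp (-(s * x ^ 2)))) x =
      ENNReal.ofReal ((1 + 2 * s) ^ (-(1 / 2) : ℝ)) *
        ENNReal.ofReal (gaussianPDFReal 0 ((1 + 2 * s)⁻¹).toNNReal x) := by
    intro x
    have h1 : gaussianPDFReal 0 1 x = gaussianPDFReal 0 (1 : ℝ).toNNReal x := by simp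
    simp only [Pi.mul_apply, gaussianPDF]
    rw [← ENNReal.ofReal_mul (gaussianPDFReal_nonneg _ _ _), ← ENNReal.ofReal_mul (by positivity),
      h1, gaussianPDFReal_eq_exp 0 one_pos, gaussianPDFReal_eq_exp 0 (inv_pos.2 hs1),
      Real.rpow_def_of_pos hs1, ← Real.exp_add, ← Real.exp_add, Real.log_inv, Real.log_one]
    congr 2
    field_simp
    ring
  simp_rw [e]
  rw [lintegral_const_mul _ (by fun_prop), lintegral_gaussianPDFReal_eq_one _ (by simpa using hs1),
    mul_one]

/-- Any exponent in `(-1, 0)` would be integrable at the origin. The moment is used for the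
probability of small noise and for the entropy when `n = 2`. -/
theorem exists_lintegral_abs_rpow_gaussianReal_le :
    ∃ M : ℝ, 0 ≤ M ∧ ∫⁻ x, ENNReal.ofReal (|x| ^ (-(1 / 2) : ℝ)) ∂(gaussianReal 0 1) ≤
      ENNReal.ofReal M := by
  have h1 : Integrable fun x : ℝ => |x| ^ (-(1 / 2) : ℝ) * Real.exp (-(1 / 2) * |x| ^ 2) := by
    have := (integrable_fun_norm_addHaar (volume : Measure ℝ)
      (f := fun y : ℝ => y ^ (-(1 / 2) : ℝ) * Real.exp (-(1 / 2) * y ^ 2))).2 (by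
        simpa using integrableOn_rpow_mul_exp_neg_mul_sq (show (0 : ℝ) < 1 / 2 by norm_num)
          (show (-1 : ℝ) < -(1 / 2) by norm_num))
    simpa [Real.norm_eq_abs] using this
  have hfin : ∫⁻ x, ENNReal.ofReal (|x| ^ (-(1 / 2) : ℝ)) ∂(gaussianReal 0 1) ≠ ∞ := by
    rw [gaussianReal_of_var_ne_zero 0 one_ne_zero,
      lintegral_withDensity_eq_lintegral_mul _ (by fun_prop) (by fun_prop)]
    refine ne_top_of_le_ne_top h1.lintegral_lt_top.ne (lintegral_mono fun x => ?_)
    simp only [Pi.mul_apply, gaussianPDF]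
    rw [← ENNReal.ofReal_mul (gaussianPDFReal_nonneg _ _ _)]
    refine ENNReal.ofReal_le_ofReal ?_
    rw [mul_comm]
    gcongr
    rw [gaussianPDFReal]
    have h2 : (√(2 * Real.pi * ((1 : NNReal) : ℝ)))⁻¹ ≤ 1 := by
      refine inv_le_one_of_one_le₀ (Real.one_le_sqrt.2 ?_)
      have := Real.pi_gt_three
      simp only [NNReal.coe_one]
      linarith
    have h3 : Real.exp (-(x - 0) ^ 2 / (2 * ((1 : NNReal) : ℝ))) =
        Real.exp (-(1 / 2) * |x| ^ 2) := by
      rw [sq_abs]; congr 1; simp only [NNReal.coe_one]; ring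
    rw [h3]
    exact mul_le_of_le_one_left (Real.exp_pos _).le h2
  exact ⟨_, ENNReal.toReal_nonneg, (ENNReal.ofReal_toReal hfin).ge⟩

theorem lintegral_Ioi_of_hasDerivAt {f F : ℝ → ℝ} {l : ℝ}
    (hd : ∀ s ∈ Set.Ici (0 : ℝ), HasDerivAt F (f s) s) (hf : ∀ s ∈ Set.Ioi (0 : ℝ), 0 ≤ f s)
    (hl : Filter.Tendsto F Filter.atTop (nhds l)) :
    ∫⁻ s in Set.Ioi (0 : ℝ), ENNReal.ofReal (f s) = ENNReal.ofReal (l - F 0) := by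
  rw [← integral_Ioi_of_hasDerivAt_of_nonneg' hd hf hl,
    ofReal_integral_eq_lintegral_ofReal (integrableOn_Ioi_deriv_of_nonneg' hd hf hl)
      ((ae_restrict_iff' measurableSet_Ioi).2 (Filter.Eventually.of_forall hf))]

/-- The Laplace representation turns the inverse moment of a sum into a product over independent
observations. At `X = 0` both sides are `∞`. -/
theorem inv_eq_lintegral_exp {X : ℝ} (hX : 0 ≤ X) :
    (ENNReal.ofReal X)⁻¹ = ∫⁻ s in Set.Ioi (0 : ℝ), ENNReal.ofReal (Real.exp (-(s * X))) := by
  rcases hX.eq_or_lt with rfl | hX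
  · simp
  · rw [lintegral_Ioi_of_hasDerivAt (F := fun s => -(Real.exp (-(s * X)) / X)) (l := 0)]
    · simp [ENNReal.ofReal_inv_of_pos hX]
    · intro s _
      have h := (((hasDerivAt_id s).mul_const X).neg.exp.div_const X).neg
      refine h.congr_deriv ?_
      simp only [id, Pi.neg_apply]
      field_simp
    · exact fun s _ => (Real.exp_pos _).le
    · have h1 : Filter.Tendsto (fun s : ℝ => -(s * X)) Filter.atTop Filter.atBot :=
        Filter.tendsto_neg_atTop_atBot.comp (Filter.tendsto_id.atTop_mul_const hX)
      simpa using ((Real.tendsto_exp_atBot.comp h1).div_const X).neg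

theorem lintegral_Ioi_one_add_two_mul_rpow {n : ℕ} (hn : 3 ≤ n) :
    ∫⁻ s in Set.Ioi (0 : ℝ), ENNReal.ofReal ((1 + 2 * s) ^ (-(n / 2) : ℝ)) =
      ENNReal.ofReal (1 / ((n : ℝ) - 2)) := by
  have hn3 : (3 : ℝ) ≤ n := by exact_mod_cast hn
  have hn2 : (0 : ℝ) < n - 2 := by linarith
  rw [lintegral_Ioi_of_hasDerivAt (F := fun s => -((1 + 2 * s) ^ (1 - n / 2 : ℝ) / (n - 2)))
    (l := 0)]
  · simp
  · intro s hs
    have hs : 0 ≤ s := hs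
    have h1 : HasDerivAt (fun s : ℝ => 1 + 2 * s) 2 s := by
      simpa using ((hasDerivAt_id s).const_mul 2).const_add 1
    have h2 := ((h1.rpow_const (p := 1 - (n : ℝ) / 2)
      (Or.inl (by positivity))).div_const ((n : ℝ) - 2)).neg
    refine h2.congr_deriv ?_
    rw [show (1 : ℝ) - n / 2 - 1 = -(n / 2) by ring]
    field_simp
    ring
  · intro s hs
    have hs : 0 < s := hs
    positivity
  · have h1 : Filter.Tendsto (fun s : ℝ => 1 + 2 * s) Filter.atTop Filter.atTop :=
      Filter.tendsto_atTop_add_const_left _ _ (Filter.tendsto_id.const_mul_atTop two_pos)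
    have h2 := (tendsto_rpow_neg_atTop (show 0 < (n : ℝ) / 2 - 1 by linarith)).comp h1
    have h3 := (h2.div_const ((n : ℝ) - 2)).neg
    simp only [neg_sub, zero_div, neg_zero] at h3
    exact h3

/-- The sum of squares of the standardized noise. -/
noncomputable def noiseSq {d n : ℕ} (θ : EuclideanSpace ℝ (Fin d)) (σ : ℝ)
    (z : Fin n → ℝ × EuclideanSpace ℝ (Fin d)) : ℝ :=
  ∑ i, (((z i).1 - inner ℝ (z i).2 θ) / σ) ^ 2

@[fun_prop]
theorem measurable_noiseSq {d n : ℕ} (θ : EuclideanSpace ℝ (Fin d)) (σ : ℝ) :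
    Measurable (noiseSq (n := n) θ σ) := by
  unfold noiseSq; fun_prop

theorem noiseSq_nonneg {d n : ℕ} (θ : EuclideanSpace ℝ (Fin d)) (σ : ℝ)
    (z : Fin n → ℝ × EuclideanSpace ℝ (Fin d)) : 0 ≤ noiseSq θ σ z :=
  Finset.sum_nonneg fun _ _ => sq_nonneg _

theorem lintegral_noiseSq {d n : ℕ} (ν : Measure (EuclideanSpace ℝ (Fin d)))
    [IsProbabilityMeasure ν] (θ : EuclideanSpace ℝ (Fin d)) {σ : ℝ} (hσ : 0 < σ) :
    ∫⁻ z, ENNReal.ofReal (noiseSq θ σ z) ∂(Measure.pi fun _ : Fin n => linModel ν θ σ) = n := by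
  unfold noiseSq
  simp_rw [ENNReal.ofReal_sum_of_nonneg fun i (_ : i ∈ Finset.univ) => sq_nonneg _]
  rw [lintegral_pi_sum (linModel ν θ σ)
    (f := fun z => ENNReal.ofReal (((z.1 - inner ℝ z.2 θ) / σ) ^ 2)) (by fun_prop),
    lintegral_linModel_noise ν θ hσ (f := fun x => ENNReal.ofReal (x ^ 2)) (by fun_prop),
    lintegral_sq_gaussianReal]
  simp

theorem lintegral_inv_noiseSq {d n : ℕ} (hn : 3 ≤ n) (ν : Measure (EuclideanSpace ℝ (Fin d)))
    [IsProbabilityMeasure ν] (θ : EuclideanSpace ℝ (Fin d)) {σ : ℝ} (hσ : 0 < σ) :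
    ∫⁻ z, (ENNReal.ofReal (noiseSq θ σ z))⁻¹ ∂(Measure.pi fun _ : Fin n => linModel ν θ σ) =
      ENNReal.ofReal (1 / ((n : ℝ) - 2)) := by
  simp_rw [inv_eq_lintegral_exp (noiseSq_nonneg θ σ _)]
  rw [lintegral_lintegral_swap (by fun_prop), ← lintegral_Ioi_one_add_two_mul_rpow hn]
  refine setLIntegral_congr_fun measurableSet_Ioi fun s hs => ?_
  have hs : 0 < s := hs
  have e : ∀ z : Fin n → ℝ × EuclideanSpace ℝ (Fin d),
      ENNReal.ofReal (Real.exp (-(s * noiseSq θ σ z))) = ∏ i, ENNReal.ofReal (Real.exp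
        (-(s * (((z i).1 - inner ℝ (z i).2 θ) / σ) ^ 2))) := by
    intro z
    rw [← ENNReal.ofReal_prod_of_nonneg fun i _ => (Real.exp_pos _).le, ← Real.exp_sum, noiseSq,
      Finset.mul_sum, Finset.sum_neg_distrib]
  simp_rw [e]
  rw [lintegral_pi_prod (linModel ν θ σ)
    (f := fun z => ENNReal.ofReal (Real.exp (-(s * ((z.1 - inner ℝ z.2 θ) / σ) ^ 2))))
    (by fun_prop), lintegral_linModel_noise ν θ hσ
    (f := fun x => ENNReal.ofReal (Real.exp (-(s * x ^ 2)))) (by fun_prop),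
    lintegral_exp_neg_mul_sq_gaussianReal hs.le, ← ENNReal.ofReal_pow (by positivity),
    ← Real.rpow_natCast, ← Real.rpow_mul (by positivity)]
  congr 2; ring

/-- For `n ≥ 3`, `-log q ≤ 1/q - 1` and the inverse chi-square moment `1/(n - 2)` give the bound
`2n/(n - 2) ≤ 6`. For `n = 2` that inverse moment is infinite; the logarithm is controlled by one
coordinate through `-log |e| ≤ 2(|e|^(-1/2) - 1)`. -/
theorem exists_lintegral_entropy_le :
    ∃ M : ℝ, 0 ≤ M ∧ ∀ (d n : ℕ), 2 ≤ n → ∀ (ν : Measure (EuclideanSpace ℝ (Fin d)))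
      [IsProbabilityMeasure ν] (θ : EuclideanSpace ℝ (Fin d)) (σ : ℝ), 0 < σ →
      ∫⁻ z, ENNReal.ofReal (n * (noiseSq θ σ z / n - 1 - Real.log (noiseSq θ σ z / n)))
        ∂(Measure.pi fun _ : Fin n => linModel ν θ σ) ≤ ENNReal.ofReal M := by
  obtain ⟨M, hM0, hM⟩ := exists_lintegral_abs_rpow_gaussianReal_le
  refine ⟨max 6 (2 + 8 * M), by positivity, fun d n hn ν _ θ σ hσ => ?_⟩
  set P := Measure.pi fun _ : Fin n => linModel ν θ σ with hP
  have hn' : (0 : ℝ) < n := by positivity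
  rcases hn.eq_or_lt with hn2 | hn3
  · refine le_trans ?_ (ENNReal.ofReal_le_ofReal (le_max_right _ _))
    subst hn2
    calc _ ≤ ∫⁻ z, (ENNReal.ofReal (noiseSq θ σ z) + ENNReal.ofReal 8 *
            ENNReal.ofReal (|((z 0).1 - inner ℝ (z 0).2 θ) / σ| ^ (-(1 / 2) : ℝ))) ∂P := by
          refine lintegral_mono_ae ?_
          filter_upwards [ae_noise_ne_zero ν θ hσ (0 : Fin 2)] with z hz
          rw [← ENNReal.ofReal_mul (by norm_num),
            ← ENNReal.ofReal_add (noiseSq_nonneg _ _ _) (by positivity)]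
          refine ENNReal.ofReal_le_ofReal ?_
          set e := ((z 0).1 - inner ℝ (z 0).2 θ) / σ with he
          have hX : e ^ 2 ≤ noiseSq θ σ z :=
            Finset.single_le_sum (f := fun i => (((z i).1 - inner ℝ (z i).2 θ) / σ) ^ 2)
              (fun i _ => sq_nonneg _) (Finset.mem_univ 0)
          have hep : 0 < |e| := abs_pos.2 hz
          have hX0 : 0 < noiseSq θ σ z := lt_of_lt_of_le (by positivity) hX
          have l1 := Real.log_le_log (by positivity) hX
          have l2 := Real.log_le_sub_one_of_pos (show 0 < |e| ^ (-(1 / 2) : ℝ) by positivity)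
          rw [Real.log_rpow hep] at l2
          rw [← sq_abs, Real.log_pow] at l1
          push_cast at l1 ⊢
          rw [Real.log_div hX0.ne' two_ne_zero]
          have := Real.log_two_lt_d9
          linarith
      _ ≤ ENNReal.ofReal 2 + ENNReal.ofReal 8 * ENNReal.ofReal M := by
          rw [lintegral_add_left (by fun_prop), lintegral_const_mul' _ _ ENNReal.ofReal_ne_top,
            lintegral_noiseSq ν θ hσ, lintegral_pi_noise ν θ hσ (0 : Fin 2)
              (f := fun x => ENNReal.ofReal (|x| ^ (-(1 / 2) : ℝ))) (by fun_prop)]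
          refine add_le_add ?_ (mul_le_mul' le_rfl hM)
          norm_num
      _ = _ := by
          rw [← ENNReal.ofReal_mul (by norm_num), ← ENNReal.ofReal_add (by norm_num)
            (by positivity)]
  · refine le_trans ?_ (ENNReal.ofReal_le_ofReal (le_max_left _ _))
    have hn3' : (3 : ℝ) ≤ n := by exact_mod_cast hn3
    have hn2 : (0 : ℝ) < n - 2 := by linarith
    set I := ∫⁻ z, ENNReal.ofReal (n * (noiseSq θ σ z / n - 1 - Real.log (noiseSq θ σ z / n))) ∂P
      with hI
    -- The cancellation of the two terms of order `n` against `-2n` is essential. The `2n` is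
    -- carried on the left because subtraction in `ℝ≥0∞` is truncated.
    have h : I + ENNReal.ofReal (2 * n) ≤
        ENNReal.ofReal 6 + ENNReal.ofReal (2 * n) := by
      calc I + ENNReal.ofReal (2 * n) = ∫⁻ z, (ENNReal.ofReal (n * (noiseSq θ σ z / n - 1 -
              Real.log (noiseSq θ σ z / n))) + ENNReal.ofReal (2 * n)) ∂P := by
            rw [lintegral_add_right _ measurable_const, lintegral_const, measure_univ, mul_one]
        _ ≤ ∫⁻ z, (ENNReal.ofReal (noiseSq θ σ z) + ENNReal.ofReal (n ^ 2) *
              (ENNReal.ofReal (noiseSq θ σ z))⁻¹) ∂P := by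
            refine lintegral_mono_ae ?_
            filter_upwards [ae_noise_ne_zero ν θ hσ (⟨0, by omega⟩ : Fin n)] with z hz
            have hX : _ ≤ noiseSq θ σ z :=
              Finset.single_le_sum (f := fun i => (((z i).1 - inner ℝ (z i).2 θ) / σ) ^ 2)
                (fun i _ => sq_nonneg _) (Finset.mem_univ (⟨0, by omega⟩ : Fin n))
            have hX0 : 0 < noiseSq θ σ z := lt_of_lt_of_le (by positivity) hX
            have hq : 0 < noiseSq θ σ z / n := by positivity
            rw [← ENNReal.ofReal_inv_of_pos hX0, ← ENNReal.ofReal_mul (by positivity),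
              ← ENNReal.ofReal_add hX0.le (by positivity), ← ENNReal.ofReal_add (mul_nonneg hn'.le
                (by linarith [Real.log_le_sub_one_of_pos hq])) (by positivity)]
            refine ENNReal.ofReal_le_ofReal ?_
            have l := Real.log_le_sub_one_of_pos (inv_pos.2 hq)
            rw [Real.log_inv] at l
            have l2 : n * (noiseSq θ σ z / n - 1 - Real.log (noiseSq θ σ z / n)) ≤
                n * (noiseSq θ σ z / n - 1 + ((noiseSq θ σ z / n)⁻¹ - 1)) := by
              gcongr; linarith
            have e : n * (noiseSq θ σ z / n - 1 + ((noiseSq θ σ z / n)⁻¹ - 1)) =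
                noiseSq θ σ z + n ^ 2 * (noiseSq θ σ z)⁻¹ - 2 * n := by field_simp; ring
            linarith
        _ = n + ENNReal.ofReal (n ^ 2) * ENNReal.ofReal (1 / ((n : ℝ) - 2)) := by
            rw [lintegral_add_left (by fun_prop), lintegral_const_mul' _ _ ENNReal.ofReal_ne_top,
              lintegral_noiseSq ν θ hσ, lintegral_inv_noiseSq hn3 ν θ hσ]
        _ ≤ _ := by
            rw [← ENNReal.ofReal_natCast n, ← ENNReal.ofReal_mul (by positivity),
              ← ENNReal.ofReal_add (by positivity) (by positivity),
              ← ENNReal.ofReal_add (by positivity) (by positivity)]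
            refine ENNReal.ofReal_le_ofReal ?_
            rw [mul_one_div, ← le_sub_iff_add_le', div_le_iff₀ hn2]
            nlinarith
    exact (ENNReal.add_le_add_iff_right ENNReal.ofReal_ne_top).1 h

/-! ### The regime of large noise level -/

/-- A pointwise bound for the plug-in scale loss, uniform over the `ℓ¹` ball. -/
theorem scaleLoss_le_of_mem_l1Ball {a α b C₁ σ₀ ρ : ℝ} (ha : 0 < a) (h0 : 0 < α) (h1 : α < 1)
    {n d : ℕ} (hn : 0 < n) (hb : 0 < b) (hσ₀ : 0 < σ₀) {θ θ₀ : EuclideanSpace ℝ (Fin d)}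
    (hθ : θ ∈ l1Ball d C₁) (hθ₀ : θ₀ ∈ l1Ball d C₁)
    (z : Fin n → ℝ × EuclideanSpace ℝ (Fin d)) (j : Fin n)
    (hz : ((z j).1 - inner ℝ (z j).2 θ₀) / σ₀ ≠ 0) (hρ : 0 < ρ) :
    n * scaleLoss α ((a + n * α / 2) * σ₀ ^ 2 /
        (b + α * (∑ i, ((z i).1 - inner ℝ (z i).2 θ) ^ 2) / 2)) ≤
      n * (noiseSq θ₀ σ₀ z / n - 1 - Real.log (noiseSq θ₀ σ₀ z / n)) +
        noiseSq θ₀ σ₀ z / n + (1 + 4 * a + 2 * b / σ₀ ^ 2) +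
        (1 + n + 16 * n ^ 2) * (4 * C₁ ^ 2 / σ₀ ^ 2 * ∑ i, ‖(z i).2‖ ^ 2) +
        n * Real.log (1 + (2 * a + n) / (2 * b / σ₀ ^ 2)) *
          (ρ * |((z j).1 - inner ℝ (z j).2 θ₀) / σ₀| ^ (-(1 / 2) : ℝ) +
            16 * n ^ 2 * (4 * C₁ ^ 2 / σ₀ ^ 2 * ∑ i, ‖(z i).2‖ ^ 2) / ρ ^ 4) := by
  have hs : 0 < σ₀ ^ 2 := by positivity
  have hβ : 0 < 2 * b / σ₀ ^ 2 := by positivity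
  have hV : ∑ i, (inner ℝ (z i).2 (θ - θ₀) / σ₀) ^ 2 ≤
      4 * C₁ ^ 2 / σ₀ ^ 2 * ∑ i, ‖(z i).2‖ ^ 2 := by
    rw [Finset.mul_sum]
    refine Finset.sum_le_sum fun i _ => ?_
    have b1 : |inner ℝ (z i).2 (θ - θ₀)| ≤ ‖(z i).2‖ * (2 * C₁) :=
      (abs_real_inner_le_norm _ _).trans
        (mul_le_mul_of_nonneg_left (norm_sub_le_of_mem_l1Ball hθ hθ₀) (norm_nonneg _))
    have b2 := pow_le_pow_left₀ (abs_nonneg _) b1 2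
    rw [sq_abs] at b2
    rw [div_pow, div_mul_eq_mul_div]
    refine div_le_div_of_nonneg_right (b2.trans_eq ?_) hs.le
    ring
  have hsum : ∑ i, ((z i).1 - inner ℝ (z i).2 θ) ^ 2 = σ₀ ^ 2 *
      ∑ i, (((z i).1 - inner ℝ (z i).2 θ₀) / σ₀ - inner ℝ (z i).2 (θ - θ₀) / σ₀) ^ 2 := by
    rw [Finset.mul_sum]
    refine Finset.sum_congr rfl fun i _ => ?_
    rw [← sub_div, div_pow, mul_div_cancel₀ _ hs.ne', inner_sub_right]
    ring
  have hE : 0 ≤ ∑ i, (((z i).1 - inner ℝ (z i).2 θ₀) / σ₀ - inner ℝ (z i).2 (θ - θ₀) / σ₀) ^ 2 :=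
    Finset.sum_nonneg fun i _ => sq_nonneg _
  have h := scaleLoss_posterior_le ha h0 h1 hn hβ
    (fun i => ((z i).1 - inner ℝ (z i).2 θ₀) / σ₀) (fun i => inner ℝ (z i).2 (θ - θ₀) / σ₀)
    hV j hz hρ
  have harg : (a + n * α / 2) * σ₀ ^ 2 / (b + α * (∑ i, ((z i).1 - inner ℝ (z i).2 θ) ^ 2) / 2) =
      (2 * a + n * α) / (2 * b / σ₀ ^ 2 + α *
        ∑ i, (((z i).1 - inner ℝ (z i).2 θ₀) / σ₀ - inner ℝ (z i).2 (θ - θ₀) / σ₀) ^ 2) := by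
    rw [hsum]
    generalize ∑ i, (((z i).1 - inner ℝ (z i).2 θ₀) / σ₀ - inner ℝ (z i).2 (θ - θ₀) / σ₀) ^ 2 = E
      at hE
    rw [div_eq_div_iff (by positivity) (by positivity)]
    field_simp
  rw [harg]
  exact h

/-- The prior cost of the nonzero coordinates is controlled by the sparsity rate. -/
theorem one_add_div_le_div {N s τ C₁ : ℝ} {d : ℕ} (hτ : 0 < τ) (hs : 0 < s) (hsd : s ≤ d)
    (hN : N ≤ C₁ - 2 * d * τ) : 1 + N / (s * τ) ≤ C₁ / τ / s := by
  have h : s * τ ≤ d * τ := mul_le_mul_of_nonneg_right hsd hτ.le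
  have hd : 0 ≤ s * τ := by positivity
  have h2 : 1 + N / (s * τ) = (s * τ + N) / (s * τ) := by field_simp
  rw [h2, div_div, mul_comm τ]
  exact div_le_div_of_nonneg_right (by linarith) hd

set_option maxHeartbeats 1000000 in
/-- When the noise level dominates the signal and the sample size polynomially, the expected
posterior loss is bounded by a constant. -/
theorem exists_lintegral_loss_le_of_large_noise {a σmin : ℝ} (ha : 0 < a) (hσmin : 0 < σmin) :
    ∃ C : ℝ, 0 ≤ C ∧ ∀ (α : ℝ), 0 < α → α < 1 → ∀ (n d : ℕ)
      (ν : Measure (EuclideanSpace ℝ (Fin d))) [IsProbabilityMeasure ν]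
      (Cx C₁ τ y σ₀ : ℝ) (θ₀ : EuclideanSpace ℝ (Fin d)),
      2 ≤ n → ∫⁻ x, ENNReal.ofReal (‖x‖ ^ 2) ∂ν ≤ ENNReal.ofReal (Cx ^ 2) →
      1 ≤ y → σ₀ = y ^ 8 → n ≤ y → n * Cx ^ 2 * C₁ ^ 2 ≤ y ^ 2 → (2 * σmin)⁻¹ < σ₀ ^ 2 →
      θ₀ ∈ l1Ball d C₁ →
      ∫⁻ z, ∫⁻ q, ENNReal.ofReal (n * affinityLoss ν α θ₀ σ₀ q)
          ∂(fracPosterior ((priorTheta d C₁ τ).prod (priorSigma a (√(n : ℝ))⁻¹)) α z)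
        ∂(Measure.pi fun _ : Fin n => linModel ν θ₀ σ₀) ≤ ENNReal.ofReal C := by
  obtain ⟨C, hC0, hC⟩ := exists_posterior_loss_le ha
  obtain ⟨M, hM0, hM⟩ := exists_lintegral_entropy_le
  obtain ⟨M', hM'0, hM'⟩ := exists_lintegral_abs_rpow_gaussianReal_le
  set cL := Real.log (2 * a + 2) + 18 with hcL
  have hcL0 : 0 ≤ cL := by
    have := Real.log_nonneg (show 1 ≤ 2 * a + 2 by linarith)
    positivity
  refine ⟨M + 1 + (1 + 4 * a + 4 * σmin + C + 2) + cL * M' + (72 + 64 * cL), by positivity, ?_⟩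
  intro α h0 h1 n d ν _ Cx C₁ τ y σ₀ θ₀ hn hCx hy hσy hny hsig hσm hθ₀
  have hy0 : 0 < y := by linarith
  have hσ₀ : 0 < σ₀ := by rw [hσy]; positivity
  have hs : 0 < σ₀ ^ 2 := by positivity
  have hn0 : 0 < n := by omega
  have hn' : (0 : ℝ) < n := by exact_mod_cast hn0
  have hn1 : (1 : ℝ) ≤ n := by exact_mod_cast hn0
  set b := (√(n : ℝ))⁻¹ with hb
  have hsn : 0 < √(n : ℝ) := Real.sqrt_pos.2 hn'
  have hb0 : 0 < b := by positivity
  have hb1 : b ≤ 1 := inv_le_one_of_one_le₀ (Real.one_le_sqrt.2 hn1)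
  set β := 2 * b / σ₀ ^ 2 with hβ
  have hβ0 : 0 < β := by positivity
  have hβle : β ≤ 4 * σmin := by
    have h2 := (inv_lt_iff_one_lt_mul₀ (show 0 < 2 * σmin by positivity)).1 hσm
    rw [hβ, div_le_iff₀ hs]
    linarith
  -- The exponents balance as follows: `L = O(y²)`, so `Lρ` is bounded, while `L n²/ρ⁴ = O(y¹²)`
  -- meets a signal-to-noise term of mean `O(y⁻¹⁴)`. The latter comes from `σ₀² = y¹⁶` and a signal
  -- of size at most `y²`.
  set ρ := (y ^ 2)⁻¹ with hρ
  have hρ0 : 0 < ρ := by positivity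
  set L := n * Real.log (1 + (2 * a + n) / β) with hL
  have hL0 : 0 ≤ L := by
    have := Real.log_nonneg (show 1 ≤ 1 + (2 * a + n) / β by
      have : 0 ≤ (2 * a + n) / β := by positivity
      linarith)
    positivity
  -- Here `1/β = σ₀² √n / 2` is polynomial in `y`. Its logarithm is crudely bounded by a multiple of
  -- `y`, and `n ≤ y` supplies the other factor.
  have hLle : L ≤ cL * y ^ 2 := by
    have e1 : 1 + (2 * a + n) / β ≤ (2 * a + 2) * y ^ 18 := by
      have e2 : (2 * a + n) / β = (2 * a + n) * √(n : ℝ) * y ^ 16 / 2 := by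
        rw [hβ, hb, hσy]; field_simp
      have e3 : √(n : ℝ) ≤ y := (Real.sqrt_le_iff.2 ⟨hn'.le, by nlinarith⟩ : √(n : ℝ) ≤ n).trans hny
      have e4 : 2 * a + n ≤ (2 * a + 1) * y := by nlinarith
      have e5 : (2 * a + n) * √(n : ℝ) * y ^ 16 / 2 ≤ (2 * a + 1) * y * y * y ^ 16 / 2 := by
        gcongr
      have e6 : 1 ≤ y ^ 18 := one_le_pow₀ hy
      have e7 : (2 * a + 1) * y * y * y ^ 16 / 2 = (2 * a + 1) / 2 * y ^ 18 := by ring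
      rw [e2]
      nlinarith
    have e8 : Real.log (1 + (2 * a + n) / β) ≤ cL * y := by
      calc _ ≤ Real.log ((2 * a + 2) * y ^ 18) := Real.log_le_log (by positivity) e1
        _ = Real.log (2 * a + 2) + 18 * Real.log y := by
          rw [Real.log_mul (by positivity) (by positivity), Real.log_pow]; norm_num
        _ ≤ Real.log (2 * a + 2) * y + 18 * y := by
          have l1 := Real.log_nonneg (show 1 ≤ 2 * a + 2 by linarith)
          have l2 := Real.log_le_sub_one_of_pos hy0
          nlinarith
        _ = _ := by rw [hcL]; ring
    have e9 : 0 ≤ Real.log (1 + (2 * a + n) / β) :=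
      Real.log_nonneg (by
        have : 0 ≤ (2 * a + n) / β := by positivity
        linarith)
    calc L ≤ y * (cL * y) := by rw [hL]; gcongr
      _ = _ := by ring
  set W := 4 * C₁ ^ 2 / σ₀ ^ 2 with hW
  set kV := ((1 + n + 16 * n ^ 2) + L * (16 * n ^ 2 / ρ ^ 4)) * W with hkV
  have hkV0 : 0 ≤ kV := by positivity
  have hkVle : kV * (n * Cx ^ 2) ≤ 72 + 64 * cL := by
    have f1 : W * (n * Cx ^ 2) ≤ 4 / y ^ 14 := by
      calc W * (n * Cx ^ 2) = 4 * (n * Cx ^ 2 * C₁ ^ 2) / σ₀ ^ 2 := by rw [hW]; ring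
        _ ≤ 4 * y ^ 2 / σ₀ ^ 2 := by gcongr
        _ = 4 / y ^ 14 := by rw [hσy]; field_simp
    have f2 : (1 + n + 16 * (n : ℝ) ^ 2) ≤ 18 * y ^ 12 := by
      have g1 : (n : ℝ) ^ 2 ≤ y ^ 2 := by gcongr
      have g2 : y ^ 2 ≤ y ^ 12 := pow_le_pow_right₀ hy (by norm_num)
      nlinarith
    have f3 : L * (16 * n ^ 2 / ρ ^ 4) ≤ 16 * cL * y ^ 12 := by
      have g1 : 16 * (n : ℝ) ^ 2 / ρ ^ 4 ≤ 16 * y ^ 10 := by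
        have : 16 * (n : ℝ) ^ 2 / ρ ^ 4 = 16 * n ^ 2 * y ^ 8 := by rw [hρ]; field_simp
        rw [this]
        calc 16 * (n : ℝ) ^ 2 * y ^ 8 ≤ 16 * y ^ 2 * y ^ 8 := by gcongr
          _ = _ := by ring
      calc _ ≤ (cL * y ^ 2) * (16 * y ^ 10) := by gcongr
        _ = _ := by ring
    calc kV * (n * Cx ^ 2) = ((1 + n + 16 * n ^ 2) + L * (16 * n ^ 2 / ρ ^ 4)) *
          (W * (n * Cx ^ 2)) := by rw [hkV]; ring
      _ ≤ (18 * y ^ 12 + 16 * cL * y ^ 12) * (4 / y ^ 14) := by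
          gcongr
      _ = (72 + 64 * cL) * (y ^ 2)⁻¹ := by field_simp; ring
      _ ≤ (72 + 64 * cL) * 1 := by
          gcongr
          exact inv_le_one_of_one_le₀ (one_le_pow₀ hy)
      _ = _ := mul_one _
  have hkI : L * ρ ≤ cL := by
    calc L * ρ ≤ cL * y ^ 2 * ρ := by gcongr
      _ = cL := by rw [hρ]; field_simp
  have hbias : 2 * (n * Cx ^ 2 * C₁ ^ 2 / σ₀ ^ 2) ≤ 2 := by
    have : n * Cx ^ 2 * C₁ ^ 2 / σ₀ ^ 2 ≤ 1 := by
      rw [div_le_one hs, hσy, ← pow_mul]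
      exact hsig.trans (pow_le_pow_right₀ hy (by norm_num))
    linarith
  set K₀ := 1 + 4 * a + 4 * σmin + C + 2 with hK₀
  have hK₀0 : 0 ≤ K₀ := by positivity
  set j : Fin n := ⟨0, hn0⟩ with hj
  set P := Measure.pi fun _ : Fin n => linModel ν θ₀ σ₀ with hP
  have hpt : ∀ᵐ z ∂P, ∫⁻ q, ENNReal.ofReal (n * affinityLoss ν α θ₀ σ₀ q)
      ∂(fracPosterior ((priorTheta d C₁ τ).prod (priorSigma a b)) α z) ≤
      ENNReal.ofReal (n * (noiseSq θ₀ σ₀ z / n - 1 - Real.log (noiseSq θ₀ σ₀ z / n))) +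
        (ENNReal.ofReal (n : ℝ)⁻¹ * ENNReal.ofReal (noiseSq θ₀ σ₀ z) + (ENNReal.ofReal K₀ +
        (ENNReal.ofReal (L * ρ) *
          ENNReal.ofReal (|((z j).1 - inner ℝ (z j).2 θ₀) / σ₀| ^ (-(1 / 2) : ℝ)) +
        ENNReal.ofReal kV * ∑ i, ENNReal.ofReal (‖(z i).2‖ ^ 2)))) := by
    filter_upwards [ae_noise_ne_zero ν θ₀ hσ₀ j] with z hz
    set e : Fin n → ℝ := fun i => ((z i).1 - inner ℝ (z i).2 θ₀) / σ₀ with he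
    set V := W * ∑ i, ‖(z i).2‖ ^ 2 with hV
    have hS0 : 0 ≤ ∑ i, ‖(z i).2‖ ^ 2 := Finset.sum_nonneg fun i _ => by positivity
    have hX : ∑ i, e i ^ 2 = noiseSq θ₀ σ₀ z := rfl
    set F := n * (noiseSq θ₀ σ₀ z / n - 1 - Real.log (noiseSq θ₀ σ₀ z / n)) +
      noiseSq θ₀ σ₀ z / n + (1 + 4 * a + β) + (1 + n + 16 * n ^ 2) * V +
        L * (ρ * |e j| ^ (-(1 / 2) : ℝ) + 16 * n ^ 2 * V / ρ ^ 4) with hF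
    have hFb : ∀ θ ∈ l1Ball d C₁, n * scaleLoss α ((a + n * α / 2) * σ₀ ^ 2 /
        (b + α * (∑ i, ((z i).1 - inner ℝ (z i).2 θ) ^ 2) / 2)) ≤ F := by
      intro θ hθ
      rw [hF, hV, hW]
      exact scaleLoss_le_of_mem_l1Ball ha h0 h1 hn0 hb0 hσ₀ hθ hθ₀ z j hz hρ0
    refine (hC α h0 h1 n d ν Cx C₁ τ b σ₀ F θ₀ hCx hb0 hσ₀ hθ₀ z hFb).trans ?_
    have hX0 : 0 ≤ noiseSq θ₀ σ₀ z := noiseSq_nonneg _ _ _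
    rw [← ENNReal.ofReal_sum_of_nonneg fun i _ => by positivity,
      ← ENNReal.ofReal_mul (by positivity), ← ENNReal.ofReal_mul (by positivity),
      ← ENNReal.ofReal_mul (by positivity), ← ENNReal.ofReal_add (by positivity) (by positivity),
      ← ENNReal.ofReal_add (by positivity) (by positivity),
      ← ENNReal.ofReal_add (by positivity) (by positivity)]
    refine le_trans (ENNReal.ofReal_le_ofReal ?_) ENNReal.ofReal_add_le
    rw [hF, hK₀]
    have e1 : (1 + n + 16 * n ^ 2) * V + L * (ρ * |e j| ^ (-(1 / 2) : ℝ) + 16 * n ^ 2 * V / ρ ^ 4) =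
        L * ρ * |e j| ^ (-(1 / 2) : ℝ) + kV * ∑ i, ‖(z i).2‖ ^ 2 := by
      rw [hkV, hV]; ring
    have e2 : noiseSq θ₀ σ₀ z / n = (n : ℝ)⁻¹ * noiseSq θ₀ σ₀ z := by ring
    linarith
  refine (lintegral_mono_ae hpt).trans ?_
  rw [lintegral_add_left (by fun_prop), lintegral_add_left (by fun_prop),
    lintegral_add_left (by fun_prop), lintegral_add_left (by fun_prop),
    lintegral_const_mul' _ _ ENNReal.ofReal_ne_top, lintegral_const_mul' _ _ ENNReal.ofReal_ne_top,
    lintegral_const_mul' _ _ ENNReal.ofReal_ne_top, lintegral_noiseSq ν θ₀ hσ₀,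
    lintegral_pi_noise ν θ₀ hσ₀ j (f := fun x => ENNReal.ofReal (|x| ^ (-(1 / 2) : ℝ)))
      (by fun_prop),
    lintegral_pi_sum (linModel ν θ₀ σ₀) (f := fun z => ENNReal.ofReal (‖z.2‖ ^ 2)) (by fun_prop),
    lintegral_linModel_norm_sq, lintegral_const, measure_univ, mul_one]
  calc _ ≤ ENNReal.ofReal M + (ENNReal.ofReal (n : ℝ)⁻¹ * n + (ENNReal.ofReal K₀ +
        (ENNReal.ofReal (L * ρ) * ENNReal.ofReal M' +
          ENNReal.ofReal kV * (n * ENNReal.ofReal (Cx ^ 2))))) := by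
        gcongr
        exact hM d n hn ν θ₀ σ₀ hσ₀
    _ = ENNReal.ofReal (M + ((n : ℝ)⁻¹ * n + (K₀ + (L * ρ * M' + kV * (n * Cx ^ 2))))) := by
        rw [← ENNReal.ofReal_natCast n, ← ENNReal.ofReal_mul (by positivity),
          ← ENNReal.ofReal_mul (by positivity), ← ENNReal.ofReal_mul (by positivity),
          ← ENNReal.ofReal_mul (by positivity), ← ENNReal.ofReal_add (by positivity)
          (by positivity), ← ENNReal.ofReal_add (by positivity) (by positivity),
          ← ENNReal.ofReal_add (by positivity) (by positivity),
          ← ENNReal.ofReal_add (by positivity) (by positivity)]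
    _ ≤ _ := by
        refine ENNReal.ofReal_le_ofReal ?_
        rw [inv_mul_cancel₀ hn'.ne']
        have : L * ρ * M' ≤ cL * M' := by gcongr
        linarith

/-! ### The main theorem -/

theorem renyi_posterior_eq {a α : ℝ} (h0 : 0 < α) (h1 : α < 1) {n d : ℕ} (hn : 0 < n)
    (ν : Measure (EuclideanSpace ℝ (Fin d))) [IsProbabilityMeasure ν] {Cx C₁ τ b σ₀ : ℝ}
    (θ₀ : EuclideanSpace ℝ (Fin d)) (hσ₀ : 0 < σ₀) (ha : 0 < a) (hb : 0 < b)
    (hCx : ∫⁻ x, ENNReal.ofReal (‖x‖ ^ 2) ∂ν ≤ ENNReal.ofReal (Cx ^ 2))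
    (z : Fin n → ℝ × EuclideanSpace ℝ (Fin d)) :
    ∫⁻ q, renyiDiv α (linModel ν q.1 q.2) (linModel ν θ₀ σ₀)
        ∂(fracPosterior ((priorTheta d C₁ τ).prod (priorSigma a b)) α z) =
      ENNReal.ofReal ((n * (1 - α))⁻¹) * ∫⁻ q, ENNReal.ofReal (n * affinityLoss ν α θ₀ σ₀ q)
        ∂(fracPosterior ((priorTheta d C₁ τ).prod (priorSigma a b)) α z) := by
  have hn' : (0 : ℝ) < n := by exact_mod_cast hn
  have h1' : 0 < 1 - α := by linarith
  have hfin : IsProbabilityMeasure (priorSigma a b) := ⟨priorSigma_univ ha hb⟩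
  have hae : ∀ᵐ q ∂(fracPosterior ((priorTheta d C₁ τ).prod (priorSigma a b)) α z), 0 < q.2 := by
    unfold fracPosterior normalizeMeasure
    refine Measure.ae_smul_measure ?_ _
    refine (withDensity_absolutelyContinuous _ _).ae_le ?_
    exact Measure.quasiMeasurePreserving_snd.ae (ae_priorSigma_pos a b)
  rw [← lintegral_const_mul' _ _ ENNReal.ofReal_ne_top]
  refine lintegral_congr_ae ?_
  filter_upwards [hae] with q hq
  rw [renyiDiv_linModel_eq_affinityLoss ν h0 h1 q.1 θ₀ hq hσ₀ hCx,
    ← ENNReal.ofReal_mul (by positivity)]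
  congr 1
  field_simp

set_option maxHeartbeats 1000000 in
theorem mainTheorem6 (a σmin : ℝ) (ha : 0 < a) (hσmin : 0 < σmin) :
    ∃ c : ℝ, 0 < c ∧
      ∀ (α : ℝ), 0 < α → α < 1 →
      ∀ (n d : ℕ) (ν : Measure (EuclideanSpace ℝ (Fin d))) [IsProbabilityMeasure ν]
        (Cx C₁ τ : ℝ) (Θ : Set (EuclideanSpace ℝ (Fin d)))
        (θ₀ : EuclideanSpace ℝ (Fin d)) (σ₀ : ℝ),
        1 ≤ sparsity θ₀ → sparsity θ₀ < n → n < d →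
        0 < Cx →
        ∫⁻ x, ENNReal.ofReal (‖x‖ ^ 2) ∂ν < ENNReal.ofReal (Cx ^ 2) →
        0 < σ₀ → (2 * σmin)⁻¹ < σ₀ ^ 2 →
        τ = (Cx * √((n : ℝ) * (d : ℝ)))⁻¹ →
        ∑ i, |θ₀ i| ≤ C₁ - 2 * (d : ℝ) * τ →
        ∫⁻ z, (∫⁻ q, renyiDiv α (linModel ν q.1 q.2) (linModel ν θ₀ σ₀)
            ∂(fracPosterior ((priorTheta d C₁ τ).prod (priorSigma a (√(n : ℝ))⁻¹)) α z))
          ∂(Measure.pi (fun _ : Fin n => linModel ν θ₀ σ₀))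
        ≤ ENNReal.ofReal (α / (1 - α)) *
            (⨅ θ ∈ Θ, InformationTheory.klDiv (linModel ν θ₀ σ₀) (linModel ν θ σ₀))
          + ENNReal.ofReal
              (c * ((1 + α) / (1 - α)) * sparseRate n d (sparsity θ₀) Cx C₁) := by
  obtain ⟨C, hC0, hC⟩ := exists_lintegral_loss_le_of_large_noise ha hσmin
  set C' := Real.log (Real.Gamma a) + (a + 1) * Real.log 2 + Real.log (4 / 3) + 2 + 10 * σmin
    with hC'
  -- Each summand pays for one cost in units of `A`: `6` for the shift in `θ`, `48 a` for `a log
  -- σ₀²` when `σ₀² ≤ Q^16`, `3 (1 + a/2)` for the `log n` term, and `2|C'|`, `2C` for constants,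
  -- since `A ≥ 1/2`.
  refine ⟨6 + 48 * a + (1 + a / 2) * 3 + 2 * |C'| + 2 * C, by positivity, ?_⟩
  intro α h0 h1 n d ν _ Cx C₁ τ Θ θ₀ σ₀ hs1 hsn hnd hCx0 hCx hσ₀ hσm hτ hθ₀
  -- The Kullback–Leibler term is discarded, so nothing about `Θ` matters from here on.
  refine le_trans ?_ le_add_self
  set c := 6 + 48 * a + (1 + a / 2) * 3 + 2 * |C'| + 2 * C with hc
  set s := sparsity θ₀ with hsd
  have h1' : 0 < 1 - α := by linarith
  have hn0 : 0 < n := by omega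
  have hd0 : 0 < d := by omega
  have hn' : (0 : ℝ) < n := by exact_mod_cast hn0
  have hn1 : (1 : ℝ) ≤ n := by exact_mod_cast hn0
  have hd' : (0 : ℝ) < d := by exact_mod_cast hd0
  have hs1' : (1 : ℝ) ≤ s := by exact_mod_cast hs1
  have hs0 : (0 : ℝ) < s := by linarith
  have hsnR : (s : ℝ) ≤ n := by exact_mod_cast hsn.le
  have hndR : (n : ℝ) ≤ d := by exact_mod_cast hnd.le
  have hsq : 0 < √((n : ℝ) * d) := Real.sqrt_pos.2 (by positivity)
  have hτ0 : 0 < τ := by rw [hτ]; positivity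
  set Q := Cx * C₁ * √((n : ℝ) * d) with hQ
  have hC₁τ : C₁ / τ = Q := by rw [hτ, hQ]; field_simp
  have hN0 : 0 ≤ ∑ i, |θ₀ i| := Finset.sum_nonneg fun _ _ => abs_nonneg _
  have hC₁ge : 2 * d * τ ≤ C₁ := by linarith
  -- The margin `2dτ ≤ C₁` forces `Q ≥ 2d ≥ 2s`. Hence `log (Q/s) ≥ log 2`, which is what lets `A`
  -- absorb constants, `s`, `log n` and `log Q`.
  have hQd : 2 * d ≤ Q := by rw [← hC₁τ, le_div_iff₀ hτ0]; exact hC₁ge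
  have hQ0 : 0 < Q := by linarith
  have hlog2 : 1 / 2 < Real.log 2 := by linarith [Real.log_two_gt_d9]
  set A := s * Real.log (Q / s) with hA
  have hlogQs : Real.log 2 ≤ Real.log (Q / s) :=
    Real.log_le_log two_pos (by rw [le_div_iff₀ hs0]; linarith)
  have hAs : s * Real.log 2 ≤ A := by rw [hA]; gcongr
  have hA2 : 1 / 2 ≤ A := by nlinarith
  have hAQ : Real.log Q ≤ 3 * A := by
    have e1 : Real.log Q = Real.log (Q / s) + Real.log s := by
      rw [Real.log_div hQ0.ne' hs0.ne']; ring
    have e2 : Real.log (Q / s) ≤ A := by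
      rw [hA]; exact le_mul_of_one_le_left (by linarith) hs1'
    have e3 := Real.log_le_sub_one_of_pos hs0
    nlinarith
  have key : ∫⁻ z, ∫⁻ q, ENNReal.ofReal (n * affinityLoss ν α θ₀ σ₀ q)
        ∂(fracPosterior ((priorTheta d C₁ τ).prod (priorSigma a (√(n : ℝ))⁻¹)) α z)
      ∂(Measure.pi fun _ : Fin n => linModel ν θ₀ σ₀) ≤ ENNReal.ofReal (c * A) := by
    -- Below the threshold `log σ₀² ≤ 16 log Q ≤ 48 A`. Above it `y = σ₀^(1/8)` exceeds `Q`, and so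
    -- dominates both `n` and the signal size.
    rcases le_or_gt (σ₀ ^ 2) (Q ^ 16) with hcase | hcase
    · refine (lintegral_loss_le_of_prior_mass ha hσmin h0 h1 hn0 hd0 ν θ₀ hCx0 hCx.le hσ₀ hσm hτ
        hθ₀).trans (ENNReal.ofReal_le_ofReal ?_)
      have k1 := sum_shiftCost_le hτ0 θ₀ hs1
      rw [← hsd] at k1
      have k2 : s * Real.log (1 + (∑ i, |θ₀ i|) / (s * τ)) ≤ A := by
        rw [hA]
        refine mul_le_mul_of_nonneg_left (Real.log_le_log (by positivity) ?_) hs0.le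
        rw [← hC₁τ]
        exact one_add_div_le_div hτ0 hs0 (hsnR.trans hndR) hθ₀
      have k3 : Real.log (σ₀ ^ 2) ≤ 48 * A := by
        have := Real.log_le_log (by positivity) hcase
        rw [Real.log_pow Q] at this
        push_cast at this
        linarith
      have k4 : Real.log n ≤ 3 * A :=
        (Real.log_le_log hn' (by linarith)).trans hAQ
      have k5 : a * Real.log (σ₀ ^ 2) ≤ a * (48 * A) := by gcongr
      have k6 : (1 + a / 2) * Real.log n ≤ (1 + a / 2) * (3 * A) := by gcongr
      have k7 : C' ≤ 2 * |C'| * A := by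
        have := mul_le_mul_of_nonneg_left hA2 (abs_nonneg C')
        linarith [le_abs_self C']
      have k8 : 0 ≤ C * A := by positivity
      rw [hc]
      linarith
    · set y := σ₀ ^ (1 / 8 : ℝ) with hy
      have hyσ : σ₀ = y ^ 8 := by
        rw [hy, ← Real.rpow_natCast, ← Real.rpow_mul hσ₀.le]; norm_num
      have hy0 : 0 < y := by positivity
      have hQy : Q ≤ y := by
        rw [hyσ, ← pow_mul] at hcase
        exact (lt_of_pow_lt_pow_left₀ 16 hy0.le hcase).le
      have hk := hC α h0 h1 n d ν Cx C₁ τ y σ₀ θ₀ (by omega) hCx.le (by linarith) hyσ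
        (by linarith) (by
          calc (n : ℝ) * Cx ^ 2 * C₁ ^ 2 ≤ (n * d) * Cx ^ 2 * C₁ ^ 2 := by
                gcongr
                exact le_mul_of_one_le_right hn'.le (by linarith)
            _ = Q ^ 2 := by rw [hQ, mul_pow, mul_pow, Real.sq_sqrt (by positivity)]; ring
            _ ≤ y ^ 2 := by gcongr) hσm (show ∑ i, |θ₀ i| ≤ C₁ by nlinarith)
      refine hk.trans (ENNReal.ofReal_le_ofReal ?_)
      have k9 : C ≤ 2 * C * A := by nlinarith
      have k10 : 0 ≤ (6 + 48 * a + (1 + a / 2) * 3 + 2 * |C'|) * A := by positivity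
      rw [hc]
      linarith
  simp_rw [renyi_posterior_eq h0 h1 hn0 ν θ₀ hσ₀ ha (inv_pos.2 (Real.sqrt_pos.2 hn')) hCx.le]
  rw [lintegral_const_mul' _ _ ENNReal.ofReal_ne_top]
  refine (mul_le_mul' le_rfl key).trans ?_
  rw [← ENNReal.ofReal_mul (by positivity)]
  refine ENNReal.ofReal_le_ofReal ?_
  have hrate : sparseRate n d s Cx C₁ = A / n := rfl
  rw [hrate]
  have hcA : 0 ≤ c * A / (n * (1 - α)) := by positivity
  calc ((n : ℝ) * (1 - α))⁻¹ * (c * A) = 1 * (c * A / (n * (1 - α))) := by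
        rw [one_mul, div_eq_inv_mul]
    _ ≤ (1 + α) * (c * A / (n * (1 - α))) := by gcongr; linarith
    _ = _ := by field_simp
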